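/- Let $\mathcal A$ be a unital associative algebra over $\mathbb C$, let $\mathcal H$ be a complex Hilbert space on which $\mathcal A$ acts through a unital algebra homomorphism $\mathcal A\to B(\mathcal H)$, let $F$ be a bounded selfadjoint operator on $\mathcal H$ (it is not assumed that $F^2=1$), and let $p>0$ be a real number with $$[F,a]\in\mathcal L^p\ \ (a\in\mathcal A),\qquad F^2-1\in\mathcal L^{p/2},$$ where $\mathcal L^q$ is the Schatten class. Periodic cyclic cohomology $HP^{*}(\mathcal A)$ is the cohomology of the $(b,B)$-bicomplex: finite sequences of multilinear functionals $\varphi_k$ on $\mathcal A^{k+1}$, $k$ of fixed parity, with differential $b+B$. **Even case.** Suppose moreover that $\gamma$ is a $\mathbb Z/2$-grading of $\mathcal H$ ($\gamma=\gamma^*$, $\gamma^2=1$) for which all $a\in\mathcal A$ are even and $F$ is odd. For $2m\ge p$ let $\mathrm{Ch}_{2m}(F)$ be the cochain with components, for $k=0,2,\dots,2m$, $$\mathrm{Ch}^k(F)(a_0,\dots,a_k)=\frac{m!}{(m+\frac k2)!}\sum_{i_0+\dots+i_k=m-\frac k2}\mathrm{Tr}\,\gamma\,a_0(1-F^2)^{i_0}[F,a_1](1-F^2)^{i_1}\cdots[F,a_k](1-F^2)^{i_k}.$$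 On $\widetilde{\mathcal H}=\mathcal H\oplus\mathcal H$ let $a\in\mathcal A$ act by $\tilde a=a\oplus 0$, and let $\tilde\gamma=\gamma\oplus(-\gamma)$ and $F'=F\oplus(-F)$. Then there is a bounded selfadjoint operator $\widetilde F$ on $\widetilde{\mathcal H}$, odd for $\tilde\gamma$, with $\widetilde F^2=1$ and $\widetilde F-F'\in\mathcal L^p$. Moreover, for every bounded odd $\widetilde F$ (selfadjoint or not) with $\widetilde F^2=1$ and $\widetilde F-F'\in\mathcal L^p$, for every $m$ with $2m\ge p$ and every $m'\geq 0$ with $2m'+1\ge p$: all operators whose traces are taken, in the formula above and in the formula below, are of trace class; $\mathrm{Ch}_{2m}(F)$ is a cocycle; Connes' character of the doubled module, that is, the cochain with the single nonzero component $$\frac{1}{(2m')!}\tau_{2m'},\qquad \tau_{2m'}(a_0,\dots,a_{2m'})=m'!\,\mathrm{Tr}'\big(\tilde\gamma\,\tilde a_0[\widetilde F,\tilde a_1]\cdots[\widetilde F,\tilde a_{2m'}]\big),\qquad \mathrm{Tr}'(T)=\tfrac12\mathrm{Tr}\big(\widetilde F(\widetilde FT+T\widetilde F)\big),$$ is a cocycle;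 and $$[\mathrm{Ch}_{2m}(F)]=\Big[\tfrac{1}{(2m')!}\tau_{2m'}\Big]\in HP^0(\mathcal A).$$ (If $2m'\ge p$, then $\mathrm{Tr}'$ may be replaced by $\mathrm{Tr}$.) **Odd case.** Without a grading, for $2m+1\ge p$ let $\mathrm{Ch}_{2m+1}(F)$ be the cochain with components, for $k=1,3,\dots,2m+1$, $$\mathrm{Ch}^k_{2m+1}(a_0,\dots,a_k)=\frac{\Gamma(m+\frac32)\sqrt{2i}}{(m+\frac{k+1}2)!}\sum_{i_0+\dots+i_k=m-\frac{k-1}2}\mathrm{Tr}\,a_0(1-F^2)^{i_0}[F,a_1](1-F^2)^{i_1}\cdots[F,a_k](1-F^2)^{i_k}.$$ Then the same holds: there is a bounded selfadjoint $\widetilde F$ on $\widetilde{\mathcal H}$ with $\widetilde F^2=1$ and $\widetilde F-F'\in\mathcal L^p$; and for every bounded $\widetilde F$ with $\widetilde F^2=1$ and $\widetilde F-F'\in\mathcal L^p$, every $m\geq 0$ with $2m+1\ge p$ and every $m'\geq 0$ with $2m'+2\ge p$, all operators whose traces are taken are of trace class, $\mathrm{Ch}_{2m+1}(F)$ and the cochain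 with the single nonzero component $\frac{1}{(2m'+1)!}\tau_{2m'+1}$, where $$\tau_{2m'+1}(a_0,\dots,a_{2m'+1})=\sqrt{2i}\,\Gamma(m'+\tfrac32)\,\mathrm{Tr}'\big(\tilde a_0[\widetilde F,\tilde a_1]\cdots[\widetilde F,\tilde a_{2m'+1}]\big),$$ are cocycles, and their classes in $HP^1(\mathcal A)$ are equal. -/

import Mathlib

noncomputable section

namespace CyclicCharacter

/-! ### Periodic cyclic cohomology through the `(b, B)`-bicomplex -/

section Cyclic

variable (A : Type*) [Ring A] [Algebra ℂ A]

/-- A family of functionals `φ n (a₀, …, aₙ)`, one in each degree `n`. -/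
abbrev CochainFamily : Type _ := (n : ℕ) → (Fin (n + 1) → A) → ℂ

variable {A}

/-- The functional `φ` of `n + 1` variables is `ℂ`-multilinear. -/
def IsMultilinear {n : ℕ} (φ : (Fin (n + 1) → A) → ℂ) : Prop :=
  ∃ g : MultilinearMap ℂ (fun _ : Fin (n + 1) => A) ℂ, ⇑g = φ

/-- The Hochschild coboundary
`(b φ)(a₀, …, aₙ₊₁) = ∑_{j ≤ n} (-1)^j φ(a₀, …, a_j a_{j+1}, …, aₙ₊₁)
  + (-1)^(n+1) φ(aₙ₊₁ a₀, a₁, …, aₙ)`. -/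
def hochschildb (n : ℕ) (φ : (Fin (n + 1) → A) → ℂ) : (Fin (n + 2) → A) → ℂ := fun a =>
  (∑ j : Fin (n + 1), (-1 : ℂ) ^ (j : ℕ) * φ (Fin.contractNth j.castSucc (· * ·) a)) +
    (-1 : ℂ) ^ (n + 1) *
      φ (Fin.cons (a (Fin.last (n + 1)) * a 0) (fun i : Fin n => a i.succ.castSucc))

/-- `(B₀ φ)(a₀, …, aₙ) = φ(1, a₀, …, aₙ) - (-1)^(n+1) φ(a₀, …, aₙ, 1)`. -/
def connesB₀ (n : ℕ) (φ : (Fin (n + 2) → A) → ℂ) : (Fin (n + 1) → A) → ℂ := fun a =>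
  φ (Fin.cons 1 a) - (-1 : ℂ) ^ (n + 1) * φ (Fin.snoc (α := fun _ => A) a 1)

/-- Connes' operator `B`, the sum of `B₀ φ` over the signed cyclic permutations
`(-1)^(n j) (B₀ φ)(a_j, a_{j+1}, …, a_{j-1})`, with indices modulo `n + 1`. -/
def connesB (n : ℕ) (φ : (Fin (n + 2) → A) → ℂ) : (Fin (n + 1) → A) → ℂ := fun a =>
  ∑ j : Fin (n + 1), (-1 : ℂ) ^ (n * (j : ℕ)) * connesB₀ n φ (fun i => a (i + j))

variable (A)

/-- The total differential `b + B`. -/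
def totalD : CochainFamily A →ₗ[ℂ] CochainFamily A where
  toFun c := fun n =>
    match n with
    | 0 => connesB 0 (c 1)
    | n + 1 => hochschildb n (c n) + connesB (n + 1) (c (n + 2))
  map_add' c d := by
    funext n a
    cases n <;>
      simp only [hochschildb, connesB, connesB₀, Pi.add_apply, Finset.sum_add_distrib,
        Finset.sum_sub_distrib, mul_add, mul_sub] <;>
      ring
  map_smul' r c := by
    funext n a
    cases n <;>
      simp only [hochschildb, connesB, connesB₀, Pi.add_apply, Pi.smul_apply, smul_eq_mul,
        Finset.mul_sum, RingHom.id_apply, mul_add, mul_sub]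
    · exact Finset.sum_congr rfl fun _ _ => by ring
    · congr 1
      · congr 1
        · exact Finset.sum_congr rfl fun _ _ => by ring
        · ring
      · exact Finset.sum_congr rfl fun _ _ => by ring

/-- Periodic cyclic cochains of parity `i`: finitely many nonzero components, all multilinear and
all in degrees `n ≡ i mod 2`. -/
def periodicCochains (i : ZMod 2) : Submodule ℂ (CochainFamily A) where
  carrier := {c | (∀ n, IsMultilinear (c n)) ∧ (∀ n : ℕ, (n : ZMod 2) ≠ i → c n = 0) ∧
    ∃ N, ∀ n, N < n → c n = 0}
  zero_mem' := ⟨fun _ => ⟨0, rfl⟩, fun _ _ => rfl, 0, fun _ _ => rfl⟩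
  add_mem' := by
    rintro c d ⟨hc, hc', M, hM⟩ ⟨hd, hd', N, hN⟩
    refine ⟨fun n => ?_, fun n hn => by simp [hc' n hn, hd' n hn], max M N, fun n hn => ?_⟩
    · obtain ⟨g, hg⟩ := hc n
      obtain ⟨k, hk⟩ := hd n
      exact ⟨g + k, by funext a; simp [← hg, ← hk]⟩
    · simp [hM n (lt_of_le_of_lt (le_max_left _ _) hn),
        hN n (lt_of_le_of_lt (le_max_right _ _) hn)]
  smul_mem' := by
    rintro r c ⟨hc, hc', M, hM⟩
    refine ⟨fun n => ?_, fun n hn => by simp [hc' n hn], M, fun n hn => by simp [hM n hn]⟩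
    obtain ⟨g, hg⟩ := hc n
    exact ⟨r • g, by funext a; simp [← hg]⟩

/-- Periodic cyclic cocycles of parity `i`. -/
def periodicCocycles (i : ZMod 2) : Submodule ℂ (CochainFamily A) :=
  periodicCochains A i ⊓ LinearMap.ker (totalD A)

/-- Periodic cyclic coboundaries of parity `i`. -/
def periodicCoboundaries (i : ZMod 2) : Submodule ℂ (CochainFamily A) :=
  (periodicCochains A (i + 1)).map (totalD A)

/-- Periodic cyclic cohomology `HP^i(A)`, `i ∈ ℤ/2`, of the unital algebra `A`. -/
abbrev HP (i : ZMod 2) : Type _ :=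
  periodicCocycles A i ⧸ (periodicCoboundaries A i).submoduleOf (periodicCocycles A i)

variable {A}

/-- The class in `HP^i(A)` of a cocycle. -/
def HP.mk {i : ZMod 2} (c : CochainFamily A) (hc : c ∈ periodicCocycles A i) : HP A i :=
  Submodule.Quotient.mk ⟨c, hc⟩

end Cyclic

/-! ### Schatten classes and the trace -/

section Schatten

variable {H : Type*} [NormedAddCommGroup H] [InnerProductSpace ℂ H]

/-- The `n`-th singular number of a bounded operator on a Hilbert space: its distance to the
operators of rank at most `n`. -/
def singularNumber (T : H →L[ℂ] H) (n : ℕ) : ℝ :=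
  ⨅ R : {R : H →L[ℂ] H // LinearMap.rank (R : H →ₗ[ℂ] H) ≤ n}, ‖T - R.1‖

/-- `T` belongs to the Schatten class `𝓛^p` (`0 < p < ∞`): its singular numbers are
`p`-summable. -/
def IsSchatten (p : ℝ) (T : H →L[ℂ] H) : Prop :=
  Summable fun n : ℕ => singularNumber T n ^ p

/-- The trace `∑ᵢ ⟨eᵢ, T eᵢ⟩` of a bounded operator over a Hilbert basis. It is meaningful for
trace class operators `T`, that is `IsSchatten 1 T`, for which the sum converges absolutely and
does not depend on the basis. -/
def opTrace [CompleteSpace H] (T : H →L[ℂ] H) : ℂ :=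
  ∑' i, inner ℂ ((exists_hilbertBasis ℂ H).choose_spec.choose i)
    (T ((exists_hilbertBasis ℂ H).choose_spec.choose i))

end Schatten

/-! ### Fredholm modules and their characters -/

section Fredholm

/-- The data of an odd bounded (pre-)Fredholm module over the unital algebra `A`: a unital
representation on the Hilbert space `H` and a bounded selfadjoint operator `F`; it is not required
that `F² = 1`. -/
structure FredholmModule (A : Type*) [Ring A] [Algebra ℂ A] (H : Type*) [NormedAddCommGroup H]
    [InnerProductSpace ℂ H] [CompleteSpace H] where
  /-- the action of `A` on `H` -/
  rep : A →ₐ[ℂ] (H →L[ℂ] H)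
  /-- the operator of the module -/
  F : H →L[ℂ] H
  selfAdjoint_F : IsSelfAdjoint F

/-- The data of an even bounded (pre-)Fredholm module: moreover a `ℤ/2`-grading `γ` of `H`, for
which `A` acts by even operators and `F` is odd. -/
structure EvenFredholmModule (A : Type*) [Ring A] [Algebra ℂ A] (H : Type*)
    [NormedAddCommGroup H] [InnerProductSpace ℂ H] [CompleteSpace H]
    extends FredholmModule A H where
  /-- the grading operator -/
  γ : H →L[ℂ] H
  selfAdjoint_γ : IsSelfAdjoint γ
  γ_mul_γ : γ * γ = 1
  rep_even : ∀ a, γ * rep a = rep a * γ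
  F_odd : γ * F = -(F * γ)

variable {A : Type*} [Ring A] [Algebra ℂ A]
variable {H : Type*} [NormedAddCommGroup H] [InnerProductSpace ℂ H] [CompleteSpace H]

/-- The summability conditions `[F, a] ∈ 𝓛^p` for all `a` and `F² - 1 ∈ 𝓛^(p/2)`. -/
def FredholmModule.IsSummable (E : FredholmModule A H) (p : ℝ) : Prop :=
  (∀ a, IsSchatten p ⁅E.F, E.rep a⁆) ∧ IsSchatten (p / 2) (E.F ^ 2 - 1)

/-- The operator `a₀ (1 - F²)^{i₀} [F, a₁] (1 - F²)^{i₁} ⋯ [F, a_k] (1 - F²)^{i_k}`. -/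
def FredholmModule.term (E : FredholmModule A H) {k : ℕ} (a : Fin (k + 1) → A)
    (i : Fin (k + 1) → ℕ) : H →L[ℂ] H :=
  E.rep (a 0) * (1 - E.F ^ 2) ^ i 0 *
    (List.ofFn fun j : Fin k => ⁅E.F, E.rep (a j.succ)⁆ * (1 - E.F ^ 2) ^ i j.succ).prod

/-- The character `Ch_{2m}(F)` of an even module: for even `k ≤ 2m` its component is
`m! / (m + k/2)! ∑_{i₀ + ⋯ + i_k = m - k/2} Tr γ a₀ (1 - F²)^{i₀} [F, a₁] ⋯ [F, a_k] (1 - F²)^{i_k}`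
and all other components vanish. -/
def EvenFredholmModule.character (E : EvenFredholmModule A H) (m : ℕ) : CochainFamily A :=
  fun k a =>
    if Even k ∧ k ≤ 2 * m then
      ((m.factorial : ℂ) / ((m + k / 2).factorial : ℂ)) *
        ∑ i ∈ Finset.Nat.antidiagonalTuple (k + 1) (m - k / 2), opTrace (E.γ * E.term a i)
    else 0

/-- The character `Ch_{2m+1}(F)` of an odd module: for odd `k ≤ 2m + 1` its component is
`Γ(m + 3/2) √(2i) / (m + (k+1)/2)! ∑_{i₀ + ⋯ + i_k = m - (k-1)/2}
  Tr a₀ (1 - F²)^{i₀} [F, a₁] ⋯ [F, a_k] (1 - F²)^{i_k}`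
and all other components vanish. -/
def FredholmModule.oddCharacter (E : FredholmModule A H) (m : ℕ) : CochainFamily A :=
  fun k a =>
    if Odd k ∧ k ≤ 2 * m + 1 then
      ((Real.Gamma (m + 3 / 2) : ℂ) * (2 * Complex.I) ^ (1 / 2 : ℂ) /
          ((m + (k + 1) / 2).factorial : ℂ)) *
        ∑ i ∈ Finset.Nat.antidiagonalTuple (k + 1) (m - (k - 1) / 2), opTrace (E.term a i)
    else 0

/-- All traces in the definition of `Ch_{2m}(F)` are traces of trace class operators. -/
def EvenFredholmModule.CharacterTraceClass (E : EvenFredholmModule A H) (m : ℕ) : Prop :=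
  ∀ k : ℕ, Even k → k ≤ 2 * m → ∀ a : Fin (k + 1) → A,
    ∀ i ∈ Finset.Nat.antidiagonalTuple (k + 1) (m - k / 2), IsSchatten 1 (E.γ * E.term a i)

/-- All traces in the definition of `Ch_{2m+1}(F)` are traces of trace class operators. -/
def FredholmModule.OddCharacterTraceClass (E : FredholmModule A H) (m : ℕ) : Prop :=
  ∀ k : ℕ, Odd k → k ≤ 2 * m + 1 → ∀ a : Fin (k + 1) → A,
    ∀ i ∈ Finset.Nat.antidiagonalTuple (k + 1) (m - (k - 1) / 2), IsSchatten 1 (E.term a i)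

/-! ### The doubled module with `F̃² = 1` and Connes' character -/

/-- The Hilbert space `H ⊕ H`. -/
abbrev Double (H : Type*) : Type _ := WithLp 2 (H × H)

/-- The operator `S ⊕ T` on `H ⊕ H`. -/
def diagOp (S T : H →L[ℂ] H) : Double H →L[ℂ] Double H :=
  ((WithLp.prodContinuousLinearEquiv 2 ℂ H H).symm : H × H →L[ℂ] Double H) ∘L
    (S.prodMap T) ∘L ((WithLp.prodContinuousLinearEquiv 2 ℂ H H) : Double H →L[ℂ] H × H)

/-- The action `a ↦ a ⊕ 0` of `A` on `H ⊕ H`. -/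
def FredholmModule.doubleRep (E : FredholmModule A H) (a : A) : Double H →L[ℂ] Double H :=
  diagOp (E.rep a) 0

/-- The grading `γ ⊕ (-γ)` of `H ⊕ H`. -/
def EvenFredholmModule.doubleγ (E : EvenFredholmModule A H) : Double H →L[ℂ] Double H :=
  diagOp E.γ (-E.γ)

/-- `F̃` makes `H ⊕ H` into a doubled module of Connes (without grading): `F̃² = 1` and
`F̃ - (F ⊕ (-F)) ∈ 𝓛^p`. -/
def FredholmModule.IsDouble (E : FredholmModule A H) (p : ℝ)
    (Ft : Double H →L[ℂ] Double H) : Prop :=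
  Ft ^ 2 = 1 ∧ IsSchatten p (Ft - diagOp E.F (-E.F))

/-- `F̃` makes `H ⊕ H` into a graded doubled module of Connes: moreover `F̃` is odd. -/
def EvenFredholmModule.IsEvenDouble (E : EvenFredholmModule A H) (p : ℝ)
    (Ft : Double H →L[ℂ] Double H) : Prop :=
  E.toFredholmModule.IsDouble p Ft ∧ E.doubleγ * Ft = -(Ft * E.doubleγ)

/-- The operator `a₀ [F̃, a₁] ⋯ [F̃, aₙ]` on `H ⊕ H`. -/
def FredholmModule.doubleTerm (E : FredholmModule A H) (Ft : Double H →L[ℂ] Double H) {n : ℕ}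
    (a : Fin (n + 1) → A) : Double H →L[ℂ] Double H :=
  E.doubleRep (a 0) * (List.ofFn fun j : Fin n => ⁅Ft, E.doubleRep (a j.succ)⁆).prod

/-- Connes' regularised trace `Tr'(T) = ½ Tr (F (F T + T F))`, for `F² = 1`. It is defined as soon
as `F T + T F` is trace class, and it is equal to `Tr T` if `T` is trace class. -/
def connesTrace {K : Type*} [NormedAddCommGroup K] [InnerProductSpace ℂ K] [CompleteSpace K]
    (F T : K →L[ℂ] K) : ℂ :=
  (1 / 2) * opTrace (F * (F * T + T * F))

/-- Connes' Chern character of the even doubled module: the cyclic cocycle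
`τ_{2m}(a₀, …, a_{2m}) = m! Tr'(γ̃ a₀ [F̃, a₁] ⋯ [F̃, a_{2m}])`, which is placed in the
`(b, B)`-bicomplex as the cochain with the only nonzero component `τ_{2m} / (2m)!`. -/
def EvenFredholmModule.connesCharacter (E : EvenFredholmModule A H)
    (Ft : Double H →L[ℂ] Double H) (m : ℕ) : CochainFamily A :=
  fun n a =>
    if n = 2 * m then
      ((m.factorial : ℂ) / ((2 * m).factorial : ℂ)) *
        connesTrace Ft (E.doubleγ * E.doubleTerm Ft a)
    else 0

/-- Connes' Chern character of the odd doubled module: the cyclic cocycle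
`τ_{2m+1}(a₀, …, a_{2m+1}) = √(2i) Γ(m + 3/2) Tr'(a₀ [F̃, a₁] ⋯ [F̃, a_{2m+1}])`, which is placed
in the `(b, B)`-bicomplex as the cochain with the only nonzero component `τ_{2m+1} / (2m+1)!`. -/
def FredholmModule.connesOddCharacter (E : FredholmModule A H)
    (Ft : Double H →L[ℂ] Double H) (m : ℕ) : CochainFamily A :=
  fun n a =>
    if n = 2 * m + 1 then
      ((Real.Gamma (m + 3 / 2) : ℂ) * (2 * Complex.I) ^ (1 / 2 : ℂ) /
          ((2 * m + 1).factorial : ℂ)) *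
        connesTrace Ft (E.doubleTerm Ft a)
    else 0

/-- The traces in the definition of Connes' character of the even doubled module are traces of
trace class operators. -/
def EvenFredholmModule.ConnesTraceClass (E : EvenFredholmModule A H)
    (Ft : Double H →L[ℂ] Double H) (m : ℕ) : Prop :=
  ∀ a : Fin (2 * m + 1) → A, IsSchatten 1
    (Ft * (Ft * (E.doubleγ * E.doubleTerm Ft a) + E.doubleγ * E.doubleTerm Ft a * Ft))

/-- The traces in the definition of Connes' character of the odd doubled module are traces of
trace class operators. -/
def FredholmModule.ConnesOddTraceClass (E : FredholmModule A H)
    (Ft : Double H →L[ℂ] Double H) (m : ℕ) : Prop :=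
  ∀ a : Fin (2 * m + 2) → A, IsSchatten 1
    (Ft * (Ft * E.doubleTerm Ft a + E.doubleTerm Ft a * Ft))

end Fredholm

end CyclicCharacter

end

open CyclicCharacter

/-! The argument separates operator theory from algebra. Put `F' = F ⊕ (-F)` and `V = F̃ - F'`. An
operator has weight `k > 0` if it lies in `𝓛^(p/k)`; all bounded operators have weight `0`. Weights
add under products by Hölder (`IsSchatten.mul`), and the trace is cyclic on products of total weight
at least `p` even if no single factor is trace class (`opTrace_comm_of_mem`). `[F', a]` has weight
`1` and `1 - F'²` weight `2`; `V` has weight `1`, and `F'V + VF' = (1 - F'²) - V²` has weight `2`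
because `F̃² = 1`. `TracedModule` records these facts, and from there on everything is algebra.

The sums over exponents `i₀ + ⋯ + i_k = r` are the coefficients of `z^r` in the words `G[F,a₁]G ⋯
[F,a_k]G`, where `G = (1 - z(1 - F²))⁻¹`. These are the homogeneous parts of a geometric series, the
inverse of `1 - z(1 - F²) - [F,·]`, and they satisfy a Bianchi type identity
(`WordRelations.barD_word`): their bar differential consists of two end terms and `z` times a
supercommutator with `F`. Traces annihilate supercommutators with `F` slightly beyond the trace
class (`T_supercommutator`), and the Euler derivation `z d/dz` computes cyclic sums of words
(`cycNorm_word`). With the factor `1/(r + k)!` this gives a cocycle of the cyclic bicomplex, with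
Hochschild and bar columns (`bicomplexHoch_φ_ψ`, `bicomplexBar_φ_ψ`). The bar columns are
contractible, and `bicomplexProj` carries this cocycle to the `(b, B)`-bicomplex.

Along the segment `F' + tV` the derivative of the character is the boundary of the words with one
letter `V` inserted. The path is polynomial in `t`, so the integration over `[0, 1]` is algebraic,
and the characters of `F'` and `F̃` are cohomologous (`char_shift_sub_char`). At `t = 0` the
representation `a ⊕ 0` removes the second copy of `H` and leaves `Ch(F)`. At `t = 1` all powers of
`1 - F̃² = 0` disappear, and only the top component is left.

For `F̃² = 1` one has `F̃(F̃T + TF̃) = γ̃ F̃[F̃,a₀] ⋯ [F̃,aₙ]` when `T = γ̃ a₀[F̃,a₁] ⋯ [F̃,aₙ]`,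
with `γ̃ = 1` in the odd case. So Connes' character exists one degree below the trace class range,
and `periodicity` relates degrees `n` and `n + 2` with the factor `2(n + 1)`. The constants `Γ(n/2 +
1)/n!` absorb this factor (`kappa_eq`), so `m` and `m'` can be chosen independently.

For the existence of `F̃` the block matrix with rows `(c, s)` and `(s, -c)` is used, where `c` is
the truncation of `F` to `[-1, 1]` and `s` is the square root of the positive part of `1 - F²`
(`symmetryOp`). -/

noncomputable section

namespace CyclicCharacter

/-! ### Approximation numbers and Schatten classes. -/

section SingularNumbers

variable {H : Type*} [NormedAddCommGroup H] [InnerProductSpace ℂ H]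

theorem singularNumber_le {T R : H →L[ℂ] H} {n : ℕ}
    (hR : LinearMap.rank (R : H →ₗ[ℂ] H) ≤ n) : singularNumber T n ≤ ‖T - R‖ :=
  ciInf_le (f := fun R : {R : H →L[ℂ] H // LinearMap.rank (R : H →ₗ[ℂ] H) ≤ n} => ‖T - R.1‖)
    ⟨0, by rintro _ ⟨R, rfl⟩; positivity⟩ ⟨R, hR⟩

theorem rank_zero_le (n : ℕ) : LinearMap.rank ((0 : H →L[ℂ] H) : H →ₗ[ℂ] H) ≤ n := by
  simp

theorem singularNumber_nonneg (T : H →L[ℂ] H) (n : ℕ) : 0 ≤ singularNumber T n :=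
  Real.iInf_nonneg fun _ => norm_nonneg _

theorem exists_norm_sub_lt (T : H →L[ℂ] H) (n : ℕ) {ε : ℝ} (hε : 0 < ε) :
    ∃ R : H →L[ℂ] H, LinearMap.rank (R : H →ₗ[ℂ] H) ≤ n ∧ ‖T - R‖ < singularNumber T n + ε := by
  have : Nonempty {R : H →L[ℂ] H // LinearMap.rank (R : H →ₗ[ℂ] H) ≤ n} :=
    ⟨⟨0, rank_zero_le n⟩⟩
  obtain ⟨R, hR⟩ := exists_lt_of_ciInf_lt (lt_add_of_pos_right (singularNumber T n) hε)
  exact ⟨R.1, R.2, hR⟩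

theorem singularNumber_le_norm (T : H →L[ℂ] H) (n : ℕ) : singularNumber T n ≤ ‖T‖ := by
  simpa using singularNumber_le (T := T) (rank_zero_le n)

theorem singularNumber_antitone (T : H →L[ℂ] H) : Antitone (singularNumber T) := by
  intro m n hmn
  refine le_of_forall_pos_le_add fun ε hε => ?_
  obtain ⟨R, hR, hR'⟩ := exists_norm_sub_lt T m hε
  exact (singularNumber_le (hR.trans (by exact_mod_cast hmn))).trans hR'.le

theorem rank_add_le_of_le {R R' : H →L[ℂ] H} {m n : ℕ}
    (hR : LinearMap.rank (R : H →ₗ[ℂ] H) ≤ m) (hR' : LinearMap.rank (R' : H →ₗ[ℂ] H) ≤ n) :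
    LinearMap.rank ((R + R' : H →L[ℂ] H) : H →ₗ[ℂ] H) ≤ (m + n : ℕ) := by
  rw [ContinuousLinearMap.toLinearMap_add, Nat.cast_add]
  exact (LinearMap.rank_add_le _ _).trans (add_le_add hR hR')

theorem rank_mul_le_left {S R : H →L[ℂ] H} {n : ℕ}
    (hR : LinearMap.rank (R : H →ₗ[ℂ] H) ≤ n) :
    LinearMap.rank ((R * S : H →L[ℂ] H) : H →ₗ[ℂ] H) ≤ n :=
  (LinearMap.rank_comp_le_left (S : H →ₗ[ℂ] H) (R : H →ₗ[ℂ] H)).trans hR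

theorem rank_mul_le_right {S R : H →L[ℂ] H} {n : ℕ}
    (hR : LinearMap.rank (R : H →ₗ[ℂ] H) ≤ n) :
    LinearMap.rank ((S * R : H →L[ℂ] H) : H →ₗ[ℂ] H) ≤ n :=
  (LinearMap.rank_comp_le_right (R : H →ₗ[ℂ] H) (S : H →ₗ[ℂ] H)).trans hR

theorem rank_neg_le {R : H →L[ℂ] H} {n : ℕ}
    (hR : LinearMap.rank (R : H →ₗ[ℂ] H) ≤ n) :
    LinearMap.rank ((-R : H →L[ℂ] H) : H →ₗ[ℂ] H) ≤ n := by
  simpa using rank_mul_le_right (S := (-1 : H →L[ℂ] H)) hR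

theorem singularNumber_add_le (S T : H →L[ℂ] H) (m n : ℕ) :
    singularNumber (S + T) (m + n) ≤ singularNumber S m + singularNumber T n := by
  refine le_of_forall_pos_le_add fun ε hε => ?_
  obtain ⟨R, hR, hR'⟩ := exists_norm_sub_lt S m (half_pos hε)
  obtain ⟨Q, hQ, hQ'⟩ := exists_norm_sub_lt T n (half_pos hε)
  have h := singularNumber_le (T := S + T) (rank_add_le_of_le hR hQ)
  have h2 : ‖S + T - (R + Q)‖ ≤ ‖S - R‖ + ‖T - Q‖ := by
    rw [add_sub_add_comm]; exact norm_add_le _ _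
  linarith

/-- If `R` and `Q` approximate `S` and `T`, then `RT + (S - R)Q` has rank at most `m + n`, and its
distance from `ST` factors as `(S - R)(T - Q)`. -/
theorem singularNumber_mul_le (S T : H →L[ℂ] H) (m n : ℕ) :
    singularNumber (S * T) (m + n) ≤ singularNumber S m * singularNumber T n := by
  have key : ∀ ε : ℝ, 0 < ε → singularNumber (S * T) (m + n) ≤
      (singularNumber S m + ε) * (singularNumber T n + ε) := by
    intro ε hε
    obtain ⟨R, hR, hR'⟩ := exists_norm_sub_lt S m hε
    obtain ⟨Q, hQ, hQ'⟩ := exists_norm_sub_lt T n hε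
    have h := singularNumber_le (T := S * T)
      (rank_add_le_of_le (rank_mul_le_left (S := T) hR) (rank_mul_le_right (S := S - R) hQ))
    have h2 : S * T - (R * T + (S - R) * Q) = (S - R) * (T - Q) := by noncomm_ring
    rw [h2] at h
    refine h.trans ((norm_mul_le _ _).trans ?_)
    have := singularNumber_nonneg S m
    exact mul_le_mul hR'.le hQ'.le (norm_nonneg _) (by positivity)
  have hlim : Filter.Tendsto (fun ε : ℝ => (singularNumber S m + ε) * (singularNumber T n + ε))
      (nhdsWithin 0 (Set.Ioi 0)) (nhds ((singularNumber S m + 0) * (singularNumber T n + 0))) := by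
    have : Continuous fun ε : ℝ => (singularNumber S m + ε) * (singularNumber T n + ε) := by
      fun_prop
    exact (this.tendsto 0).mono_left nhdsWithin_le_nhds
  simp only [add_zero] at hlim
  exact ge_of_tendsto hlim (by
    filter_upwards [self_mem_nhdsWithin] with ε hε using key ε hε)

theorem singularNumber_mul_le_left (S T : H →L[ℂ] H) (n : ℕ) :
    singularNumber (S * T) n ≤ ‖S‖ * singularNumber T n := by
  have h := singularNumber_mul_le S T 0 n
  rw [zero_add] at h
  exact h.trans (mul_le_mul_of_nonneg_right (singularNumber_le_norm S 0)
    (singularNumber_nonneg T n))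

theorem singularNumber_mul_le_right (S T : H →L[ℂ] H) (n : ℕ) :
    singularNumber (S * T) n ≤ singularNumber S n * ‖T‖ := by
  have h := singularNumber_mul_le S T n 0
  rw [add_zero] at h
  exact h.trans (mul_le_mul_of_nonneg_left (singularNumber_le_norm T 0)
    (singularNumber_nonneg S n))

theorem singularNumber_sub_le {S R : H →L[ℂ] H} {m : ℕ} (n : ℕ)
    (hR : LinearMap.rank (R : H →ₗ[ℂ] H) ≤ m) :
    singularNumber (S - R) (n + m) ≤ singularNumber S n := by
  have h := singularNumber_add_le S (-R) n m
  have h0 : singularNumber (-R) m = 0 :=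
    le_antisymm (by simpa using singularNumber_le (T := -R) (rank_neg_le hR))
      (singularNumber_nonneg _ _)
  rw [h0, add_zero, ← sub_eq_add_neg] at h
  exact h

/-- An operator that is bounded, in the mean, by `Z`, has singular numbers bounded by those of
`Z`. -/
theorem singularNumber_sq_le [CompleteSpace H] {Y Z : H →L[ℂ] H} {C : ℝ} (hC : 0 ≤ C)
    (h : ∀ v, ‖Y v‖ ^ 2 ≤ C * ‖Z v‖ * ‖v‖) (n : ℕ) :
    singularNumber Y n ^ 2 ≤ C * singularNumber Z n := by
  have key : ∀ ε : ℝ, 0 < ε → singularNumber Y n ^ 2 ≤ C * (singularNumber Z n + ε) := by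
    intro ε hε
    obtain ⟨R, hR, hR'⟩ := exists_norm_sub_lt Z n hε
    set K : Submodule ℂ H := LinearMap.ker (R : H →ₗ[ℂ] H) with hK
    have hKc : IsClosed (K : Set H) := by
      have : (K : Set H) = R ⁻¹' {0} := by ext v; simp [hK]
      rw [this]
      exact isClosed_singleton.preimage R.continuous
    have : CompleteSpace K := hKc.completeSpace_coe
    -- On `ker R` the operator `Z` agrees with `Z - R`, so `YP` is small. The remainder `Q = Y(1 -
    -- P)` annihilates `ker R`, hence factors through `R` and has rank at most `n`.
    set P : H →L[ℂ] H := K.starProjection with hP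
    set Q : H →L[ℂ] H := Y - Y * P with hQ
    have hPK : ∀ v, P v ∈ K := fun v => Submodule.starProjection_apply_mem K v
    have hQR : LinearMap.rank (Q : H →ₗ[ℂ] H) ≤ n := by
      have hker : LinearMap.ker (R : H →ₗ[ℂ] H) ≤ LinearMap.ker (Q : H →ₗ[ℂ] H) := by
        intro v hv
        have : P v = v := Submodule.starProjection_eq_self_iff.mpr hv
        simp [hQ, this]
      obtain ⟨g, hg⟩ := LinearMap.exists_extend
        (((Submodule.liftQ _ (Q : H →ₗ[ℂ] H) hker) ∘ₗ
          (R : H →ₗ[ℂ] H).quotKerEquivRange.symm.toLinearMap))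
      have hQg : (Q : H →ₗ[ℂ] H) = g ∘ₗ (R : H →ₗ[ℂ] H) := by
        ext v
        have h1 := LinearMap.congr_fun hg ⟨R v, LinearMap.mem_range_self (R : H →ₗ[ℂ] H) v⟩
        have h2 : (R : H →ₗ[ℂ] H).quotKerEquivRange.symm
            ⟨R v, LinearMap.mem_range_self (R : H →ₗ[ℂ] H) v⟩ = Submodule.Quotient.mk v := by
          rw [LinearEquiv.symm_apply_eq]; rfl
        simp only [LinearMap.comp_apply, Submodule.subtype_apply, LinearEquiv.coe_coe] at h1
        rw [h2] at h1
        simpa using h1.symm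
      rw [hQg]
      exact (LinearMap.rank_comp_le_right _ _).trans hR
    have hs : 0 ≤ C * (singularNumber Z n + ε) := by
      have := singularNumber_nonneg Z n
      positivity
    have hYP : ‖Y * P‖ ≤ √(C * (singularNumber Z n + ε)) := by
      refine ContinuousLinearMap.opNorm_le_bound _ (Real.sqrt_nonneg _) fun v => ?_
      have h1 : ‖Y (P v)‖ ^ 2 ≤ C * (singularNumber Z n + ε) * ‖P v‖ ^ 2 := by
        have h2 : Z (P v) = (Z - R) (P v) := by
          have : R (P v) = 0 := hPK v
          simp [this]
        have h3 : ‖Z (P v)‖ ≤ (singularNumber Z n + ε) * ‖P v‖ := by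
          rw [h2]
          exact ((Z - R).le_opNorm _).trans (mul_le_mul_of_nonneg_right hR'.le (norm_nonneg _))
        calc ‖Y (P v)‖ ^ 2 ≤ C * ‖Z (P v)‖ * ‖P v‖ := h _
          _ ≤ C * ((singularNumber Z n + ε) * ‖P v‖) * ‖P v‖ := by gcongr
          _ = _ := by ring
      have h4 : ‖P v‖ ≤ ‖v‖ := Submodule.norm_starProjection_apply_le K v
      have h5 : ‖Y (P v)‖ ^ 2 ≤ (√(C * (singularNumber Z n + ε)) * ‖v‖) ^ 2 := by
        rw [mul_pow, Real.sq_sqrt hs]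
        exact h1.trans (by gcongr)
      exact le_of_sq_le_sq h5 (by positivity)
    have h6 : singularNumber Y n ≤ √(C * (singularNumber Z n + ε)) := by
      have := singularNumber_le (T := Y) hQR
      rw [hQ, sub_sub_cancel] at this
      exact this.trans hYP
    calc singularNumber Y n ^ 2 ≤ √(C * (singularNumber Z n + ε)) ^ 2 := by
          have := singularNumber_nonneg Y n
          gcongr
      _ = _ := Real.sq_sqrt hs
  have hlim : Filter.Tendsto (fun ε : ℝ => C * (singularNumber Z n + ε))
      (nhdsWithin 0 (Set.Ioi 0)) (nhds (C * (singularNumber Z n + 0))) := by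
    have : Continuous fun ε : ℝ => C * (singularNumber Z n + ε) := by fun_prop
    exact (this.tendsto 0).mono_left nhdsWithin_le_nhds
  simp only [add_zero] at hlim
  exact ge_of_tendsto hlim (by
    filter_upwards [self_mem_nhdsWithin] with ε hε using key ε hε)

end SingularNumbers

/-- The bounds for sums and products of operators are at the indices `2n = n + n`; monotonicity
supplies the odd ones. -/
theorem summable_of_even {f : ℕ → ℝ} (h0 : ∀ n, 0 ≤ f n) (hf : Antitone f)
    (h : Summable fun n => f (2 * n)) : Summable f := by
  refine Summable.even_add_odd h (h.of_nonneg_of_le (fun n => h0 _) fun n => hf (by omega))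

theorem summable_comp_half {f : ℕ → ℝ} (h : Summable f) : Summable fun n => f (n / 2) := by
  refine Summable.even_add_odd ?_ ?_
  · simpa using h
  · have : (fun k : ℕ => f ((2 * k + 1) / 2)) = f := by
      funext k
      congr 1
      omega
    rw [this]; exact h

section Schatten

variable {H : Type*} [NormedAddCommGroup H] [InnerProductSpace ℂ H]

theorem IsSchatten.tendsto_zero {p : ℝ} (hp : 0 < p) {T : H →L[ℂ] H} (h : IsSchatten p T) :
    Filter.Tendsto (singularNumber T) Filter.atTop (nhds 0) := by
  have h1 := (h.tendsto_atTop_zero).rpow_const (p := p⁻¹) (Or.inr (by positivity))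
  rw [Real.zero_rpow (by positivity)] at h1
  refine h1.congr fun n => ?_
  rw [← Real.rpow_mul (singularNumber_nonneg T n), mul_inv_cancel₀ hp.ne', Real.rpow_one]

theorem IsSchatten.mono {p q : ℝ} (hp : 0 < p) (hpq : p ≤ q) {T : H →L[ℂ] H}
    (h : IsSchatten p T) : IsSchatten q T := by
  refine Summable.of_norm_bounded_eventually_nat (g := fun n => singularNumber T n ^ p) h ?_
  filter_upwards [(h.tendsto_zero hp).eventually (ge_mem_nhds one_pos)] with n hn
  have h0 := singularNumber_nonneg T n
  rw [Real.norm_of_nonneg (Real.rpow_nonneg h0 _)]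
  rcases h0.eq_or_lt with h1 | h1
  · rw [← h1, Real.zero_rpow hp.ne', Real.zero_rpow (hp.trans_le hpq).ne']
  · exact Real.rpow_le_rpow_of_exponent_ge h1 hn hpq

theorem IsSchatten.of_le {p c : ℝ} (hp : 0 < p) {S T : H →L[ℂ] H} (h : IsSchatten p T)
    (hc : 0 ≤ c) (hS : ∀ n, singularNumber S n ≤ c * singularNumber T n) : IsSchatten p S := by
  refine Summable.of_nonneg_of_le (fun n => Real.rpow_nonneg (singularNumber_nonneg S n) _)
    (fun n => ?_) (h.mul_left (c ^ p))
  rw [← Real.mul_rpow hc (singularNumber_nonneg T n)]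
  exact Real.rpow_le_rpow (singularNumber_nonneg S n) (hS n) hp.le

theorem IsSchatten.mul_left {p : ℝ} (hp : 0 < p) (S : H →L[ℂ] H) {T : H →L[ℂ] H}
    (h : IsSchatten p T) : IsSchatten p (S * T) :=
  h.of_le hp (norm_nonneg S) (singularNumber_mul_le_left S T)

theorem IsSchatten.mul_right {p : ℝ} (hp : 0 < p) {S : H →L[ℂ] H} (T : H →L[ℂ] H)
    (h : IsSchatten p S) : IsSchatten p (S * T) :=
  h.of_le hp (norm_nonneg T) fun n => by
    rw [mul_comm]; exact singularNumber_mul_le_right S T n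

theorem isSchatten_zero {p : ℝ} (hp : 0 < p) : IsSchatten p (0 : H →L[ℂ] H) := by
  have : ∀ n, singularNumber (0 : H →L[ℂ] H) n = 0 := fun n =>
    le_antisymm (by simpa using singularNumber_le_norm (0 : H →L[ℂ] H) n)
      (singularNumber_nonneg _ _)
  simp [IsSchatten, this, Real.zero_rpow hp.ne', summable_zero]

/-- The bound `s₂ₙ(S + T) ≤ 2 max(sₙ(S), sₙ(T))` replaces the Minkowski inequality, so exponents
below `1` are covered too. -/
theorem IsSchatten.add {p : ℝ} (hp : 0 < p) {S T : H →L[ℂ] H} (hS : IsSchatten p S)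
    (hT : IsSchatten p T) : IsSchatten p (S + T) := by
  refine summable_of_even (fun n => Real.rpow_nonneg (singularNumber_nonneg _ n) _)
    (fun m n hmn => Real.rpow_le_rpow (singularNumber_nonneg _ n)
      (singularNumber_antitone _ hmn) hp.le) ?_
  refine Summable.of_nonneg_of_le (fun n => Real.rpow_nonneg (singularNumber_nonneg _ _) _)
    (fun n => ?_) ((Summable.add hS hT).mul_left (2 ^ p))
  have h0 := singularNumber_nonneg S n
  have h1 := singularNumber_nonneg T n
  have h2 : singularNumber (S + T) (2 * n) ≤
      2 * max (singularNumber S n) (singularNumber T n) := by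
    have := singularNumber_add_le S T n n
    rw [← two_mul] at this
    linarith [le_max_left (singularNumber S n) (singularNumber T n),
      le_max_right (singularNumber S n) (singularNumber T n)]
  have h3 := Real.rpow_le_rpow (singularNumber_nonneg _ _) h2 hp.le
  rw [Real.mul_rpow (by norm_num) (le_max_of_le_left h0)] at h3
  refine h3.trans (mul_le_mul_of_nonneg_left ?_ (by positivity))
  rcases max_cases (singularNumber S n) (singularNumber T n) with ⟨h, _⟩ | ⟨h, _⟩ <;> rw [h]
  · linarith [Real.rpow_nonneg h1 p]
  · linarith [Real.rpow_nonneg h0 p]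

/-- The exponents `r/a` and `r/b` are conjugate because `a/r + b/r = 1`. With exponents written as
quotients, the weights `a` and `b` simply add. -/
theorem summable_mul_of_rpow {f g : ℕ → ℝ} {a b : ℝ} (ha : 0 < a) (hb : 0 < b) {r : ℝ}
    (hr : r = a + b) (hf : ∀ n, 0 ≤ f n) (hg : ∀ n, 0 ≤ g n)
    (hfa : Summable fun n => f n ^ (r / a)) (hgb : Summable fun n => g n ^ (r / b)) :
    Summable fun n => f n * g n := by
  refine Real.summable_mul_of_Lp_Lq_of_nonneg (p := r / a) (q := r / b) ?_ hf hg hfa hgb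
  rw [Real.holderConjugate_iff]
  subst hr
  refine ⟨by rw [lt_div_iff₀ ha]; linarith, ?_⟩
  field_simp

/-- The Hölder property of Schatten classes. -/
theorem IsSchatten.mul {p a b : ℝ} (hp : 0 < p) (ha : 0 < a) (hb : 0 < b) {S T : H →L[ℂ] H}
    (hS : IsSchatten (p / a) S) (hT : IsSchatten (p / b) T) : IsSchatten (p / (a + b)) (S * T) := by
  have hq : 0 < p / (a + b) := by positivity
  refine summable_of_even (fun n => Real.rpow_nonneg (singularNumber_nonneg _ n) _)
    (fun m n hmn => Real.rpow_le_rpow (singularNumber_nonneg _ n)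
      (singularNumber_antitone _ hmn) hq.le) ?_
  have hSn := singularNumber_nonneg S
  have hTn := singularNumber_nonneg T
  have key : Summable fun n => singularNumber S n ^ (p / (a + b)) *
      singularNumber T n ^ (p / (a + b)) := by
    refine summable_mul_of_rpow ha hb rfl (fun n => Real.rpow_nonneg (hSn n) _)
      (fun n => Real.rpow_nonneg (hTn n) _) ?_ ?_
    · refine hS.congr fun n => ?_
      rw [← Real.rpow_mul (hSn n)]
      congr 1
      field_simp
    · refine hT.congr fun n => ?_
      rw [← Real.rpow_mul (hTn n)]
      congr 1
      field_simp
  refine Summable.of_nonneg_of_le (fun n => Real.rpow_nonneg (singularNumber_nonneg _ _) _)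
    (fun n => ?_) key
  rw [← Real.mul_rpow (hSn n) (hTn n), two_mul]
  exact Real.rpow_le_rpow (singularNumber_nonneg _ _) (singularNumber_mul_le S T n n) hq.le

/-- This passes from `𝓛^(p/2)` to `𝓛^p` for a kind of square root: for selfadjoint `Y` the
hypothesis follows from `‖Yv‖² = ⟨Y²v, v⟩` once `Y²` is dominated by `Z` in norm. -/
theorem IsSchatten.of_norm_sq_le [CompleteSpace H] {p C : ℝ} (hp : 0 < p) {Y Z : H →L[ℂ] H}
    (hC : 0 ≤ C) (h : ∀ v, ‖Y v‖ ^ 2 ≤ C * ‖Z v‖ * ‖v‖) (hZ : IsSchatten (p / 2) Z) :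
    IsSchatten p Y := by
  refine Summable.of_nonneg_of_le (fun n => Real.rpow_nonneg (singularNumber_nonneg _ _) _)
    (fun n => ?_) (Summable.mul_left (C ^ (p / 2)) hZ)
  have h0 := singularNumber_nonneg Y n
  have h1 := singularNumber_sq_le hC h n
  rw [← Real.mul_rpow hC (singularNumber_nonneg Z n)]
  calc singularNumber Y n ^ p = (singularNumber Y n ^ 2) ^ (p / 2) := by
        rw [← Real.rpow_natCast, ← Real.rpow_mul h0]
        congr 1
        push_cast
        ring
    _ ≤ _ := Real.rpow_le_rpow (by positivity) h1 (by positivity)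

end Schatten

end CyclicCharacter

end

noncomputable section

namespace CyclicCharacter

/-! ### Nuclear representations, the trace and its cyclicity. -/

section Trace

variable {H : Type*} [NormedAddCommGroup H] [InnerProductSpace ℂ H]

/-- `T = ∑ₖ ⟨yₖ, ·⟩ xₖ` with `∑ₖ ‖xₖ‖ ‖yₖ‖ < ∞`. -/
def IsNuclearRep (T : H →L[ℂ] H) {κ : Type} (x y : κ → H) : Prop :=
  (Summable fun k => ‖x k‖ * ‖y k‖) ∧ ∀ v, HasSum (fun k => inner ℂ (y k) v • x k) (T v)

theorem sum_norm_inner_mul_le {ι : Type*} {e : ι → H} (he : Orthonormal ℂ e) (x y : H)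
    (s : Finset ι) : ∑ i ∈ s, ‖inner ℂ y (e i) * inner ℂ (e i) x‖ ≤ ‖x‖ * ‖y‖ := by
  have h1 : ∑ i ∈ s, ‖inner ℂ (e i) x‖ ^ 2 ≤ ‖x‖ ^ 2 := he.sum_inner_products_le x
  have h2 : ∑ i ∈ s, ‖inner ℂ y (e i)‖ ^ 2 ≤ ‖y‖ ^ 2 := by
    simp_rw [norm_inner_symm y]
    exact he.sum_inner_products_le y
  calc ∑ i ∈ s, ‖inner ℂ y (e i) * inner ℂ (e i) x‖
      = ∑ i ∈ s, ‖inner ℂ y (e i)‖ * ‖inner ℂ (e i) x‖ := by simp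
    _ ≤ √(∑ i ∈ s, ‖inner ℂ y (e i)‖ ^ 2) * √(∑ i ∈ s, ‖inner ℂ (e i) x‖ ^ 2) :=
        Real.sum_mul_le_sqrt_mul_sqrt _ _ _
    _ ≤ ‖y‖ * ‖x‖ := by
        refine mul_le_mul ?_ ?_ (Real.sqrt_nonneg _) (norm_nonneg _)
        · exact Real.sqrt_le_iff.mpr ⟨norm_nonneg _, h2⟩
        · exact Real.sqrt_le_iff.mpr ⟨norm_nonneg _, h1⟩
    _ = _ := mul_comm _ _

/-- By Bessel and Cauchy-Schwarz the double series `⟨yₖ, eᵢ⟩⟨eᵢ, xₖ⟩` converges absolutely. Summed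
over `i` first it gives `⟨yₖ, xₖ⟩`, over `k` first the diagonal entries of `T`; the former does not
involve the basis. -/
theorem IsNuclearRep.hasSum_trace {T : H →L[ℂ] H} {κ : Type} {x y : κ → H}
    (h : IsNuclearRep T x y) {ι : Type*} (e : HilbertBasis ι ℂ H) :
    HasSum (fun i => inner ℂ (e i) (T (e i))) (∑' k, inner ℂ (y k) (x k)) := by
  have hb : ∀ k (s : Finset ι),
      ∑ i ∈ s, ‖inner ℂ (y k) (e i) * inner ℂ (e i) (x k)‖ ≤ ‖x k‖ * ‖y k‖ :=
    fun k s => sum_norm_inner_mul_le e.orthonormal _ _ s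
  have hk : ∀ k, Summable fun i => ‖inner ℂ (y k) (e i) * inner ℂ (e i) (x k)‖ := fun k =>
    summable_of_sum_le (fun i => norm_nonneg _) (hb k)
  have hf : Summable fun q : κ × ι => inner ℂ (y q.1) (e q.2) * inner ℂ (e q.2) (x q.1) := by
    refine Summable.of_norm ((summable_prod_of_nonneg fun _ => norm_nonneg _).mpr ⟨hk, ?_⟩)
    exact Summable.of_nonneg_of_le (fun k => tsum_nonneg fun i => norm_nonneg _)
      (fun k => (hk k).tsum_le_of_sum_le (hb k)) h.1
  have h1 := hf.hasSum.prod_fiberwise fun k => e.hasSum_inner_mul_inner (y k) (x k)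
  have h2 := ((Equiv.prodComm ι κ).hasSum_iff.mpr hf.hasSum).prod_fiberwise
    (g := fun i => inner ℂ (e i) (T (e i))) fun i => by
      have := (h.2 (e i)).mapL (innerSL ℂ (e i))
      simpa [Function.comp_def, inner_smul_right] using this
  rw [h1.tsum_eq]
  exact h2

theorem IsNuclearRep.opTrace_eq [CompleteSpace H] {T : H →L[ℂ] H} {κ : Type} {x y : κ → H}
    (h : IsNuclearRep T x y) : opTrace T = ∑' k, inner ℂ (y k) (x k) :=
  (h.hasSum_trace (exists_hilbertBasis ℂ H).choose_spec.choose).tsum_eq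

theorem IsNuclearRep.mul_left {T : H →L[ℂ] H} {κ : Type} {x y : κ → H}
    (h : IsNuclearRep T x y) (S : H →L[ℂ] H) : IsNuclearRep (S * T) (fun k => S (x k)) y := by
  refine ⟨Summable.of_nonneg_of_le (fun k => by positivity) (fun k => ?_) (h.1.mul_left ‖S‖),
    fun v => ?_⟩
  · rw [← mul_assoc]
    exact mul_le_mul_of_nonneg_right (S.le_opNorm _) (norm_nonneg _)
  · simpa using (h.2 v).mapL S

theorem IsNuclearRep.mul_right [CompleteSpace H] {T : H →L[ℂ] H} {κ : Type} {x y : κ → H}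
    (h : IsNuclearRep T x y) (S : H →L[ℂ] H) :
    IsNuclearRep (T * S) x (fun k => S.adjoint (y k)) := by
  refine ⟨Summable.of_nonneg_of_le (fun k => by positivity) (fun k => ?_)
    (h.1.mul_left ‖S.adjoint‖), fun v => ?_⟩
  · rw [← mul_assoc, mul_comm ‖S.adjoint‖, mul_assoc]
    exact mul_le_mul_of_nonneg_left (S.adjoint.le_opNorm _) (norm_nonneg _)
  · simpa [ContinuousLinearMap.adjoint_inner_left] using h.2 (S v)

/-- For an orthonormal basis `bᵢ` of the range, `Dv = ∑ ⟨D* bᵢ, v⟩ bᵢ`. -/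
theorem exists_finite_rep [CompleteSpace H] {D : H →L[ℂ] H} {n : ℕ}
    (hD : LinearMap.rank (D : H →ₗ[ℂ] H) ≤ n) :
    ∃ (d : ℕ) (x y : Fin d → H), d ≤ n ∧ (∀ i, ‖x i‖ * ‖y i‖ ≤ ‖D‖) ∧
      ∀ v, D v = ∑ i, inner ℂ (y i) v • x i := by
  have hfin : Module.rank ℂ (LinearMap.range (D : H →ₗ[ℂ] H)) < Cardinal.aleph0 :=
    lt_of_le_of_lt hD (Cardinal.natCast_lt_aleph0)
  have : FiniteDimensional ℂ (LinearMap.range (D : H →ₗ[ℂ] H)) :=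
    Module.rank_lt_aleph0_iff.mp hfin
  set b := stdOrthonormalBasis ℂ (LinearMap.range (D : H →ₗ[ℂ] H))
  have hb : ∀ i, ‖((b i : LinearMap.range (D : H →ₗ[ℂ] H)) : H)‖ = 1 := fun i => b.norm_eq_one i
  refine ⟨_, fun i => (b i : H), fun i => D.adjoint (b i), ?_, fun i => ?_, fun v => ?_⟩
  · exact Module.finrank_le_of_rank_le hD
  · rw [hb i, one_mul]
    refine (D.adjoint.le_opNorm _).trans ?_
    rw [hb i, mul_one, LinearIsometryEquiv.norm_map]
  · have h1 := congrArg Subtype.val (b.sum_repr' ⟨D v, LinearMap.mem_range_self (D : H →ₗ[ℂ] H) v⟩)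
    simp only [Submodule.coe_sum, Submodule.coe_smul, Submodule.coe_inner] at h1
    simp only [ContinuousLinearMap.adjoint_inner_left]
    exact h1.symm

theorem exists_nuclearRep_of_hasSum [CompleteSpace H] {T : H →L[ℂ] H} {D : ℕ → H →L[ℂ] H}
    {d : ℕ → ℕ} (hd : ∀ k, LinearMap.rank (D k : H →ₗ[ℂ] H) ≤ d k)
    (hs : Summable fun k => d k * ‖D k‖) (hT : ∀ v, HasSum (fun k => D k v) (T v)) :
    ∃ (κ : Type) (x y : κ → H), IsNuclearRep T x y ∧
      ∑' k, ‖x k‖ * ‖y k‖ ≤ ∑' k, d k * ‖D k‖ := by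
  choose m x y hm hxy hD using fun k => exists_finite_rep (hd k)
  have hfib : ∀ k, ∑' i : Fin (m k), ‖x k i‖ * ‖y k i‖ ≤ d k * ‖D k‖ := fun k => by
    rw [tsum_fintype]
    refine (Finset.sum_le_sum fun i _ => hxy k i).trans ?_
    rw [Finset.sum_const, Finset.card_univ, Fintype.card_fin, nsmul_eq_mul]
    exact mul_le_mul_of_nonneg_right (by exact_mod_cast hm k) (norm_nonneg _)
  have hsum : Summable fun q : Σ k, Fin (m k) => ‖x q.1 q.2‖ * ‖y q.1 q.2‖ := by
    refine (summable_sigma_of_nonneg fun q => by positivity).mpr ⟨fun k => Summable.of_finite, ?_⟩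
    exact Summable.of_nonneg_of_le (fun k => tsum_nonneg fun i => by positivity) hfib hs
  refine ⟨Σ k, Fin (m k), fun q => x q.1 q.2, fun q => y q.1 q.2, ⟨hsum, fun v => ?_⟩, ?_⟩
  · have h1 : Summable fun q : Σ k, Fin (m k) => inner ℂ (y q.1 q.2) v • x q.1 q.2 := by
      refine Summable.of_norm (Summable.of_nonneg_of_le (fun q => norm_nonneg _) (fun q => ?_)
        (hsum.mul_left ‖v‖))
      rw [norm_smul]
      calc ‖inner ℂ (y q.1 q.2) v‖ * ‖x q.1 q.2‖ ≤ (‖y q.1 q.2‖ * ‖v‖) * ‖x q.1 q.2‖ :=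
            mul_le_mul_of_nonneg_right (norm_inner_le_norm _ _) (norm_nonneg _)
        _ = _ := by ring
    have h2 := h1.hasSum.sigma (g := fun k => D k v) fun k => by
      rw [hD k v]
      exact hasSum_fintype _
    rw [(hT v).unique h2]
    exact h1.hasSum
  · rw [hsum.tsum_sigma' fun k => Summable.of_finite]
    exact Summable.tsum_le_tsum hfib
      (Summable.of_nonneg_of_le (fun k => tsum_nonneg fun i => by positivity) hfib hs) hs

/-- Cauchy condensation with an explicit constant. -/
theorem sum_pow_two_mul_le {f : ℕ → ℝ} (hf : Antitone f) (hf0 : 0 ≤ f 0) (n : ℕ) :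
    ∑ k ∈ Finset.range (n + 1), 2 ^ k * f (2 ^ k - 1) ≤ 2 * ∑ j ∈ Finset.range (2 ^ n), f j := by
  induction n with
  | zero => simp; linarith
  | succ n ih =>
    rw [Finset.sum_range_succ]
    have h1 : ∑ j ∈ Finset.range (2 ^ (n + 1)), f j =
        ∑ j ∈ Finset.range (2 ^ n), f j + ∑ j ∈ Finset.range (2 ^ n), f (2 ^ n + j) := by
      rw [pow_succ, mul_two, Finset.sum_range_add]
    have h2 : (2 : ℝ) ^ n * f (2 ^ (n + 1) - 1) ≤ ∑ j ∈ Finset.range (2 ^ n), f (2 ^ n + j) := by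
      have h3 : ∀ j ∈ Finset.range (2 ^ n), f (2 ^ (n + 1) - 1) ≤ f (2 ^ n + j) := fun j hj =>
        hf (by have := Finset.mem_range.mp hj; rw [pow_succ]; omega)
      have := Finset.card_nsmul_le_sum _ _ _ h3
      simpa using this
    rw [h1, pow_succ (2 : ℝ)]
    linarith

/-- `T` is the telescoping sum of the blocks `R (k+1) - R k`, where `R k` is an almost optimal
approximant of rank below `2^k`. Rank times norm of the blocks is dominated by the condensed series
of the singular numbers. The quantitative bound makes the trace continuous, see `norm_opTrace_le`.
-/
theorem exists_nuclearRep [CompleteSpace H] {T : H →L[ℂ] H} (hT : Summable (singularNumber T))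
    {δ : ℝ} (hδ : 0 < δ) :
    ∃ (κ : Type) (x y : κ → H), IsNuclearRep T x y ∧
      ∑' k, ‖x k‖ * ‖y k‖ ≤ 16 * ∑' n, singularNumber T n + 16 * δ := by
  set s := singularNumber T with hs
  choose R hR hTR using fun k : ℕ =>
    exists_norm_sub_lt T (2 ^ k - 1) (ε := δ * (1 / 4) ^ k) (by positivity)
  -- The first approximant has rank at most `2^0 - 1 = 0`, so the telescoping sum has no initial
  -- term.
  have hR0 : R 0 = 0 := by
    have h := hR 0
    simp only [pow_zero, Nat.sub_self, Nat.cast_zero, nonpos_iff_eq_zero] at h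
    have h1 := LinearMap.range_eq_bot.mp (Submodule.rank_eq_zero.mp h)
    ext v
    exact LinearMap.congr_fun h1 v
  have hsum : ∀ n, ∑ k ∈ Finset.range n, 2 ^ k * s (2 ^ k - 1) ≤ 2 * ∑' n, s n := fun n => by
    refine le_trans ?_ ((sum_pow_two_mul_le (singularNumber_antitone T)
      (singularNumber_nonneg T 0) n).trans (mul_le_mul_of_nonneg_left
        (hT.sum_le_tsum _ fun j _ => singularNumber_nonneg T j) (by norm_num)))
    refine Finset.sum_le_sum_of_subset_of_nonneg (Finset.range_mono (Nat.le_succ n)) fun k _ _ => ?_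
    have := singularNumber_nonneg T (2 ^ k - 1)
    positivity
  have hnn : ∀ k, 0 ≤ 2 ^ k * s (2 ^ k - 1) := fun k => by
    have := singularNumber_nonneg T (2 ^ k - 1)
    positivity
  have hs1 : Summable fun k => 2 ^ k * s (2 ^ k - 1) := summable_of_sum_range_le hnn hsum
  have hs2 : ∑' k, 2 ^ k * s (2 ^ k - 1) ≤ 2 * ∑' n, s n :=
    Real.tsum_le_of_sum_range_le hnn hsum
  have hg : Summable fun k : ℕ => (1 / 2 : ℝ) ^ k :=
    summable_geometric_of_lt_one (by norm_num) (by norm_num)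
  -- The factor `8` is `4` from the rank times `2` from the norm of a block. Summation contributes a
  -- further `2` to each part, whence the constants `16`.
  set g : ℕ → ℝ := fun k => 8 * (2 ^ k * s (2 ^ k - 1)) + 8 * δ * (1 / 2) ^ k with hgdef
  have hgs : Summable g := (hs1.mul_left 8).add (hg.mul_left (8 * δ))
  set d : ℕ → ℕ := fun k => (2 ^ (k + 1) - 1) + (2 ^ k - 1)
  set D : ℕ → H →L[ℂ] H := fun k => R (k + 1) - R k with hD
  have hDd : ∀ k, LinearMap.rank (D k : H →ₗ[ℂ] H) ≤ d k := fun k => by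
    rw [hD]
    simp only [sub_eq_add_neg]
    exact rank_add_le_of_le (hR (k + 1)) (rank_neg_le (hR k))
  have hle : ∀ k, d k * ‖D k‖ ≤ g k := fun k => by
    have h1 : (d k : ℝ) ≤ 4 * 2 ^ k := by
      have : d k ≤ 4 * 2 ^ k := by
        simp only [d, pow_succ]
        omega
      exact_mod_cast this
    have h2 : ‖D k‖ ≤ 2 * (s (2 ^ k - 1) + δ * (1 / 4) ^ k) := by
      have h3 : D k = (T - R k) - (T - R (k + 1)) := by simp [hD]
      rw [h3]
      have h4 := norm_sub_le (T - R k) (T - R (k + 1))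
      have h5 : s (2 ^ (k + 1) - 1) ≤ s (2 ^ k - 1) := singularNumber_antitone T (by
        rw [pow_succ]; omega)
      have h6 : δ * (1 / 4 : ℝ) ^ (k + 1) ≤ δ * (1 / 4) ^ k := by
        refine mul_le_mul_of_nonneg_left ?_ hδ.le
        exact pow_le_pow_of_le_one (by norm_num) (by norm_num) (Nat.le_succ k)
      linarith [hTR k, hTR (k + 1)]
    have h7 : (1 / 2 : ℝ) ^ k = 2 ^ k * (1 / 4) ^ k := by rw [← mul_pow]; norm_num
    calc d k * ‖D k‖ ≤ 4 * 2 ^ k * (2 * (s (2 ^ k - 1) + δ * (1 / 4) ^ k)) :=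
          mul_le_mul h1 h2 (norm_nonneg _) (by positivity)
      _ = g k := by simp only [hgdef, h7]; ring
  have hds : Summable fun k => d k * ‖D k‖ :=
    Summable.of_nonneg_of_le (fun k => by positivity) hle hgs
  have hRT : Filter.Tendsto R Filter.atTop (nhds T) := by
    rw [tendsto_iff_norm_sub_tendsto_zero]
    have h1 : Filter.Tendsto (fun k => 2 ^ k * s (2 ^ k - 1) + δ * (1 / 4 : ℝ) ^ k)
        Filter.atTop (nhds 0) := by
      have := hs1.tendsto_atTop_zero.add ((tendsto_pow_atTop_nhds_zero_of_lt_one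
        (r := (1 / 4 : ℝ)) (by norm_num) (by norm_num)).const_mul δ)
      simpa using this
    refine squeeze_zero (fun k => norm_nonneg _) (fun k => ?_) h1
    rw [norm_sub_rev]
    refine (hTR k).le.trans (add_le_add_left ?_ _)
    have h0 := singularNumber_nonneg T (2 ^ k - 1)
    exact le_mul_of_one_le_left h0 (one_le_pow₀ (by norm_num))
  have hDv : ∀ v, HasSum (fun k => D k v) (T v) := fun v => by
    have h1 : Summable fun k => D k v := by
      refine Summable.of_norm (Summable.of_nonneg_of_le (fun k => norm_nonneg _) (fun k => ?_)
        (hgs.mul_right ‖v‖))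
      refine ((D k).le_opNorm v).trans (mul_le_mul_of_nonneg_right ?_ (norm_nonneg _))
      rcases Nat.eq_zero_or_pos (d k) with h | h
      · have h1 := hDd k
        rw [h, Nat.cast_zero, nonpos_iff_eq_zero] at h1
        have h2 := LinearMap.range_eq_bot.mp (Submodule.rank_eq_zero.mp h1)
        have h3 : D k = 0 := by ext v; exact LinearMap.congr_fun h2 v
        rw [h3, norm_zero]
        have := hle k
        rw [h3, norm_zero, mul_zero] at this
        exact this
      · exact (le_mul_of_one_le_left (norm_nonneg _) (by exact_mod_cast h)).trans (hle k)
    have h2 := h1.hasSum.tendsto_sum_nat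
    have h3 : ∀ n, ∑ k ∈ Finset.range n, D k v = R n v := fun n => by
      have := Finset.sum_range_sub (fun k => R k v) n
      simpa [hD, hR0] using this
    simp only [h3] at h2
    have h4 : Filter.Tendsto (fun n => R n v) Filter.atTop (nhds (T v)) :=
      ((ContinuousLinearMap.apply ℂ H v).continuous.tendsto T).comp hRT
    rw [tendsto_nhds_unique h4 h2]
    exact h1.hasSum
  obtain ⟨κ, x, y, hxy, hle'⟩ := exists_nuclearRep_of_hasSum hDd hds hDv
  refine ⟨κ, x, y, hxy, hle'.trans ((Summable.tsum_le_tsum hle hds hgs).trans ?_)⟩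
  rw [Summable.tsum_add (hs1.mul_left 8) (hg.mul_left (8 * δ)), tsum_mul_left, tsum_mul_left,
    tsum_geometric_of_lt_one (by norm_num) (by norm_num)]
  norm_num
  linarith

theorem IsSchatten.summable {T : H →L[ℂ] H} (h : IsSchatten 1 T) : Summable (singularNumber T) := by
  simpa [IsSchatten] using h

theorem isSchatten_one_of_summable {T : H →L[ℂ] H} (h : Summable (singularNumber T)) :
    IsSchatten 1 T := by
  simpa [IsSchatten] using h

theorem singularNumber_eq_zero {R : H →L[ℂ] H} {n m : ℕ}
    (hR : LinearMap.rank (R : H →ₗ[ℂ] H) ≤ n) (hm : n ≤ m) : singularNumber R m = 0 :=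
  le_antisymm ((singularNumber_antitone R hm).trans (by simpa using singularNumber_le (T := R) hR))
    (singularNumber_nonneg _ _)

theorem isSchatten_of_rank_le {R : H →L[ℂ] H} {n : ℕ}
    (hR : LinearMap.rank (R : H →ₗ[ℂ] H) ≤ n) : IsSchatten 1 R := by
  refine isSchatten_one_of_summable ?_
  refine summable_of_ne_finset_zero (s := Finset.range n) fun m hm => ?_
  exact singularNumber_eq_zero hR (by simpa using hm)

theorem summable_singularNumber_mul {S T : H →L[ℂ] H}
    (h : Summable fun n => singularNumber S n * singularNumber T n) :
    Summable (singularNumber (S * T)) := by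
  refine summable_of_even (singularNumber_nonneg _) (singularNumber_antitone _)
    (Summable.of_nonneg_of_le (fun n => singularNumber_nonneg _ _) (fun n => ?_) h)
  rw [two_mul]
  exact singularNumber_mul_le S T n n

theorem tsum_singularNumber_mul_le {S T : H →L[ℂ] H}
    (h : Summable fun n => singularNumber S n * singularNumber T n) :
    ∑' n, singularNumber (S * T) n ≤ 2 * ∑' n, singularNumber S n * singularNumber T n := by
  have hs := summable_singularNumber_mul h
  have h0 : ∀ n, singularNumber (S * T) (2 * n) ≤ singularNumber S n * singularNumber T n :=
    fun n => by rw [two_mul]; exact singularNumber_mul_le S T n n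
  have h1 : ∀ n, singularNumber (S * T) (2 * n + 1) ≤ singularNumber S n * singularNumber T n :=
    fun n => (singularNumber_antitone _ (Nat.le_succ _)).trans (h0 n)
  have he : Summable fun n => singularNumber (S * T) (2 * n) :=
    Summable.of_nonneg_of_le (fun n => singularNumber_nonneg _ _) h0 h
  have ho : Summable fun n => singularNumber (S * T) (2 * n + 1) :=
    Summable.of_nonneg_of_le (fun n => singularNumber_nonneg _ _) h1 h
  rw [← tsum_even_add_odd he ho, two_mul]
  exact add_le_add (Summable.tsum_le_tsum h0 he h) (Summable.tsum_le_tsum h1 ho h)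

variable [CompleteSpace H]

theorem norm_opTrace_le {T : H →L[ℂ] H} (hT : Summable (singularNumber T)) :
    ‖opTrace T‖ ≤ 16 * ∑' n, singularNumber T n := by
  refine le_of_forall_pos_le_add fun ε hε => ?_
  obtain ⟨κ, x, y, h, hle⟩ := exists_nuclearRep hT (δ := ε / 16) (by positivity)
  rw [h.opTrace_eq]
  have hs : Summable fun k => ‖inner ℂ (y k) (x k)‖ :=
    Summable.of_nonneg_of_le (fun k => norm_nonneg _)
      (fun k => (norm_inner_le_norm _ _).trans (mul_comm _ _).le) h.1
  refine (norm_tsum_le_tsum_norm hs).trans ((Summable.tsum_le_tsum (fun k =>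
    (norm_inner_le_norm _ _).trans (mul_comm _ _).le) hs h.1).trans (hle.trans ?_))
  linarith

theorem opTrace_add {S T : H →L[ℂ] H} (hS : IsSchatten 1 S) (hT : IsSchatten 1 T) :
    opTrace (S + T) = opTrace S + opTrace T := by
  obtain ⟨κ, x, y, h, -⟩ := exists_nuclearRep hS.summable one_pos
  obtain ⟨κ', x', y', h', -⟩ := exists_nuclearRep hT.summable one_pos
  set e := (exists_hilbertBasis ℂ H).choose_spec.choose
  have := (h.hasSum_trace e).summable.tsum_add (h'.hasSum_trace e).summable
  simpa [opTrace, inner_add_right] using this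

theorem opTrace_smul (c : ℂ) (T : H →L[ℂ] H) : opTrace (c • T) = c * opTrace T := by
  simp only [opTrace, _root_.smul_apply, inner_smul_right, tsum_mul_left]

theorem opTrace_mul_comm_of_isSchatten {T : H →L[ℂ] H} (hT : IsSchatten 1 T) (S : H →L[ℂ] H) :
    opTrace (S * T) = opTrace (T * S) := by
  obtain ⟨κ, x, y, h, -⟩ := exists_nuclearRep hT.summable one_pos
  rw [(h.mul_left S).opTrace_eq, (h.mul_right S).opTrace_eq]
  simp only [ContinuousLinearMap.adjoint_inner_left]

/-- The trace property `Tr S T = Tr T S` if `∑ sₙ(S) sₙ(T) < ∞`. -/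
theorem opTrace_mul_comm {S T : H →L[ℂ] H}
    (h : Summable fun n => singularNumber S n * singularNumber T n)
    (hS : Filter.Tendsto (singularNumber S) Filter.atTop (nhds 0)) :
    opTrace (S * T) = opTrace (T * S) := by
  -- For the finite rank operators `R n` the trace property is known; the remainder is removed by a
  -- limit. The error `1/(n+1)²` is summable so that it can be part of a dominating sequence.
  choose R hR hSR using fun n : ℕ =>
    exists_norm_sub_lt S n (ε := 1 / ((n : ℝ) + 1) ^ 2) (by positivity)
  have hsT := singularNumber_nonneg T
  -- a summable bound
  set g : ℕ → ℝ := fun j => singularNumber S (j / 2) * singularNumber T (j / 2) +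
    1 / (((j / 2 : ℕ) : ℝ) + 1) ^ 2 * ‖T‖ with hg
  have hgs : Summable g := by
    refine (summable_comp_half h).add (Summable.mul_right _ ?_)
    refine summable_comp_half (f := fun n : ℕ => 1 / ((n : ℝ) + 1) ^ 2) ?_
    have := (summable_nat_add_iff 1).mpr (Real.summable_one_div_nat_pow.mpr one_lt_two)
    simpa using this
  have hb : ∀ n j, singularNumber (S - R n) j * singularNumber T j ≤ g j := fun n j => by
    have hT2 : singularNumber T j ≤ singularNumber T (j / 2) :=
      singularNumber_antitone T (Nat.div_le_self j 2)
    have key : singularNumber (S - R n) j ≤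
        singularNumber S (j / 2) + 1 / (((j / 2 : ℕ) : ℝ) + 1) ^ 2 := by
      -- For `j ≥ 2n`, subtracting rank `n` shifts the index to `j - n ≥ j/2`. For `j < 2n` the norm
      -- bound `sₙ(S) + 1/(n+1)²` is already below the value at `j/2 ≤ n`.
      rcases le_or_gt (2 * n) j with hj | hj
      · have h1 := singularNumber_sub_le (S := S) (j - n) (hR n)
        rw [Nat.sub_add_cancel (by omega)] at h1
        have h2 : singularNumber S (j - n) ≤ singularNumber S (j / 2) :=
          singularNumber_antitone S (by omega)
        have : (0 : ℝ) ≤ 1 / (((j / 2 : ℕ) : ℝ) + 1) ^ 2 := by positivity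
        linarith
      · have h1 := (singularNumber_le_norm (S - R n) j).trans (hSR n).le
        have h2 : singularNumber S n ≤ singularNumber S (j / 2) :=
          singularNumber_antitone S (by omega)
        have h3 : 1 / ((n : ℝ) + 1) ^ 2 ≤ 1 / (((j / 2 : ℕ) : ℝ) + 1) ^ 2 := by
          have : ((j / 2 : ℕ) : ℝ) ≤ n := by exact_mod_cast (by omega : j / 2 ≤ n)
          gcongr
        linarith
    calc singularNumber (S - R n) j * singularNumber T j
        ≤ (singularNumber S (j / 2) + 1 / (((j / 2 : ℕ) : ℝ) + 1) ^ 2) * singularNumber T j :=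
          mul_le_mul_of_nonneg_right key (hsT j)
      _ = singularNumber S (j / 2) * singularNumber T j +
          1 / (((j / 2 : ℕ) : ℝ) + 1) ^ 2 * singularNumber T j := by ring
      _ ≤ g j := by
          refine add_le_add (mul_le_mul_of_nonneg_left hT2 (singularNumber_nonneg _ _))
            (mul_le_mul_of_nonneg_left (singularNumber_le_norm T j) (by positivity))
  have hnn : ∀ n j, 0 ≤ singularNumber (S - R n) j * singularNumber T j := fun n j =>
    mul_nonneg (singularNumber_nonneg _ _) (hsT j)
  have hsum : ∀ n, Summable fun j => singularNumber (S - R n) j * singularNumber T j := fun n =>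
    Summable.of_nonneg_of_le (hnn n) (hb n) hgs
  have hlim : Filter.Tendsto (fun n => ∑' j, singularNumber (S - R n) j * singularNumber T j)
      Filter.atTop (nhds 0) := by
    have h1 := tendsto_tsum_of_dominated_convergence (𝓕 := Filter.atTop)
      (f := fun n j => singularNumber (S - R n) j * singularNumber T j) (g := fun _ => (0 : ℝ))
      hgs (fun j => ?_) (Filter.Eventually.of_forall fun n j => by
        rw [Real.norm_of_nonneg (hnn n j)]; exact hb n j)
    · simpa using h1
    · have h2 : Filter.Tendsto (fun n : ℕ => (singularNumber S n + 1 / ((n : ℝ) + 1) ^ 2) *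
          singularNumber T j) Filter.atTop (nhds ((0 + 0) * singularNumber T j)) := by
        refine (hS.add ?_).mul_const _
        have := (summable_nat_add_iff 1).mpr (Real.summable_one_div_nat_pow.mpr one_lt_two)
        simpa using this.tendsto_atTop_zero
      rw [add_zero, zero_mul] at h2
      exact squeeze_zero (fun n => hnn n j) (fun n => mul_le_mul_of_nonneg_right
        ((singularNumber_le_norm _ _).trans (hSR n).le) (hsT j)) h2
  -- The constant is `64 = 2 · 16 · 2`: two orders of the factors, the bound of the trace, and the
  -- bound for the singular numbers of a product.
  have hzero : ∀ n, ‖opTrace (S * T) - opTrace (T * S)‖ ≤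
      64 * ∑' j, singularNumber (S - R n) j * singularNumber T j := fun n => by
    have hRn := isSchatten_of_rank_le (hR n)
    have hs' : Summable fun j => singularNumber T j * singularNumber (S - R n) j :=
      (hsum n).congr fun j => mul_comm _ _
    have e1 := summable_singularNumber_mul (hsum n)
    have e2 := summable_singularNumber_mul hs'
    have f1 : opTrace (S * T) = opTrace (R n * T) + opTrace ((S - R n) * T) := by
      rw [← opTrace_add (hRn.mul_right one_pos T) (isSchatten_one_of_summable e1)]
      congr 1
      noncomm_ring
    have f2 : opTrace (T * S) = opTrace (T * R n) + opTrace (T * (S - R n)) := by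
      rw [← opTrace_add (hRn.mul_left one_pos T) (isSchatten_one_of_summable e2)]
      congr 1
      noncomm_ring
    rw [f1, f2, opTrace_mul_comm_of_isSchatten hRn T, add_sub_add_left_eq_sub]
    have g1 := norm_opTrace_le e1
    have g2 := norm_opTrace_le e2
    have g3 := tsum_singularNumber_mul_le (hsum n)
    have g4 := tsum_singularNumber_mul_le hs'
    have g5 : ∑' j, singularNumber T j * singularNumber (S - R n) j =
        ∑' j, singularNumber (S - R n) j * singularNumber T j :=
      tsum_congr fun j => mul_comm _ _
    rw [g5] at g4
    have := norm_sub_le (opTrace ((S - R n) * T)) (opTrace (T * (S - R n)))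
    linarith
  have h0 := ge_of_tendsto' (hlim.const_mul 64) hzero
  rw [mul_zero] at h0
  exact sub_eq_zero.mp (norm_le_zero_iff.mp h0)

end Trace

end CyclicCharacter

end

noncomputable section

namespace CyclicCharacter

/-! ### Operators on `H ⊕ H`. -/

section Double

theorem double_ext {H : Type*} {v w : Double H} (h1 : v.fst = w.fst) (h2 : v.snd = w.snd) :
    v = w :=
  WithLp.ofLp_injective 2 (Prod.ext h1 h2)

variable {H : Type*} [NormedAddCommGroup H] [InnerProductSpace ℂ H]

@[simp] theorem diagOp_apply_fst (S T : H →L[ℂ] H) (v : Double H) :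
    (diagOp S T v).fst = S v.fst := rfl

@[simp] theorem diagOp_apply_snd (S T : H →L[ℂ] H) (v : Double H) :
    (diagOp S T v).snd = T v.snd := rfl

theorem diagOp_mul (S T S' T' : H →L[ℂ] H) :
    diagOp S T * diagOp S' T' = diagOp (S * S') (T * T') := rfl

theorem diagOp_add (S T S' T' : H →L[ℂ] H) :
    diagOp S T + diagOp S' T' = diagOp (S + S') (T + T') := rfl

theorem diagOp_sub (S T S' T' : H →L[ℂ] H) :
    diagOp S T - diagOp S' T' = diagOp (S - S') (T - T') := rfl

theorem diagOp_neg (S T : H →L[ℂ] H) : -diagOp S T = diagOp (-S) (-T) := rfl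

theorem diagOp_smul (c : ℂ) (S T : H →L[ℂ] H) : c • diagOp S T = diagOp (c • S) (c • T) := rfl

theorem diagOp_one : diagOp (1 : H →L[ℂ] H) 1 = 1 := rfl

theorem diagOp_zero : diagOp (0 : H →L[ℂ] H) 0 = 0 := rfl

theorem norm_diagOp_zero_le (T : H →L[ℂ] H) : ‖diagOp T 0‖ ≤ ‖T‖ := by
  refine ContinuousLinearMap.opNorm_le_bound _ (norm_nonneg _) fun v => ?_
  have h1 : ‖diagOp T 0 v‖ ^ 2 ≤ (‖T‖ * ‖v‖) ^ 2 := by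
    rw [mul_pow, WithLp.prod_norm_sq_eq_of_L2, WithLp.prod_norm_sq_eq_of_L2]
    simp only [diagOp_apply_fst, diagOp_apply_snd, zero_apply, norm_zero]
    have h2 : ‖T v.fst‖ ^ 2 ≤ (‖T‖ * ‖v.fst‖) ^ 2 := by
      have := T.le_opNorm v.fst
      gcongr
    nlinarith [sq_nonneg (‖T‖ * ‖v.snd‖)]
  exact le_of_sq_le_sq h1 (by positivity)

theorem rank_diagOp_zero_le {R : H →L[ℂ] H} {n : ℕ}
    (hR : LinearMap.rank (R : H →ₗ[ℂ] H) ≤ n) :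
    LinearMap.rank ((diagOp R 0 : Double H →L[ℂ] Double H) : Double H →ₗ[ℂ] Double H) ≤ n := by
  have h : ((diagOp R 0 : Double H →L[ℂ] Double H) : Double H →ₗ[ℂ] Double H) =
      (((WithLp.linearEquiv 2 ℂ (H × H)).symm : H × H →ₗ[ℂ] Double H) ∘ₗ LinearMap.inl ℂ H H) ∘ₗ
      ((R : H →ₗ[ℂ] H) ∘ₗ
        (LinearMap.fst ℂ H H ∘ₗ (WithLp.linearEquiv 2 ℂ (H × H) : Double H →ₗ[ℂ] H × H))) := by
    ext v
    rfl
  rw [h]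
  exact (LinearMap.rank_comp_le_right _ _).trans ((LinearMap.rank_comp_le_left _ _).trans hR)

theorem singularNumber_diagOp_le (T : H →L[ℂ] H) (n : ℕ) :
    singularNumber (diagOp T 0) n ≤ singularNumber T n := by
  refine le_of_forall_pos_le_add fun ε hε => ?_
  obtain ⟨R, hR, hR'⟩ := exists_norm_sub_lt T n hε
  have h1 : singularNumber (diagOp T 0) n ≤ ‖diagOp T 0 - diagOp R 0‖ :=
    singularNumber_le (rank_diagOp_zero_le hR)
  have h2 : diagOp T 0 - diagOp R 0 = diagOp (T - R) 0 := by
    rw [diagOp_sub, sub_zero]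
  rw [h2] at h1
  exact h1.trans ((norm_diagOp_zero_le _).trans hR'.le)

theorem IsSchatten.diagOp_left {p : ℝ} (hp : 0 < p) {T : H →L[ℂ] H} (hT : IsSchatten p T) :
    IsSchatten p (diagOp T 0) :=
  Summable.of_nonneg_of_le (fun n => Real.rpow_nonneg (singularNumber_nonneg _ n) _)
    (fun n => Real.rpow_le_rpow (singularNumber_nonneg _ n) (singularNumber_diagOp_le T n) hp.le) hT

/-- The flip of `H ⊕ H`. -/
def swapOp : Double H →L[ℂ] Double H :=
  ((WithLp.prodContinuousLinearEquiv 2 ℂ H H).symm : H × H →L[ℂ] Double H) ∘L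
    (ContinuousLinearEquiv.prodComm ℂ H H : H × H →L[ℂ] H × H) ∘L
      ((WithLp.prodContinuousLinearEquiv 2 ℂ H H) : Double H →L[ℂ] H × H)

theorem swapOp_mul_diagOp (S T : H →L[ℂ] H) : swapOp * diagOp S T = diagOp T S * swapOp := rfl

theorem swapOp_mul_swapOp : (swapOp : Double H →L[ℂ] Double H) * swapOp = 1 := rfl

theorem IsSchatten.diagOp {p : ℝ} (hp : 0 < p) {S T : H →L[ℂ] H} (hS : IsSchatten p S)
    (hT : IsSchatten p T) : IsSchatten p (diagOp S T) := by
  have h : CyclicCharacter.diagOp S T = CyclicCharacter.diagOp S 0 +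
      swapOp * CyclicCharacter.diagOp T 0 * swapOp := by
    rw [swapOp_mul_diagOp, mul_assoc, swapOp_mul_swapOp, mul_one, diagOp_add, add_zero, zero_add]
  rw [h]
  exact (hS.diagOp_left hp).add hp (((hT.diagOp_left hp).mul_left hp _).mul_right hp _)

variable [CompleteSpace H]

theorem opTrace_diagOp {T : H →L[ℂ] H} (hT : IsSchatten 1 T) :
    opTrace (diagOp T 0) = opTrace T := by
  obtain ⟨κ, x, y, h, -⟩ := exists_nuclearRep hT.summable one_pos
  have h' : IsNuclearRep (diagOp T 0) (fun k => (WithLp.toLp 2 (x k, (0 : H)) : Double H))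
      (fun k => (WithLp.toLp 2 (y k, (0 : H)) : Double H)) := by
    refine ⟨by simpa using h.1, fun v => ?_⟩
    set L : H →L[ℂ] Double H :=
      ((WithLp.prodContinuousLinearEquiv 2 ℂ H H).symm : H × H →L[ℂ] Double H) ∘L
        ContinuousLinearMap.inl ℂ H H
    have h1 := (h.2 v.fst).mapL L
    have h2 : (fun k => inner ℂ (WithLp.toLp 2 (y k, (0 : H)) : Double H) v •
        (WithLp.toLp 2 (x k, (0 : H)) : Double H)) = fun k => L (inner ℂ (y k) v.fst • x k) := by
      funext k
      refine double_ext ?_ ?_ <;> simp [L, WithLp.prod_inner_apply]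
    have h3 : diagOp T 0 v = L (T v.fst) := rfl
    rw [h2, h3]
    exact h1
  rw [h.opTrace_eq, h'.opTrace_eq]
  simp [WithLp.prod_inner_apply]

theorem diagOp_isSelfAdjoint {S T : H →L[ℂ] H} (hS : IsSelfAdjoint S) (hT : IsSelfAdjoint T) :
    IsSelfAdjoint (diagOp S T) := by
  rw [ContinuousLinearMap.isSelfAdjoint_iff_isSymmetric] at *
  intro v w
  have h1 := hS v.fst w.fst
  have h2 := hT v.snd w.snd
  simp only [ContinuousLinearMap.coe_coe] at *
  rw [WithLp.prod_inner_apply, WithLp.prod_inner_apply]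
  exact congrArg₂ (· + ·) h1 h2

theorem swapOp_isSelfAdjoint : IsSelfAdjoint (swapOp : Double H →L[ℂ] Double H) := by
  rw [ContinuousLinearMap.isSelfAdjoint_iff_isSymmetric]
  intro v w
  simp only [ContinuousLinearMap.coe_coe]
  rw [WithLp.prod_inner_apply, WithLp.prod_inner_apply, add_comm]
  rfl

end Double

/-! ### Existence of the symmetry, by functional calculus. -/

section Existence

variable {H : Type*} [NormedAddCommGroup H] [InnerProductSpace ℂ H] [CompleteSpace H]

theorem norm_sq_le_of_sq_le {Y X : H →L[ℂ] H} (hY : IsSelfAdjoint Y) (v : H) (hX : Y * Y = X) :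
    ‖Y v‖ ^ 2 ≤ ‖X v‖ * ‖v‖ := by
  have h1 : inner ℂ (Y v) (Y v) = inner ℂ (X v) v := by
    rw [← hX]
    exact ((ContinuousLinearMap.isSelfAdjoint_iff_isSymmetric.mp hY) (Y v) v).symm
  have h2 : ‖inner ℂ (Y v) (Y v)‖ = ‖Y v‖ ^ 2 := by
    rw [inner_self_eq_norm_sq_to_K]; simp
  rw [← h2, h1]
  exact norm_inner_le_norm _ _

/-- With `X = g(F)²` and `Z = F² - 1`, the calculus gives `X² ≤ Z²`, that is `‖Xv‖ ≤ ‖Zv‖`, and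
`‖g(F)v‖² = ⟨Xv, v⟩`. Comparing squares avoids the absolute value of `Z`. -/
theorem isSchatten_cfc {p : ℝ} (hp : 0 < p) {F : H →L[ℂ] H} (hF : IsSelfAdjoint F)
    (hF2 : IsSchatten (p / 2) (F ^ 2 - 1)) {g : ℝ → ℝ} (hg : Continuous g)
    (hg2 : ∀ x, g x ^ 2 ≤ |1 - x ^ 2|) : IsSchatten p (cfc g F) := by
  set Y := cfc g F
  have hY : IsSelfAdjoint Y := cfc_predicate g F
  set X := cfc (fun x => g x ^ 2) F
  have hX : IsSelfAdjoint X := cfc_predicate _ F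
  have hYX : Y * Y = X := by
    rw [← sq]
    exact (cfc_pow g 2 F (by fun_prop) hF).symm
  set Z := F ^ 2 - 1 with hZ
  have hZe : Z = cfc (fun x : ℝ => x ^ 2 - 1) F := by
    rw [cfc_sub (fun x : ℝ => x ^ 2) (fun _ => 1) F, cfc_const_one ℝ F, cfc_pow_id F 2]
  have hZs : IsSelfAdjoint Z := by rw [hZe]; exact cfc_predicate _ F
  have hle : X * X ≤ Z * Z := by
    rw [hZe, ← cfc_mul (fun x : ℝ => x ^ 2 - 1) (fun x : ℝ => x ^ 2 - 1) F,
      ← cfc_mul (fun x : ℝ => g x ^ 2) (fun x : ℝ => g x ^ 2) F]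
    refine cfc_mono fun x _ => ?_
    have h1 := hg2 x
    have h2 := sq_abs (1 - x ^ 2)
    nlinarith [abs_nonneg (1 - x ^ 2), sq_nonneg (g x)]
  have hsa : ∀ {S : H →L[ℂ] H}, IsSelfAdjoint S → ∀ v,
      RCLike.re (inner ℂ ((S * S) v) v) = ‖S v‖ ^ 2 := by
    intro S hS v
    have h1 : inner ℂ ((S * S) v) v = inner ℂ (S v) (S v) :=
      (ContinuousLinearMap.isSelfAdjoint_iff_isSymmetric.mp hS) (S v) v
    rw [h1, inner_self_eq_norm_sq]
  refine IsSchatten.of_norm_sq_le hp zero_le_one (fun v => ?_) hF2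
  rw [one_mul]
  refine (norm_sq_le_of_sq_le hY v hYX).trans (mul_le_mul_of_nonneg_right ?_ (norm_nonneg _))
  have h1 := ((ContinuousLinearMap.le_def _ _).mp hle).re_inner_nonneg_left v
  rw [sub_apply, inner_sub_left, map_sub, hsa hX, hsa hZs] at h1
  exact le_of_sq_le_sq (by linarith) (norm_nonneg _)

/-- The retraction of the real line onto `[-1, 1]`. -/
def clampFun (x : ℝ) : ℝ := max (-1) (min 1 x)

/-- The function `√(1 - x²)`, extended by zero. -/
def sineFun (x : ℝ) : ℝ := √(max 0 (1 - x ^ 2))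

theorem continuous_clampFun : Continuous clampFun := by unfold clampFun; fun_prop

theorem continuous_sineFun : Continuous sineFun := by unfold sineFun; fun_prop

theorem clampFun_neg (x : ℝ) : clampFun (-x) = -clampFun x := by
  unfold clampFun
  rcases le_total 1 x with h | h <;> rcases le_total (-1) x with h' | h' <;>
    simp [max_def, min_def] <;> split_ifs <;> linarith

theorem sineFun_neg (x : ℝ) : sineFun (-x) = sineFun x := by simp [sineFun]

theorem clampFun_sq_add (x : ℝ) : clampFun x * clampFun x + sineFun x * sineFun x = 1 := by
  unfold clampFun sineFun
  rw [Real.mul_self_sqrt (le_max_left _ _)]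
  rcases le_total 1 x with h | h
  · rw [min_eq_left h, max_eq_right (by norm_num), max_eq_left (by nlinarith)]; norm_num
  · rw [min_eq_right h]
    rcases le_total (-1) x with h' | h'
    · rw [max_eq_right h', max_eq_right (by nlinarith)]; ring
    · rw [max_eq_left h', max_eq_left (by nlinarith)]; norm_num

theorem clampFun_sub_sq_le (x : ℝ) : (clampFun x - x) ^ 2 ≤ |1 - x ^ 2| := by
  unfold clampFun
  rcases le_total 1 x with h | h
  · rw [min_eq_left h, max_eq_right (by norm_num), abs_of_nonpos (by nlinarith)]; nlinarith
  · rw [min_eq_right h]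
    rcases le_total (-1) x with h' | h'
    · rw [max_eq_right h']; simp
    · rw [max_eq_left h', abs_of_nonpos (by nlinarith)]; nlinarith

theorem sineFun_sq_le (x : ℝ) : sineFun x ^ 2 ≤ |1 - x ^ 2| := by
  unfold sineFun
  rw [Real.sq_sqrt (le_max_left _ _)]
  exact max_le (abs_nonneg _) (le_abs_self _)

/-- The rotation of `F ⊕ (-F)` into a symmetry. -/
def symmetryOp (F : H →L[ℂ] H) : Double H →L[ℂ] Double H :=
  diagOp (cfc clampFun F) (-cfc clampFun F) + diagOp (cfc sineFun F) (cfc sineFun F) * swapOp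

theorem symmetryOp_isSelfAdjoint (F : H →L[ℂ] H) : IsSelfAdjoint (symmetryOp F) := by
  have hc : IsSelfAdjoint (cfc clampFun F) := cfc_predicate _ F
  have hs : IsSelfAdjoint (cfc sineFun F) := cfc_predicate _ F
  refine IsSelfAdjoint.add (R := Double H →L[ℂ] Double H) (diagOp_isSelfAdjoint hc hc.neg) ?_
  rw [IsSelfAdjoint, star_mul, swapOp_isSelfAdjoint.star_eq, (diagOp_isSelfAdjoint hs hs).star_eq,
    swapOp_mul_diagOp]

/-- The block matrix has rows `(c, s)` and `(s, -c)` with commuting entries and `c² + s² = 1`. The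
truncations keep this relation for spectrum outside `[-1, 1]`. -/
theorem symmetryOp_sq {F : H →L[ℂ] H} (hF : IsSelfAdjoint F) : symmetryOp F ^ 2 = 1 := by
  set c := cfc clampFun F
  set s := cfc sineFun F
  have hcs : c * s = s * c := cfc_commute_cfc _ _ F
  have h1 : c * c + s * s = 1 := by
    rw [← cfc_mul clampFun clampFun F continuous_clampFun.continuousOn
      continuous_clampFun.continuousOn, ← cfc_mul sineFun sineFun F
      continuous_sineFun.continuousOn continuous_sineFun.continuousOn,
      ← cfc_add (a := F) (fun x => clampFun x * clampFun x) (fun x => sineFun x * sineFun x)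
        (by have := continuous_clampFun; fun_prop) (by have := continuous_sineFun; fun_prop)]
    simp only [clampFun_sq_add]
    exact cfc_const_one ℝ F
  have h2 : symmetryOp F ^ 2 = diagOp c (-c) * diagOp c (-c) +
      diagOp c (-c) * diagOp s s * swapOp + diagOp s s * (swapOp * diagOp c (-c)) +
      diagOp s s * (swapOp * diagOp s s) * swapOp := by
    rw [symmetryOp]; noncomm_ring
  rw [h2, swapOp_mul_diagOp, swapOp_mul_diagOp, ← mul_assoc, ← mul_assoc, mul_assoc _ swapOp,
    swapOp_mul_swapOp, mul_one, diagOp_mul, diagOp_mul, diagOp_mul, diagOp_mul, ← hcs]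
  have h3 : diagOp (c * s) (-c * s) * swapOp + diagOp (s * -c) (c * s) * swapOp = 0 := by
    rw [← add_mul, diagOp_add, mul_neg, neg_mul, ← hcs, add_neg_cancel, neg_add_cancel, diagOp_zero,
      zero_mul]
  rw [add_assoc (diagOp (c * c) _), h3, add_zero, diagOp_add, neg_mul_neg, h1, diagOp_one]

/-- The entries of the difference are `±(c - F)` and `s`, functions of `F` whose squares are at most
`|1 - F²|`. -/
theorem symmetryOp_sub {p : ℝ} (hp : 0 < p) {F : H →L[ℂ] H} (hF : IsSelfAdjoint F)
    (hF2 : IsSchatten (p / 2) (F ^ 2 - 1)) : IsSchatten p (symmetryOp F - diagOp F (-F)) := by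
  have h1 : symmetryOp F - diagOp F (-F) =
      diagOp (cfc clampFun F - F) (-(cfc clampFun F - F)) +
        diagOp (cfc sineFun F) (cfc sineFun F) * swapOp := by
    rw [symmetryOp, add_sub_right_comm, diagOp_sub]
    congr 2
    abel
  have h2 : IsSchatten p (cfc clampFun F - F) := by
    have h3 : cfc clampFun F - F = cfc (fun x => clampFun x - x) F := by
      rw [cfc_sub (a := F) clampFun (fun x => x) continuous_clampFun.continuousOn, cfc_id' ℝ F]
    rw [h3]
    exact isSchatten_cfc hp hF hF2 (continuous_clampFun.sub continuous_id) clampFun_sub_sq_le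
  have h4 : IsSchatten p (cfc sineFun F) :=
    isSchatten_cfc hp hF hF2 continuous_sineFun sineFun_sq_le
  have h5 : IsSchatten p (-(cfc clampFun F - F)) := by
    simpa using h2.mul_left hp (-1)
  rw [h1]
  exact (h2.diagOp hp h5).add hp ((h4.diagOp hp h4).mul_right hp _)

/-- Conjugation by the unitary `γ` is a star automorphism that maps `F` to `-F`, and functional
calculus is natural under it. -/
theorem cfc_conj {γ F : H →L[ℂ] H} (hγ : IsSelfAdjoint γ) (hγ2 : γ * γ = 1)
    (hF : IsSelfAdjoint F) (hFγ : γ * F = -(F * γ)) {g : ℝ → ℝ} (hg : Continuous g) :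
    γ * cfc g F = cfc (fun x => g (-x)) F * γ := by
  let u : unitary (H →L[ℂ] H) := ⟨γ, by
    rw [Unitary.mem_iff, hγ.star_eq]; exact ⟨hγ2, hγ2⟩⟩
  have hu : ∀ X : H →L[ℂ] H, Unitary.conjStarAlgAut ℂ (H →L[ℂ] H) u X = γ * X * γ := fun X => by
    rw [Unitary.conjStarAlgAut_apply]
    simp only [u, hγ.star_eq]
  have hcont : Continuous (Unitary.conjStarAlgAut ℂ (H →L[ℂ] H) u) := by
    have : ⇑(Unitary.conjStarAlgAut ℂ (H →L[ℂ] H) u) = fun X => γ * X * γ := funext hu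
    rw [this]
    fun_prop
  have hFn : γ * F * γ = -F := by rw [hFγ, neg_mul, mul_assoc, hγ2, mul_one]
  have h1 := StarAlgHomClass.map_cfc (S := ℂ) (Unitary.conjStarAlgAut ℂ (H →L[ℂ] H) u) g F
    hg.continuousOn hcont hF (by rw [hu, hFn]; exact hF.neg)
  rw [hu, hu, hFn, ← cfc_comp_neg (a := F) g hg.continuousOn hF] at h1
  rw [← h1, mul_assoc _ γ γ, hγ2, mul_one]

/-- The diagonal part is odd because `clampFun` is an odd function. In the other part `sineFun` is
even, and the flip anticommutes with `γ ⊕ (-γ)`. -/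
theorem symmetryOp_odd {γ F : H →L[ℂ] H} (hγ : IsSelfAdjoint γ) (hγ2 : γ * γ = 1)
    (hF : IsSelfAdjoint F) (hFγ : γ * F = -(F * γ)) :
    diagOp γ (-γ) * symmetryOp F = -(symmetryOp F * diagOp γ (-γ)) := by
  have hc : γ * cfc clampFun F = -(cfc clampFun F * γ) := by
    rw [cfc_conj hγ hγ2 hF hFγ continuous_clampFun]
    simp only [clampFun_neg]
    rw [cfc_neg, neg_mul]
  have hs : γ * cfc sineFun F = cfc sineFun F * γ := by
    rw [cfc_conj hγ hγ2 hF hFγ continuous_sineFun]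
    simp only [sineFun_neg]
  rw [symmetryOp, mul_add, add_mul, mul_assoc _ swapOp, swapOp_mul_diagOp, ← mul_assoc, ← mul_assoc,
    diagOp_mul, diagOp_mul, diagOp_mul, diagOp_mul, neg_add, ← neg_mul (diagOp (H := H) _ _) swapOp, diagOp_neg,
    diagOp_neg]
  simp only [neg_mul, mul_neg, neg_neg, hc, hs]

end Existence

end CyclicCharacter

end

noncomputable section

namespace CyclicCharacter

/-! ### The cyclic bicomplex and its projection onto the `(b, B)`-bicomplex. -/

section CyclicBicomplex

section Cyc

variable {A : Type*}

variable (A) in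
/-- All functionals of `n + 1` variables. -/
abbrev Functionals (n : ℕ) : Type _ := (Fin (n + 1) → A) → ℂ

/-- The inverse `(φ t)(a₀, …, aₙ) = (-1)^n φ(a₁, …, aₙ, a₀)` of the signed cyclic operator. -/
def cycInv (n : ℕ) : Module.End ℂ (Functionals A n) where
  toFun φ a := (-1 : ℂ) ^ n * φ (fun i => a (i + 1))
  map_add' φ χ := by funext a; simp [mul_add]
  map_smul' c φ := by funext a; simp; ring

theorem cycInv_pow_apply (n j : ℕ) (φ : Functionals A n) (a : Fin (n + 1) → A) :
    (cycInv n ^ j) φ a = (-1 : ℂ) ^ (n * j) * φ (fun i => a (i + Fin.ofNat (n + 1) j)) := by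
  induction j generalizing φ with
  | zero => simp
  | succ j ih =>
    rw [pow_succ, Module.End.mul_apply, ih]
    simp only [cycInv, LinearMap.coe_mk, AddHom.coe_mk]
    rw [← mul_assoc, ← pow_add]
    congr 3
    funext i
    congr 1
    ext
    simp only [Fin.val_add, Fin.val_ofNat, Fin.val_one', Nat.add_mod_mod, Nat.mod_add_mod]
    congr 1
    omega

theorem cycInv_pow_card (n : ℕ) : (cycInv n : Module.End ℂ (Functionals A n)) ^ (n + 1) = 1 := by
  ext φ a
  rw [cycInv_pow_apply, Module.End.one_apply, (Nat.even_mul_succ_self n).neg_one_pow, one_mul]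
  congr 1
  funext i
  congr 1
  ext
  simp

/-- The signed cyclic operator `(λ φ)(a₀, …, aₙ) = (-1)^n φ(aₙ, a₀, …, aₙ₋₁)`. -/
def cyc (n : ℕ) : Module.End ℂ (Functionals A n) := cycInv n ^ n

theorem cyc_mul_cycInv (n : ℕ) : (cyc n : Module.End ℂ (Functionals A n)) * cycInv n = 1 := by
  rw [cyc, ← pow_succ, cycInv_pow_card]

theorem cycInv_mul_cyc (n : ℕ) : (cycInv n : Module.End ℂ (Functionals A n)) * cyc n = 1 := by
  rw [cyc, ← pow_succ', cycInv_pow_card]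

theorem cyc_snoc (n : ℕ) (φ : Functionals A n) (a : Fin n → A) (x : A) :
    cyc n φ (Fin.snoc (α := fun _ => A) a x) = (-1 : ℂ) ^ n * φ (Fin.cons x a) := by
  rw [cyc, cycInv_pow_apply]
  congr 1
  · rcases Nat.even_or_odd n with h | h
    · rw [(h.mul_left n).neg_one_pow, h.neg_one_pow]
    · rw [(h.mul h).neg_one_pow, h.neg_one_pow]
  · congr 1
    funext i
    refine Fin.cases ?_ (fun i => ?_) i
    · have : (0 + Fin.ofNat (n + 1) n : Fin (n + 1)) = Fin.last n := by ext; simp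
      rw [this, Fin.snoc_last, Fin.cons_zero]
    · have : (i.succ + Fin.ofNat (n + 1) n : Fin (n + 1)) = i.castSucc := by
        ext
        have hi := i.isLt
        simp only [Fin.val_add, Fin.val_succ, Fin.val_ofNat, Nat.add_mod_mod, Fin.val_castSucc]
        rw [Nat.mod_eq_sub_mod (by omega), Nat.mod_eq_of_lt (by omega)]
        omega
      rw [this, Fin.snoc_castSucc, Fin.cons_succ]

/-- The norm operator, the sum of all powers of the signed cyclic operator. -/
def cycNorm (n : ℕ) : Module.End ℂ (Functionals A n) :=
  ∑ j ∈ Finset.range (n + 1), cycInv n ^ j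

theorem cycNorm_apply (n : ℕ) (φ : Functionals A n) (a : Fin (n + 1) → A) :
    cycNorm n φ a = ∑ j : Fin (n + 1), (-1 : ℂ) ^ (n * (j : ℕ)) * φ (fun i => a (i + j)) := by
  rw [cycNorm, LinearMap.sum_apply, Finset.sum_apply, Finset.sum_range]
  refine Finset.sum_congr rfl fun j _ => ?_
  rw [cycInv_pow_apply]
  simp

theorem cycNorm_mul_cycInv (n : ℕ) :
    (cycNorm n : Module.End ℂ (Functionals A n)) * cycInv n = cycNorm n := by
  rw [cycNorm, Finset.sum_mul]
  simp only [← pow_succ]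
  rw [Finset.sum_range_succ, cycInv_pow_card, Finset.sum_range_succ', pow_zero]

theorem cycInv_mul_cycNorm (n : ℕ) :
    (cycInv n : Module.End ℂ (Functionals A n)) * cycNorm n = cycNorm n := by
  rw [cycNorm, Finset.mul_sum]
  simp only [← pow_succ']
  rw [Finset.sum_range_succ, cycInv_pow_card, Finset.sum_range_succ', pow_zero]

theorem cyc_mul_cycNorm (n : ℕ) :
    (cyc n : Module.End ℂ (Functionals A n)) * cycNorm n = cycNorm n := by
  rw [← cycInv_mul_cycNorm, ← mul_assoc, cyc_mul_cycInv, one_mul, cycInv_mul_cycNorm]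

theorem cycNorm_mul_cyc (n : ℕ) :
    (cycNorm n : Module.End ℂ (Functionals A n)) * cyc n = cycNorm n := by
  rw [← cycNorm_mul_cycInv, mul_assoc, cycInv_mul_cyc, mul_one, cycNorm_mul_cycInv]

theorem cycNorm_mul_cycInv_pow (n j : ℕ) :
    (cycNorm n : Module.End ℂ (Functionals A n)) * cycInv n ^ j = cycNorm n := by
  induction j with
  | zero => simp
  | succ j ih => rw [pow_succ, ← mul_assoc, ih, cycNorm_mul_cycInv]

theorem cyc_pow_mul_cycNorm (n j : ℕ) :
    (cyc n : Module.End ℂ (Functionals A n)) ^ j * cycNorm n = cycNorm n := by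
  induction j with
  | zero => simp
  | succ j ih => rw [pow_succ, mul_assoc, cyc_mul_cycNorm, ih]

theorem sum_pow_eq_sum_pow_of_mul_eq_one {R : Type*} [Ring R] {x y : R} (hxy : x * y = 1)
    (hyx : y * x = 1) {n : ℕ} (hx : x ^ (n + 1) = 1) :
    ∑ j ∈ Finset.range (n + 1), y ^ j = ∑ j ∈ Finset.range (n + 1), x ^ j := by
  have hc : Commute x y := hxy.trans hyx.symm
  have h1 : ∀ j, x ^ j * y ^ j = 1 := fun j => by rw [← hc.mul_pow, hxy, one_pow]
  have hy : y ^ (n + 1) = 1 := by rw [← h1 (n + 1), hx, one_mul]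
  have h2 : ∀ j ∈ Finset.range (n + 1), x ^ (n - j) = y ^ (j + 1) := fun j hj => by
    have h3 : x ^ (n - j) * (x ^ (j + 1) * y ^ (j + 1)) = y ^ (j + 1) := by
      rw [← mul_assoc, ← pow_add, show n - j + (j + 1) = n + 1 by
        have := Finset.mem_range.mp hj; omega, hx, one_mul]
    rwa [h1, mul_one] at h3
  rw [← Finset.sum_range_reflect (fun j => x ^ j), Nat.add_sub_cancel, Finset.sum_congr rfl h2,
    Finset.sum_range_succ' (fun j => y ^ j), Finset.sum_range_succ (fun j => y ^ (j + 1)), hy,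
    pow_zero]

theorem cycNorm_eq_sum_cyc (n : ℕ) :
    (cycNorm n : Module.End ℂ (Functionals A n)) = ∑ j ∈ Finset.range (n + 1), cyc n ^ j :=
  (sum_pow_eq_sum_pow_of_mul_eq_one (cycInv_mul_cyc n) (cyc_mul_cycInv n)
    (cycInv_pow_card n)).symm

theorem cycInv_pow_cyc_pow (n j : ℕ) (φ : Functionals A n) :
    (cycInv n ^ j) ((cyc n ^ j) φ) = φ := by
  rw [← Module.End.mul_apply, ← Commute.mul_pow, cycInv_mul_cyc, one_pow, Module.End.one_apply]
  exact (cycInv_mul_cyc n).trans (cyc_mul_cycInv n).symm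

theorem cyc_cycInv_apply (n : ℕ) (φ : Functionals A n) : cyc n (cycInv n φ) = φ := by
  rw [← Module.End.mul_apply, cyc_mul_cycInv, Module.End.one_apply]

theorem cyc_cycNorm {n : ℕ} (φ : Functionals A n) : cyc n (cycNorm n φ) = cycNorm n φ := by
  rw [← Module.End.mul_apply, cyc_mul_cycNorm]

end Cyc

section Faces

variable {A : Type*} [Ring A]

/-- The alternating sum of the functions that multiply two neighbouring arguments of `f`. -/
def barD {M : Type*} [AddCommGroup M] [Module ℂ M] {n : ℕ} (f : (Fin (n + 1) → A) → M) :
    (Fin (n + 2) → A) → M := fun a =>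
  ∑ j : Fin (n + 1), (-1 : ℂ) ^ (j : ℕ) • f (Fin.contractNth j.castSucc (· * ·) a)

/-- The `j`-th cyclic face: the product of the neighbours `a_j` and `a_{j+1}`. -/
def face {n : ℕ} (j : ℕ) (a : Fin (n + 2) → A) : Fin (n + 1) → A := fun i =>
  if (i : ℕ) = j % (n + 1) then a (Fin.ofNat (n + 2) j) * a (Fin.ofNat (n + 2) (j + 1))
  else if (i : ℕ) < j then a i.castSucc else a i.succ

theorem face_of_le {n j : ℕ} (hj : j < n + 1) (a : Fin (n + 2) → A) :
    face j a = Fin.contractNth (⟨j, hj⟩ : Fin (n + 1)).castSucc (· * ·) a := by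
  funext i
  simp only [face, Fin.contractNth, Nat.mod_eq_of_lt hj, Fin.val_castSucc]
  rcases lt_trichotomy (i : ℕ) j with h | h | h
  · rw [if_neg h.ne, if_pos h, if_pos h]
  · rw [if_pos h, if_neg (by omega), if_pos h]
    congr 2
    · ext; simp [h, Nat.mod_eq_of_lt (show j < n + 2 by omega)]
    · ext; simp [h, Nat.mod_eq_of_lt (show j + 1 < n + 2 by omega)]
  · rw [if_neg h.ne', if_neg (by omega), if_neg (by omega), if_neg h.ne']

theorem face_last {n : ℕ} (a : Fin (n + 2) → A) : face (n + 1) a =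
    Fin.cons (a (Fin.last (n + 1)) * a 0) (fun i : Fin n => a i.succ.castSucc) := by
  funext i
  refine Fin.cases ?_ (fun i => ?_) i
  · simp only [face, Nat.mod_self, Fin.cons_zero]
    rw [if_pos (by simp)]
    congr 2
    · ext; simp
    · ext; simp
  · simp only [face, Nat.mod_self, Fin.cons_succ]
    rw [if_neg (by simp), if_pos (by have := i.isLt; simp)]

/-- All cyclic faces, including the wrapping one `j = n + 1`, become the zeroth face after rotation.
Hence `faceD_eq`, which reduces the relations between the faces and the cyclic operator to
computations with powers. -/
theorem face_rotate {n j : ℕ} (hj : j ≤ n + 1) (a : Fin (n + 2) → A) :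
    (fun i : Fin (n + 1) => face j a (i + Fin.ofNat (n + 1) j)) =
      face 0 (fun i => a (i + Fin.ofNat (n + 2) j)) := by
  funext i
  have hi := i.isLt
  have hv : ((i + Fin.ofNat (n + 1) j : Fin (n + 1)) : ℕ) = (i + j) % (n + 1) := by
    simp [Fin.val_add]
  have hmod : ∀ k, k < 2 * (n + 1) → k % (n + 1) = if k < n + 1 then k else k - (n + 1) := by
    intro k hk
    split_ifs with h
    · exact Nat.mod_eq_of_lt h
    · rw [Nat.mod_eq_sub_mod (by omega), Nat.mod_eq_of_lt (by omega)]
  simp only [face, hv, Nat.zero_mod]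
  rcases Nat.eq_zero_or_pos (i : ℕ) with h0 | h0
  · rw [if_pos (by rw [h0, zero_add]), if_pos h0]
    congr 2
    · ext; simp
    · ext; simp [Fin.val_add, add_comm]
  · rw [if_neg h0.ne', if_neg (Nat.not_lt_zero _)]
    have h1 := hmod (i + j) (by omega)
    have h2 := hmod j (by omega)
    rw [if_neg (by rw [h1, h2]; split_ifs <;> omega)]
    by_cases h3 : (i : ℕ) + j < n + 1
    · rw [if_neg (by rw [h1, if_pos h3]; omega)]
      congr 1
      ext
      simp only [Fin.val_succ, hv, Fin.val_add, Fin.val_ofNat]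
      rw [h1, if_pos h3, Nat.add_mod_mod, Nat.mod_eq_of_lt (by omega)]
      omega
    · rw [if_pos (by rw [h1, if_neg h3]; omega)]
      congr 1
      ext
      simp only [Fin.val_castSucc, Fin.val_succ, hv, Fin.val_add, Fin.val_ofNat]
      rw [h1, if_neg h3, Nat.add_mod_mod, Nat.mod_eq_sub_mod (by omega),
        Nat.mod_eq_of_lt (by omega)]
      omega

/-- The `j`-th signed cyclic face. -/
def faceD (n j : ℕ) : Functionals A n →ₗ[ℂ] Functionals A (n + 1) where
  toFun φ a := (-1 : ℂ) ^ j * φ (face j a)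
  map_add' φ χ := by funext a; simp [mul_add]
  map_smul' c φ := by funext a; simp; ring

/-- The contraction `(h χ)(a₀, …, aₙ) = (-1)^n χ(a₀, …, aₙ, 1)`. -/
def barH (n : ℕ) : Functionals A (n + 1) →ₗ[ℂ] Functionals A n where
  toFun φ a := (-1 : ℂ) ^ n * φ (Fin.snoc (α := fun _ => A) a 1)
  map_add' φ χ := by funext a; simp [mul_add]
  map_smul' c φ := by funext a; simp; ring

end Faces

section BB

variable {A : Type*} [Ring A]

/-- Applying `cyc` turns a last argument `1` into a first argument `1`. So `B₀ = h(1 - λ)`, and `B =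
N h (1 - λ)` by `connesB_eq`. -/
theorem connesB₀_eq (n : ℕ) (φ : Functionals A (n + 1)) :
    connesB₀ n φ = barH n (φ - cyc (n + 1) φ) := by
  funext a
  simp only [connesB₀, barH, LinearMap.coe_mk, AddHom.coe_mk, Pi.sub_apply, cyc_snoc]
  rw [mul_sub, ← mul_assoc, pow_succ]
  have : (-1 : ℂ) ^ n * (-1) ^ n = 1 := by rw [← mul_pow]; simp
  linear_combination -φ (Fin.cons 1 a) * this

theorem connesB_eq (n : ℕ) (φ : Functionals A (n + 1)) :
    connesB n φ = cycNorm n (connesB₀ n φ) := by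
  funext a
  rw [cycNorm_apply]
  rfl

theorem barD_eq_sum {n : ℕ} (φ : Functionals A n) :
    barD φ = ∑ j ∈ Finset.range (n + 1), faceD n j φ := by
  funext a
  rw [Finset.sum_apply, Finset.sum_range]
  refine Finset.sum_congr rfl fun j _ => ?_
  simp only [faceD, LinearMap.coe_mk, AddHom.coe_mk]
  rw [face_of_le j.isLt, smul_eq_mul]

theorem hochschildb_eq_sum {n : ℕ} (φ : Functionals A n) :
    hochschildb n φ = ∑ j ∈ Finset.range (n + 2), faceD n j φ := by
  rw [Finset.sum_range_succ, ← barD_eq_sum]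
  funext a
  simp only [hochschildb, barD, Pi.add_apply, faceD, LinearMap.coe_mk, AddHom.coe_mk, face_last,
    smul_eq_mul]

theorem faceD_cycInv_pow {n j : ℕ} (hj : j ≤ n + 1) (φ : Functionals A n) :
    faceD n j ((cycInv n ^ j) φ) = (cycInv (n + 1) ^ j) (faceD n 0 φ) := by
  funext a
  simp only [faceD, LinearMap.coe_mk, AddHom.coe_mk, cycInv_pow_apply]
  rw [face_rotate hj, pow_zero, one_mul, ← mul_assoc, ← pow_add]
  congr 2
  ring

theorem faceD_eq {n j : ℕ} (hj : j ≤ n + 1) (φ : Functionals A n) :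
    faceD n j φ = (cycInv (n + 1) ^ j) (faceD n 0 ((cyc n ^ j) φ)) := by
  rw [← faceD_cycInv_pow hj, cycInv_pow_cyc_pow]

theorem cyc_faceD_succ {n j : ℕ} (hj : j ≤ n) (φ : Functionals A n) :
    cyc (n + 1) (faceD n (j + 1) φ) = faceD n j (cyc n φ) := by
  rw [faceD_eq (j := j + 1) (by omega) φ, faceD_eq (j := j) (by omega) (cyc n φ), pow_succ', Module.End.mul_apply, cyc_cycInv_apply,
    pow_succ (cyc n), Module.End.mul_apply]

theorem cyc_faceD_zero {n : ℕ} (φ : Functionals A n) :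
    cyc (n + 1) (faceD n 0 φ) = faceD n (n + 1) φ := by
  have h1 : (cyc n : Module.End ℂ (Functionals A n)) ^ (n + 1) = 1 := by
    rw [cyc, ← pow_mul, mul_comm, pow_mul, cycInv_pow_card, one_pow]
  rw [faceD_eq le_rfl φ, h1]
  rfl

/-- The relation `(1 - λ) b = b' (1 - λ)`. -/
theorem hochschildb_sub_cyc {n : ℕ} (φ : Functionals A n) :
    hochschildb n φ - cyc (n + 1) (hochschildb n φ) = barD (φ - cyc n φ) := by
  have h1 : cyc (n + 1) (hochschildb n φ) = barD (cyc n φ) + faceD n (n + 1) φ := by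
    rw [hochschildb_eq_sum, Finset.sum_range_succ', map_add, map_sum, cyc_faceD_zero, barD_eq_sum]
    congr 1
    exact Finset.sum_congr rfl fun j hj => cyc_faceD_succ (by
      have := Finset.mem_range.mp hj; omega) φ
  have h2 : hochschildb n φ = barD φ + faceD n (n + 1) φ := by
    rw [hochschildb_eq_sum, Finset.sum_range_succ, barD_eq_sum]
  rw [h1, h2, add_sub_add_right_eq_sub, barD_eq_sum, barD_eq_sum, barD_eq_sum,
    ← Finset.sum_sub_distrib]
  simp only [map_sub]

/-- The relation `b N = N b'`. -/
theorem hochschildb_cycNorm {n : ℕ} (φ : Functionals A n) :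
    hochschildb n (cycNorm n φ) = cycNorm (n + 1) (barD φ) := by
  trans cycNorm (n + 1) (faceD n 0 (cycNorm n φ))
  · rw [hochschildb_eq_sum, cycNorm.eq_1 (n + 1), LinearMap.sum_apply]
    refine Finset.sum_congr rfl fun j hj => ?_
    rw [faceD_eq (by have := Finset.mem_range.mp hj; omega), ← Module.End.mul_apply (cyc n ^ j),
      cyc_pow_mul_cycNorm]
  · rw [barD_eq_sum, map_sum, cycNorm_eq_sum_cyc n, LinearMap.sum_apply, map_sum, map_sum]
    refine Finset.sum_congr rfl fun j hj => ?_
    rw [faceD_eq (j := j) (by have := Finset.mem_range.mp hj; omega),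
      ← Module.End.mul_apply (cycNorm (n + 1)), cycNorm_mul_cycInv_pow]

theorem contractNth_snoc {n : ℕ} (j : Fin (n + 1)) (a : Fin (n + 2) → A) (x : A) :
    Fin.contractNth j.castSucc.castSucc (· * ·) (Fin.snoc (α := fun _ => A) a x) =
      Fin.snoc (α := fun _ => A) (Fin.contractNth j.castSucc (· * ·) a) x := by
  funext i
  refine Fin.lastCases ?_ (fun i => ?_) i
  · have hj := j.isLt
    simp only [Fin.contractNth, Fin.val_castSucc, Fin.val_last, Fin.snoc_last]
    rw [if_neg (by omega), if_neg (by omega), Fin.succ_last, Fin.snoc_last]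
  · simp only [Fin.contractNth, Fin.val_castSucc, Fin.snoc_castSucc, Fin.succ_castSucc]

theorem contractNth_last_snoc {n : ℕ} (a : Fin (n + 1) → A) :
    Fin.contractNth (Fin.last n).castSucc (· * ·) (Fin.snoc (α := fun _ => A) a 1) = a := by
  funext i
  have hi := i.isLt
  simp only [Fin.contractNth, Fin.val_castSucc, Fin.val_last, Fin.snoc_castSucc]
  rcases Nat.lt_or_ge (i : ℕ) n with h | h
  · rw [if_pos h]
  · have : i = Fin.last n := by ext; simp; omega
    subst this
    rw [if_neg (by simp), if_pos (by simp), Fin.succ_last, Fin.snoc_last, mul_one]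

/-- The relation `b' h + h b' = 1`. -/
theorem barD_barH_add {n : ℕ} (φ : Functionals A (n + 1)) :
    barD (barH n φ) + barH (n + 1) (barD φ) = φ := by
  have hs : (-1 : ℂ) ^ (n + 1) * (-1) ^ (n + 1) = 1 := by rw [← mul_pow]; simp
  funext a
  simp only [Pi.add_apply, barD, barH, LinearMap.coe_mk, AddHom.coe_mk]
  rw [Fin.sum_univ_castSucc (n := n + 1)]
  simp only [contractNth_snoc, contractNth_last_snoc, Fin.val_castSucc, Fin.val_last, smul_eq_mul]
  rw [mul_add, ← mul_assoc, hs, one_mul, Finset.mul_sum, ← add_assoc, ← Finset.sum_add_distrib]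
  rw [Finset.sum_eq_zero, zero_add]
  intro j _
  ring

theorem barH_barD_zero (φ : Functionals A 0) : barH 0 (barD φ) = φ := by
  funext a
  simp only [barD, barH, LinearMap.coe_mk, AddHom.coe_mk]
  have := contractNth_last_snoc (n := 0) a
  rw [Fin.sum_univ_castSucc (n := 0), this]
  simp

theorem barD_sub {n : ℕ} (φ χ : Functionals A n) : barD (φ - χ) = barD φ - barD χ := by
  simp only [barD_eq_sum, map_sub, Finset.sum_sub_distrib]

theorem hochschildb_add {n : ℕ} (φ χ : Functionals A n) :
    hochschildb n (φ + χ) = hochschildb n φ + hochschildb n χ := by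
  simp only [hochschildb_eq_sum, map_add, Finset.sum_add_distrib]

theorem connesB₀_add {n : ℕ} (φ χ : Functionals A (n + 1)) :
    connesB₀ n (φ + χ) = connesB₀ n φ + connesB₀ n χ := by
  rw [connesB₀_eq, connesB₀_eq, connesB₀_eq, ← map_add, map_add]
  congr 1
  abel

theorem connesB₀_of_cyc {n : ℕ} {φ : Functionals A (n + 1)} (h : cyc (n + 1) φ = φ) :
    connesB₀ n φ = 0 := by
  rw [connesB₀_eq, h, sub_self, map_zero]

/-- `h(1 - λ)b = h b'(1 - λ) = (1 - λ) - b' h(1 - λ)`. -/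
theorem connesB₀_hochschildb {n : ℕ} (φ : Functionals A (n + 1)) :
    connesB₀ (n + 1) (hochschildb (n + 1) φ) =
      φ - cyc (n + 1) φ - barD (connesB₀ n φ) := by
  rw [connesB₀_eq, hochschildb_sub_cyc, connesB₀_eq]
  exact eq_sub_of_add_eq' (barD_barH_add (φ - cyc (n + 1) φ))

theorem totalD_zero (c : CochainFamily A) : totalD A c 0 = cycNorm 0 (connesB₀ 0 (c 1)) := by
  rw [← connesB_eq]; rfl

theorem totalD_succ (c : CochainFamily A) (n : ℕ) :
    totalD A c (n + 1) = hochschildb n (c n) + cycNorm (n + 1) (connesB₀ (n + 1) (c (n + 2))) := by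
  rw [← connesB_eq]; rfl

/-- The projection of the cyclic bicomplex onto the `(b, B)`-bicomplex. A cochain `(α, β)` of the
former has its component `α` in the Hochschild columns and `β` in the bar columns. -/
def bicomplexProj (α β : CochainFamily A) : CochainFamily A := fun n =>
  α n + cycNorm n (barH n (β (n + 1) - connesB₀ (n + 1) (α (n + 2))))

/-- The differential of the cyclic bicomplex, Hochschild columns. -/
def bicomplexHoch (α β : CochainFamily A) : CochainFamily A := fun n =>
  match n with
  | 0 => cycNorm 0 (β 0)
  | n + 1 => hochschildb n (α n) + cycNorm (n + 1) (β (n + 1))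

/-- The differential of the cyclic bicomplex, bar columns. -/
def bicomplexBar (α β : CochainFamily A) : CochainFamily A := fun n =>
  match n with
  | 0 => 0
  | n + 1 => α (n + 1) - cyc (n + 1) (α (n + 1)) - barD (β n)

/-- The substitution `β' = β - B₀ α` decouples the bar columns: the differential acts on `β'` by
`-b'` alone, and on `α` by `(b + B)α + Nβ'`. -/
theorem bicomplexProj_differential_aux (α β : CochainFamily A) (n : ℕ) :
    bicomplexBar α β (n + 1) - connesB₀ (n + 1) (bicomplexHoch α β (n + 2)) =
      -barD (β n - connesB₀ n (α (n + 1))) := by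
  simp only [bicomplexBar, bicomplexHoch]
  rw [connesB₀_add, connesB₀_of_cyc (cyc_cycNorm _), connesB₀_hochschildb, barD_sub]
  abel

/-- In the coordinates `(α, β')` of the previous lemma, the term `Nβ'` is produced by the
contraction: `b N h β' = N b' h β' = Nβ' - N h b' β'`, while `B N = 0` as `(1 - λ)N = 0`. -/
theorem totalD_bicomplexProj (α β : CochainFamily A) :
    totalD A (bicomplexProj α β) = bicomplexProj (bicomplexHoch α β) (bicomplexBar α β) := by
  funext n
  rcases n with _ | n
  · rw [totalD_zero, bicomplexProj.eq_1 (bicomplexHoch α β), bicomplexProj_differential_aux,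
      bicomplexProj, connesB₀_add, connesB₀_of_cyc (cyc_cycNorm _), add_zero, map_neg,
      barH_barD_zero]
    simp [bicomplexHoch]
  · rw [totalD_succ, bicomplexProj, bicomplexProj, bicomplexProj, bicomplexProj_differential_aux,
      connesB₀_add, connesB₀_of_cyc (cyc_cycNorm _), add_zero, hochschildb_add, hochschildb_cycNorm]
    have h := barD_barH_add (β (n + 1) - connesB₀ (n + 1) (α (n + 2)))
    rw [eq_sub_of_add_eq h, map_neg, map_neg, map_sub, map_sub]
    simp only [bicomplexHoch]
    abel

end BB

end CyclicBicomplex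

end CyclicCharacter

end

noncomputable section

namespace CyclicCharacter

/-! ### Multilinearity and membership in the periodic complex. -/

section Multilinear

variable {A : Type*} [Ring A] [Algebra ℂ A]

/-- The function `f` of `n` variables with values in `M` is `ℂ`-multilinear. -/
def IsMultilinearMap {M : Type*} [AddCommGroup M] [Module ℂ M] {n : ℕ} (f : (Fin n → A) → M) :
    Prop :=
  ∃ g : MultilinearMap ℂ (fun _ : Fin n => A) M, ⇑g = f

section Closure

variable {M M' : Type*} [AddCommGroup M] [Module ℂ M] [AddCommGroup M'] [Module ℂ M'] {n : ℕ}

theorem IsMultilinearMap.add {f f' : (Fin n → A) → M} (hf : IsMultilinearMap f)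
    (hf' : IsMultilinearMap f') : IsMultilinearMap (f + f') := by
  obtain ⟨g, rfl⟩ := hf
  obtain ⟨g', rfl⟩ := hf'
  exact ⟨g + g', rfl⟩

theorem IsMultilinearMap.smul (c : ℂ) {f : (Fin n → A) → M} (hf : IsMultilinearMap f) :
    IsMultilinearMap (c • f) := by
  obtain ⟨g, rfl⟩ := hf
  exact ⟨c • g, rfl⟩

theorem isMultilinearMap_zero : IsMultilinearMap (0 : (Fin n → A) → M) := ⟨0, rfl⟩

theorem IsMultilinearMap.sub {f f' : (Fin n → A) → M} (hf : IsMultilinearMap f)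
    (hf' : IsMultilinearMap f') : IsMultilinearMap (f - f') := by
  obtain ⟨g, rfl⟩ := hf
  obtain ⟨g', rfl⟩ := hf'
  exact ⟨g - g', rfl⟩

theorem IsMultilinearMap.sum {ι : Type*} {s : Finset ι} {f : ι → (Fin n → A) → M}
    (hf : ∀ i ∈ s, IsMultilinearMap (f i)) : IsMultilinearMap (∑ i ∈ s, f i) :=
  Finset.sum_induction f IsMultilinearMap (fun _ _ => IsMultilinearMap.add) isMultilinearMap_zero hf

theorem IsMultilinearMap.comp {f : (Fin n → A) → M} (hf : IsMultilinearMap f) (T : M →ₗ[ℂ] M') :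
    IsMultilinearMap fun a => T (f a) := by
  obtain ⟨g, rfl⟩ := hf
  exact ⟨T.compMultilinearMap g, rfl⟩

theorem IsMultilinearMap.comp_equiv {f : (Fin n → A) → M} (hf : IsMultilinearMap f)
    (σ : Equiv.Perm (Fin n)) : IsMultilinearMap fun a => f fun i => a (σ i) := by
  obtain ⟨g, rfl⟩ := hf
  exact ⟨g.domDomCongr σ, rfl⟩

theorem IsMultilinearMap.snoc {f : (Fin (n + 1) → A) → M} (hf : IsMultilinearMap f) (x : A) :
    IsMultilinearMap fun a => f (Fin.snoc (α := fun _ => A) a x) := by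
  obtain ⟨g, rfl⟩ := hf
  exact ⟨(LinearMap.applyₗ x).compMultilinearMap g.curryRight, rfl⟩

theorem IsMultilinearMap.cons {f : (Fin (n + 1) → A) → M} (hf : IsMultilinearMap f) (x : A) :
    IsMultilinearMap fun a => f (Fin.cons x a) := by
  obtain ⟨g, rfl⟩ := hf
  exact ⟨g.curryLeft x, rfl⟩

theorem isMultilinearMap_const (x : M) : IsMultilinearMap fun _ : Fin 0 → A => x :=
  ⟨MultilinearMap.constOfIsEmpty ℂ _ x, rfl⟩

theorem IsMultilinearMap.cons_mul {R : Type*} [Ring R] [Algebra ℂ R] {f : (Fin n → A) → R}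
    (hf : IsMultilinearMap f) (l : A →ₗ[ℂ] R) :
    IsMultilinearMap fun a : Fin (n + 1) → A => l (a 0) * f (Fin.tail a) := by
  obtain ⟨g, rfl⟩ := hf
  exact ⟨LinearMap.uncurryLeft (M := fun _ => A)
    { toFun := fun x => (LinearMap.mulLeft ℂ (l x)).compMultilinearMap g
      map_add' := fun x y => by ext a; simp [add_mul]
      map_smul' := fun c x => by ext a; simp }, rfl⟩

end Closure

variable {n : ℕ}

theorem isMultilinearMap_cycNorm {φ : Functionals A n} (h : IsMultilinearMap φ) :
    IsMultilinearMap (cycNorm n φ) := by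
  have h1 : cycNorm n φ = ∑ j : Fin (n + 1), (-1 : ℂ) ^ (n * (j : ℕ)) •
      fun a : Fin (n + 1) → A => φ fun i => a (i + j) := by
    funext a
    rw [cycNorm_apply, Finset.sum_apply]
    rfl
  rw [h1]
  exact IsMultilinearMap.sum fun j _ => (h.comp_equiv (Equiv.addRight j)).smul _

theorem isMultilinearMap_barH {φ : Functionals A (n + 1)} (h : IsMultilinearMap φ) :
    IsMultilinearMap (barH n φ) :=
  (h.snoc 1).smul _

theorem isMultilinearMap_connesB₀ {φ : Functionals A (n + 1)} (h : IsMultilinearMap φ) :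
    IsMultilinearMap (connesB₀ n φ) :=
  (h.cons 1).sub ((h.snoc 1).smul _)

theorem bicomplexProj_mem {α β : CochainFamily A} (hα : ∀ n, IsMultilinearMap (α n))
    (hβ : ∀ n, IsMultilinearMap (β n)) {i : ZMod 2} (hαi : ∀ n : ℕ, (n : ZMod 2) ≠ i → α n = 0)
    (hβi : ∀ n : ℕ, (n : ZMod 2) = i → β n = 0) {K : ℕ} (hαK : ∀ n, K < n → α n = 0)
    (hβK : ∀ n, K < n → β n = 0) : bicomplexProj α β ∈ periodicCochains A i := by
  have hB0 : ∀ n, connesB₀ (A := A) n 0 = 0 := fun n => by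
    rw [connesB₀_eq, map_zero, sub_zero, map_zero]
  refine ⟨fun n => ?_, fun n hn => ?_, K, fun n hn => ?_⟩
  · exact (hα n).add (isMultilinearMap_cycNorm (isMultilinearMap_barH
      ((hβ (n + 1)).sub (isMultilinearMap_connesB₀ (hα (n + 2))))))
  · have h1 : ((n + 1 : ℕ) : ZMod 2) = i := by
      have key : ∀ x y : ZMod 2, x ≠ y → x + 1 = y := by decide
      push_cast
      exact key _ _ hn
    have h2 : ((n + 2 : ℕ) : ZMod 2) ≠ i := by
      push_cast
      have : (2 : ZMod 2) = 0 := rfl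
      rwa [this, add_zero]
    rw [bicomplexProj, hαi n hn, hβi _ h1, hαi _ h2, hB0]
    simp
  · rw [bicomplexProj, hαK n hn, hβK _ (by omega), hαK _ (by omega), hB0]
    simp

end Multilinear

end CyclicCharacter

end

noncomputable section

namespace CyclicCharacter

/-! ### Words in a resolvent and their bar differentials. -/

section Words

variable {A : Type*}

section Defs

variable {R : Type*} [Ring R]

/-- The word `G x(a₁) G x(a₂) G ⋯ x(aₙ) G`. -/
def word (G : R) (x : A → R) : (n : ℕ) → (Fin n → A) → R
  | 0, _ => G
  | n + 1, a => G * x (a 0) * word G x n (Fin.tail a)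

/-- The signed sum of the words `G x(a₁) G ⋯ x(aₛ) G V G x(aₛ₊₁) ⋯ x(aₙ) G` with one letter `V`
inserted. -/
def wordIns (G V : R) (x : A → R) : (n : ℕ) → (Fin n → A) → R
  | 0, _ => G * V * G
  | n + 1, a => G * V * G * x (a 0) * word G x n (Fin.tail a) -
      G * x (a 0) * wordIns G V x n (Fin.tail a)

end Defs

section BarRecursion

variable [Ring A] {M : Type*} [AddCommGroup M] [Module ℂ M]

theorem contractNth_zero {n : ℕ} (a : Fin (n + 2) → A) :
    Fin.contractNth (0 : Fin (n + 1)).castSucc (· * ·) a =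
      Fin.cons (a 0 * a 1) (Fin.tail (Fin.tail a)) := by
  funext i
  refine Fin.cases ?_ (fun i => ?_) i
  · simp [Fin.contractNth]
  · simp [Fin.contractNth, Fin.tail]

theorem contractNth_succ {n : ℕ} (j : Fin (n + 1)) (a : Fin (n + 3) → A) :
    Fin.contractNth j.succ.castSucc (· * ·) a =
      Fin.cons (a 0) (Fin.contractNth j.castSucc (· * ·) (Fin.tail a)) := by
  funext i
  refine Fin.cases ?_ (fun i => ?_) i
  · simp [Fin.contractNth]
  · simp [Fin.contractNth, Fin.tail]

theorem barD_one (f : (Fin 1 → A) → M) (a : Fin 2 → A) :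
    barD f a = f (Fin.cons (a 0 * a 1) (Fin.tail (Fin.tail a))) := by
  rw [barD, Fin.sum_univ_succ, contractNth_zero]
  simp

theorem barD_succ {n : ℕ} (f : (Fin (n + 2) → A) → M) (a : Fin (n + 3) → A) :
    barD f a = f (Fin.cons (a 0 * a 1) (Fin.tail (Fin.tail a))) -
      barD (fun v => f (Fin.cons (a 0) v)) (Fin.tail a) := by
  rw [barD, Fin.sum_univ_succ, contractNth_zero, Fin.val_zero, pow_zero, one_smul, barD,
    sub_eq_add_neg, ← Finset.sum_neg_distrib]
  congr 1
  refine Finset.sum_congr rfl fun j _ => ?_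
  rw [contractNth_succ, Fin.val_succ, pow_succ, mul_neg_one, neg_smul]

theorem barD_comp {M' : Type*} [AddCommGroup M'] [Module ℂ M'] {n : ℕ}
    (f : (Fin (n + 1) → A) → M) (T : M →ₗ[ℂ] M') (a : Fin (n + 2) → A) :
    barD (fun v => T (f v)) a = T (barD f a) := by
  simp [barD, map_sum]

theorem barD_mul_left {R : Type*} [Ring R] [Algebra ℂ R] {n : ℕ} (f : (Fin (n + 1) → A) → R)
    (r : R) (a : Fin (n + 2) → A) : barD (fun v => r * f v) a = r * barD f a :=
  barD_comp f (LinearMap.mulLeft ℂ r) a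

theorem barD_fun_sub {n : ℕ} (f g : (Fin (n + 1) → A) → M) (a : Fin (n + 2) → A) :
    barD (fun v => f v - g v) a = barD f a - barD g a := by
  simp [barD, smul_sub, Finset.sum_sub_distrib]

end BarRecursion

section Identities

variable [Ring A] {R : Type*} [Ring R] [Algebra ℂ R]

/-- The algebraic relations between the letters of the words. -/
structure WordRelations (ρ : A → R) (F G z : R) (x : A → R) : Prop where
  map_mul : ∀ a b, x (a * b) = x a * ρ b + ρ a * x b
  central : ∀ r, r * z = z * r
  comm : F * G = G * F
  resolvent : ∀ a, ρ a * G = G * ρ a + z * (G * (F * x a + x a * F) * G)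

variable {ρ x : A → R} {F G z : R}

/-- The right hand side of the formula for the bar differential of words. -/
def wordBar (ρ : A → R) (F G z : R) (x : A → R) (n : ℕ) (a : Fin (n + 1) → A) : R :=
  ρ (a 0) * word G x n (Fin.tail a) -
    (-1 : ℂ) ^ n • (word G x n (Fin.init a) * ρ (a (Fin.last n))) -
    z * (F * word G x (n + 1) a - (-1 : ℂ) ^ (n + 1) • (word G x (n + 1) a * F))

theorem WordRelations.wordBar_zero (h : WordRelations ρ F G z x) (a : Fin 1 → A) :
    wordBar ρ F G z x 0 a = 0 := by
  have h1 := h.resolvent (a 0)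
  have h2 : ∀ r, F * (G * r) = G * (F * r) := fun r => by
    rw [← mul_assoc, h.comm, mul_assoc]
  simp only [wordBar, word]
  rw [h1]
  simp only [pow_zero, zero_add, pow_one, one_smul, neg_smul, Fin.isValue, Fin.last_zero,
    mul_add, add_mul, mul_sub, mul_neg, mul_assoc, h2, h.comm]
  abel

/-- Splitting off the first letter, the right hand side satisfies the recursion `barD_succ` of the
bar differential. The resolvent relation moves `ρ (a 0)` across `G`, and the derivation rule
assembles `x (a 0 * a 1)`. -/
theorem WordRelations.wordBar_succ (h : WordRelations ρ F G z x) (n : ℕ) (a : Fin (n + 2) → A) :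
    wordBar ρ F G z x (n + 1) a = G * x (a 0 * a 1) * word G x n (Fin.tail (Fin.tail a)) -
      G * x (a 0) * wordBar ρ F G z x n (Fin.tail a) := by
  have h1 := h.resolvent (a 0)
  have h2 : ∀ r, F * (G * r) = G * (F * r) := fun r => by
    rw [← mul_assoc, h.comm, mul_assoc]
  have h3 : ∀ r s, r * (z * s) = z * (r * s) := fun r s => by
    rw [← mul_assoc, h.central, mul_assoc]
  have h4 : ∀ r, ρ (a 0) * (G * r) = G * (ρ (a 0) * r) +
      z * (G * (F * (x (a 0) * (G * r)))) + z * (G * (x (a 0) * (F * (G * r)))) := fun r => by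
    rw [← mul_assoc, h1]
    noncomm_ring
  have e1 : (Fin.tail a) 0 = a 1 := rfl
  have e2 : (Fin.init a) 0 = a 0 := rfl
  have e3 : (Fin.tail a) (Fin.last n) = a (Fin.last (n + 1)) := rfl
  simp only [wordBar, word, Fin.tail_init_eq_init_tail, e1, e2, e3, h.map_mul]
  generalize word G x n (Fin.tail (Fin.tail a)) = P
  generalize word G x n (Fin.init (Fin.tail a)) = P'
  obtain ⟨s, hs⟩ : ∃ s : ℂ, (-1) ^ n = s := ⟨_, rfl⟩
  have hs1 : (-1 : ℂ) ^ (n + 1) = -s := by rw [pow_succ, hs, mul_neg_one]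
  have hs2 : (-1 : ℂ) ^ (n + 1 + 1) = s := by rw [pow_succ, hs1, mul_neg_one, neg_neg]
  simp only [hs, hs1, hs2, neg_smul, mul_add, add_mul, mul_sub, mul_assoc,
    mul_smul_comm, h4, sub_neg_eq_add]
  simp only [h2, h3 G, h3 (x _)]
  abel

/-- A Bianchi identity. Apart from the end terms in `ρ`, the differential is `z` times a
supercommutator with `F`, which a trace will annihilate. -/
theorem WordRelations.barD_word (h : WordRelations ρ F G z x) (n : ℕ) (a : Fin (n + 2) → A) :
    barD (word G x (n + 1)) a = wordBar ρ F G z x (n + 1) a := by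
  induction n with
  | zero =>
    rw [h.wordBar_succ, h.wordBar_zero, mul_zero, sub_zero, barD_one]
    rfl
  | succ n ih =>
    rw [h.wordBar_succ, ← ih, barD_succ, ← barD_mul_left]
    rfl

variable {V : R} {D : R → R}

/-- The relations satisfied by a derivation `D` with `D F = V`. -/
structure WordDerivation (ρ : A → R) (F G z V : R) (x : A → R) (D : R → R) : Prop where
  leibniz : ∀ r s, D (r * s) = D r * s + r * D s
  map_G : D G = -(z * (G * (F * V + V * F) * G))
  map_x : ∀ a, D (x a) = V * ρ a - ρ a * V

/-- The right hand side of the formula for the bar differential of words with an insertion. -/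
def wordInsBar (ρ : A → R) (F G z V : R) (x : A → R) (D : R → R) (n : ℕ) (a : Fin (n + 1) → A) :
    R :=
  ρ (a 0) * wordIns G V x n (Fin.tail a) -
    (-1 : ℂ) ^ n • (wordIns G V x n (Fin.init a) * ρ (a (Fin.last n))) +
    D (word G x (n + 1) a) +
    z * (F * wordIns G V x (n + 1) a + (-1 : ℂ) ^ (n + 1) • (wordIns G V x (n + 1) a * F))

theorem WordRelations.wordInsBar_zero (h : WordRelations ρ F G z x)
    (hD : WordDerivation ρ F G z V x D) (a : Fin 1 → A) :
    wordInsBar ρ F G z V x D 0 a = 0 := by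
  have h1 := h.resolvent (a 0)
  have h2 : ∀ r, F * (G * r) = G * (F * r) := fun r => by
    rw [← mul_assoc, h.comm, mul_assoc]
  have h3 : ∀ r s, r * (z * s) = z * (r * s) := fun r s => by
    rw [← mul_assoc, h.central, mul_assoc]
  have h4 : ∀ r, ρ (a 0) * (G * r) = G * (ρ (a 0) * r) +
      z * (G * (F * (x (a 0) * (G * r)))) + z * (G * (x (a 0) * (F * (G * r)))) := fun r => by
    rw [← mul_assoc, h1]
    noncomm_ring
  simp only [wordInsBar, wordIns, word, hD.leibniz, hD.map_G, hD.map_x]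
  simp only [pow_zero, zero_add, pow_one, one_smul, neg_smul, Fin.isValue, Fin.last_zero,
    mul_add, add_mul, mul_sub, sub_mul, mul_neg, neg_mul, mul_assoc, h4, h1, neg_add, neg_sub]
  simp only [h2, h.comm, h3 G, h3 (x _), h3 V]
  abel

theorem WordRelations.wordInsBar_succ (h : WordRelations ρ F G z x)
    (hD : WordDerivation ρ F G z V x D) (n : ℕ) (a : Fin (n + 2) → A) :
    wordInsBar ρ F G z V x D (n + 1) a =
      wordIns G V x (n + 1) (Fin.cons (a 0 * a 1) (Fin.tail (Fin.tail a))) -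
      (G * V * G * x (a 0) * wordBar ρ F G z x n (Fin.tail a) -
        G * x (a 0) * wordInsBar ρ F G z V x D n (Fin.tail a)) := by
  have h1 := h.resolvent (a 0)
  have h2 : ∀ r, F * (G * r) = G * (F * r) := fun r => by
    rw [← mul_assoc, h.comm, mul_assoc]
  have h3 : ∀ r s, r * (z * s) = z * (r * s) := fun r s => by
    rw [← mul_assoc, h.central, mul_assoc]
  have h4 : ∀ r, ρ (a 0) * (G * r) = G * (ρ (a 0) * r) +
      z * (G * (F * (x (a 0) * (G * r)))) + z * (G * (x (a 0) * (F * (G * r)))) := fun r => by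
    rw [← mul_assoc, h1]
    noncomm_ring
  have e1 : (Fin.tail a) 0 = a 1 := rfl
  have e2 : (Fin.init a) 0 = a 0 := rfl
  have e3 : (Fin.tail a) (Fin.last n) = a (Fin.last (n + 1)) := rfl
  simp only [wordInsBar, wordIns, wordBar, word, Fin.tail_init_eq_init_tail, e1, e2, e3, h.map_mul,
    Fin.cons_zero, Fin.tail_cons, hD.leibniz, hD.map_G, hD.map_x]
  generalize word G x n (Fin.tail (Fin.tail a)) = P
  generalize word G x n (Fin.init (Fin.tail a)) = P'
  generalize wordIns G V x n (Fin.tail (Fin.tail a)) = Q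
  generalize wordIns G V x n (Fin.init (Fin.tail a)) = Q'
  generalize D P = DP
  obtain ⟨s, hs⟩ : ∃ s : ℂ, (-1) ^ n = s := ⟨_, rfl⟩
  have hs1 : (-1 : ℂ) ^ (n + 1) = -s := by rw [pow_succ, hs, mul_neg_one]
  have hs2 : (-1 : ℂ) ^ (n + 1 + 1) = s := by rw [pow_succ, hs1, mul_neg_one, neg_neg]
  simp only [hs, hs1, hs2, neg_smul, mul_add, add_mul, mul_sub, sub_mul, mul_neg, neg_mul,
    neg_add, mul_assoc, mul_smul_comm, h4, sub_neg_eq_add, smul_sub]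
  simp only [h2, h3 G, h3 (x _), h3 V]
  abel

/-- The transgression identity: up to end terms and a supercommutator, the derivative `D` of a word
is the bar differential of the words with `V = D F` inserted. -/
theorem WordRelations.barD_wordIns (h : WordRelations ρ F G z x)
    (hD : WordDerivation ρ F G z V x D) (n : ℕ) (a : Fin (n + 2) → A) :
    barD (wordIns G V x (n + 1)) a = wordInsBar ρ F G z V x D (n + 1) a := by
  induction n with
  | zero =>
    rw [h.wordInsBar_succ hD, h.wordBar_zero, h.wordInsBar_zero hD, mul_zero, mul_zero, sub_zero,
      sub_zero, barD_one]
  | succ n ih =>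
    rw [h.wordInsBar_succ hD, ← ih, ← h.barD_word, barD_succ, ← barD_mul_left, ← barD_mul_left,
      ← barD_fun_sub]
    rfl

end Identities

end Words

end CyclicCharacter

end

noncomputable section

namespace CyclicCharacter

open PowerSeries

/-! ### Filtered algebras with a twisted trace. -/

section Traced

variable (A L : Type*) [Ring A] [Algebra ℂ A] [Ring L] [Algebra ℂ L]

/-- An algebra `L` with a decreasing multiplicative filtration `J` and a functional `T` that is a
trace, twisted by `σ`, on products of total weight `N`; and a representation `ρ` of `A` in `L` with
an operator `F` such that `[F, ρ a]` has weight `1` and `1 - F²` has weight `2`. -/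
structure TracedModule where
  J : ℕ → Submodule ℂ L
  σ : L →ₐ[ℂ] L
  T : L →ₗ[ℂ] ℂ
  N : ℕ
  ρ : A →ₙₐ[ℂ] L
  F : L
  ε : ℂ
  mem_zero : ∀ x, x ∈ J 0
  anti : Antitone J
  mul_mem : ∀ {a b x y}, x ∈ J a → y ∈ J b → x * y ∈ J (a + b)
  cyclic : ∀ {a b x y}, x ∈ J a → y ∈ J b → N ≤ a + b → T (x * y) = T (σ y * x)
  σ_ρ : ∀ a, σ (ρ a) = ρ a
  σ_F : σ F = ε • F
  ε_sq : ε * ε = 1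
  comm_mem : ∀ a, F * ρ a - ρ a * F ∈ J 1
  defect_mem : 1 - F * F ∈ J 2

end Traced

namespace TracedModule

variable {A L : Type*} [Ring A] [Algebra ℂ A] [Ring L] [Algebra ℂ L] (E : TracedModule A L)

/-- The commutator `[F, a]`. -/
def d : A →ₗ[ℂ] L :=
  (LinearMap.mulLeft ℂ E.F - LinearMap.mulRight ℂ E.F) ∘ₗ (E.ρ : A →ₗ[ℂ] L)

theorem d_apply (a : A) : E.d a = E.F * E.ρ a - E.ρ a * E.F := rfl

theorem d_mem (a : A) : E.d a ∈ E.J 1 := E.comm_mem a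

theorem d_mul (a b : A) : E.d (a * b) = E.d a * E.ρ b + E.ρ a * E.d b := by
  simp only [d_apply, map_mul]
  noncomm_ring

/-- The defect `1 - F²`. -/
def w : L := 1 - E.F * E.F

theorem σ_d (a : A) : E.σ (E.d a) = E.ε • E.d a := by
  rw [d_apply, map_sub, map_mul, map_mul, E.σ_ρ, E.σ_F, smul_sub, smul_mul_assoc, mul_smul_comm]

theorem σ_w : E.σ E.w = E.w := by
  rw [w, map_sub, map_one, map_mul, E.σ_F, smul_mul_smul_comm, E.ε_sq, one_smul]

theorem F_mul_w : E.F * E.w = E.w * E.F := by rw [w]; noncomm_ring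

theorem sd_d_mem (a : A) : E.F * E.d a + E.d a * E.F ∈ E.J 2 := by
  have h : E.F * E.d a + E.d a * E.F = E.ρ a * E.w - E.w * E.ρ a := by
    rw [d_apply, w]; noncomm_ring
  have hw : E.w ∈ E.J 2 := E.defect_mem
  rw [h]
  exact sub_mem (by simpa using E.mul_mem (E.mem_zero (E.ρ a)) hw)
    (by simpa using E.mul_mem hw (E.mem_zero (E.ρ a)))

theorem mul_mem_left (x : L) {y : L} {b : ℕ} (hy : y ∈ E.J b) : x * y ∈ E.J b := by
  simpa using E.mul_mem (E.mem_zero x) hy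

theorem mul_mem_right {x : L} (y : L) {b : ℕ} (hx : x ∈ E.J b) : x * y ∈ E.J b := by
  simpa using E.mul_mem hx (E.mem_zero y)

/-- The supertrace vanishes on supercommutators with `F`, even if both terms of the supercommutator
are not of trace class. -/
theorem T_supercommutator {v : ℕ} {x : L} (hx : x ∈ E.J v) (hv : E.N ≤ v + 2)
    (hy : E.F * x - E.ε • (x * E.F) ∈ E.J E.N) : E.T (E.F * x - E.ε • (x * E.F)) = 0 := by
  set y := E.F * x - E.ε • (x * E.F) with hydef
  have hw : E.w ∈ E.J 2 := E.defect_mem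
  -- Writing `1 = F² + w` splits the trace into two parts, and each vanishes for its own reason.
  have h1 : E.T y = E.T (E.F * (E.F * y)) + E.T (E.w * y) := by
    rw [← map_add]
    congr 1
    rw [w]; noncomm_ring
  -- As `Fy + ε yF = F²x - xF²`, the operator `F` supercommutes with `y` up to `xw - wx`. There the
  -- factor `w` raises the weight of `x` to the trace class range.
  have h2 : E.F * y = -(E.ε • (y * E.F)) + (x * E.w - E.w * x) := by
    simp only [hydef, w, mul_sub, sub_mul, smul_sub, mul_smul_comm, smul_mul_assoc, smul_smul,
      E.ε_sq, one_smul, mul_one, one_mul, mul_assoc]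
    abel
  have h3 : E.T (E.F * (x * E.w - E.w * x)) = 0 := by
    rw [mul_sub, map_sub, ← mul_assoc, ← mul_assoc,
      E.cyclic (E.mul_mem_left E.F hx) hw hv, E.σ_w, ← mul_assoc, E.F_mul_w, sub_self]
  have h4 : E.T (E.F * y * E.F) = E.ε * E.T (E.F * (E.F * y)) := by
    rw [E.cyclic (E.mul_mem_left E.F hy) (E.mem_zero E.F) (by omega), E.σ_F, smul_mul_assoc,
      map_smul, smul_eq_mul]
  have h5 : E.T (E.F * (E.F * y)) = 0 := by
    have h6 : E.T (E.F * (E.F * y)) = -(E.T (E.F * (E.F * y))) := by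
      conv_lhs => rw [h2, mul_add, map_add, h3, mul_neg, mul_smul_comm, map_neg, map_smul,
        ← mul_assoc, h4, smul_eq_mul, ← mul_assoc, E.ε_sq]
      ring
    linear_combination h6 / 2
  -- Here `wx` has weight `v + 2 ≥ N`, so each term of the supercommutator can be traced separately.
  have h7 : E.T (E.w * y) = 0 := by
    have h8 : E.T (E.w * x * E.F) = E.ε * E.T (E.F * (E.w * x)) := by
      have h9 : E.w * x ∈ E.J (2 + v) := E.mul_mem hw hx
      rw [E.cyclic h9 (E.mem_zero E.F) (by omega), E.σ_F, smul_mul_assoc, map_smul, smul_eq_mul]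
    rw [hydef, mul_sub, map_sub, mul_smul_comm, map_smul, ← mul_assoc, ← mul_assoc, h8, smul_eq_mul,
      ← mul_assoc, E.ε_sq, one_mul, ← E.F_mul_w, mul_assoc, sub_self]
  rw [h1, h5, h7, add_zero]

/-! ### Power series -/

/-- Power series whose coefficients of `z^s` have weight `v + 2 s`. -/
def Wt (v : ℕ) (f : L⟦X⟧) : Prop := ∀ s, coeff s f ∈ E.J (v + 2 * s)

/-- Power series all coefficients of which are multiplied by `c` under `σ`. -/
def Eig (c : ℂ) (f : L⟦X⟧) : Prop := ∀ s, E.σ (coeff s f) = c • coeff s f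

variable {E}

theorem Wt.mul {a b : ℕ} {f g : L⟦X⟧} (hf : E.Wt a f) (hg : E.Wt b g) : E.Wt (a + b) (f * g) := by
  intro s
  rw [coeff_mul]
  refine sum_mem fun p hp => ?_
  have h := E.mul_mem (hf p.1) (hg p.2)
  rw [Finset.HasAntidiagonal.mem_antidiagonal] at hp
  rwa [show a + b + 2 * s = a + 2 * p.1 + (b + 2 * p.2) by omega]

theorem Wt.mul_le {a b c : ℕ} (hc : c = a + b) {f g : L⟦X⟧} (hf : E.Wt a f) (hg : E.Wt b g) :
    E.Wt c (f * g) := hc ▸ hf.mul hg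

theorem Wt.add {a : ℕ} {f g : L⟦X⟧} (hf : E.Wt a f) (hg : E.Wt a g) : E.Wt a (f + g) :=
  fun s => by rw [map_add]; exact add_mem (hf s) (hg s)

theorem Wt.sub {a : ℕ} {f g : L⟦X⟧} (hf : E.Wt a f) (hg : E.Wt a g) : E.Wt a (f - g) :=
  fun s => by rw [map_sub]; exact sub_mem (hf s) (hg s)

theorem Wt.smul {a : ℕ} (c : ℂ) {f : L⟦X⟧} (hf : E.Wt a f) : E.Wt a (c • f) :=
  fun s => by rw [PowerSeries.coeff_smul]; exact (E.J _).smul_mem _ (hf s)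

theorem Wt.anti {a b : ℕ} (hab : b ≤ a) {f : L⟦X⟧} (hf : E.Wt a f) : E.Wt b f :=
  fun s => E.anti (by omega) (hf s)

theorem wt_C {a : ℕ} {x : L} (hx : x ∈ E.J a) : E.Wt a (C x) := fun s => by
  rw [coeff_C]
  split_ifs with h
  · subst h; exact hx
  · exact zero_mem _

theorem Eig.mul {c c' : ℂ} {f g : L⟦X⟧} (hf : E.Eig c f) (hg : E.Eig c' g) :
    E.Eig (c * c') (f * g) := by
  intro s
  rw [coeff_mul, map_sum, Finset.smul_sum]
  refine Finset.sum_congr rfl fun p _ => ?_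
  rw [map_mul, hf, hg, smul_mul_smul_comm]

theorem eig_C {c : ℂ} {x : L} (hx : E.σ x = c • x) : E.Eig c (C x) := fun s => by
  rw [coeff_C]
  split_ifs
  · exact hx
  · simp

variable (E)

/-- The functional `T` applied to the coefficient of `z^r`. -/
def Tr (r : ℕ) : L⟦X⟧ →ₗ[ℂ] ℂ where
  toFun f := E.T (coeff r f)
  map_add' f g := by rw [map_add, map_add]
  map_smul' c f := by rw [PowerSeries.coeff_smul, map_smul, RingHom.id_apply]

theorem Tr_apply (r : ℕ) (f : L⟦X⟧) : E.Tr r f = E.T (coeff r f) := rfl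

theorem Tr_succ_X_mul (r : ℕ) (f : L⟦X⟧) : E.Tr (r + 1) (X * f) = E.Tr r f := by
  rw [Tr_apply, coeff_succ_X_mul, Tr_apply]

theorem Tr_zero_X_mul (f : L⟦X⟧) : E.Tr 0 (X * f) = 0 := by
  rw [Tr_apply, coeff_zero_X_mul, map_zero]

variable {E}

theorem Tr_mul_comm {a b r : ℕ} {c : ℂ} {f g : L⟦X⟧} (hf : E.Wt a f) (hg : E.Wt b g)
    (hc : E.Eig c g) (h : E.N ≤ a + b + 2 * r) : E.Tr r (f * g) = c * E.Tr r (g * f) := by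
  rw [Tr_apply, Tr_apply, coeff_mul, coeff_mul, map_sum, map_sum, Finset.mul_sum,
    ← Finset.Nat.sum_antidiagonal_swap]
  refine Finset.sum_congr rfl fun p hp => ?_
  rw [Finset.HasAntidiagonal.mem_antidiagonal] at hp
  rw [Prod.fst_swap, Prod.snd_swap, E.cyclic (hf p.2) (hg p.1) (by omega), hc, smul_mul_assoc,
    map_smul, smul_eq_mul]

theorem Tr_supercommutator {v v' r : ℕ} {f : L⟦X⟧} (hf : E.Wt v f) (hv : E.N ≤ v + 2 + 2 * r)
    (hd : E.Wt v' (C E.F * f - E.ε • (f * C E.F))) (hv' : E.N ≤ v' + 2 * r) :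
    E.Tr r (C E.F * f - E.ε • (f * C E.F)) = 0 := by
  have h := hd r
  rw [Tr_apply]
  rw [map_sub, PowerSeries.coeff_smul, coeff_C_mul, coeff_mul_C] at h ⊢
  exact E.T_supercommutator (hf r) (by omega) (E.anti hv' h)

/-! ### The letters -/

variable (E)

/-- The resolvent `(1 - z (1 - F²))⁻¹`. -/
def G : L⟦X⟧ := PowerSeries.mk fun i => E.w ^ i

/-- The letter `[F, a]`. -/
def x (a : A) : L⟦X⟧ := C (E.d a)

/-- The letter `a`. -/
def r (a : A) : L⟦X⟧ := C (E.ρ a)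

theorem G_mul : E.G * (1 - X * C E.w) = 1 := by
  ext n
  rw [mul_sub, mul_one, ← mul_assoc, (commute_X E.G).eq, mul_assoc, map_sub]
  rcases n with _ | n
  · rw [coeff_zero_X_mul]; simp [G]
  · rw [coeff_succ_X_mul, coeff_mul_C, G, coeff_mk, coeff_mk, pow_succ, sub_self, coeff_one,
      if_neg (Nat.succ_ne_zero n)]

theorem mul_G : (1 - X * C E.w) * E.G = 1 := by
  ext n
  rw [sub_mul, one_mul, mul_assoc, map_sub]
  rcases n with _ | n
  · rw [coeff_zero_X_mul]; simp [G]
  · rw [coeff_succ_X_mul, coeff_C_mul, G, coeff_mk, coeff_mk, pow_succ', sub_self, coeff_one,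
      if_neg (Nat.succ_ne_zero n)]

theorem C_mul_G_of_commute {y : L} (h : Commute y E.w) : C y * E.G = E.G * C y := by
  ext n
  rw [coeff_C_mul, coeff_mul_C, G, coeff_mk]
  exact (h.pow_right n).eq

/-- The resolvent relation is the commutator of `a` with the inverse of `1 - zw`, together with
`F[F, a] + [F, a]F = aw - wa`. -/
theorem wordRelations : WordRelations E.r (C E.F) E.G X E.x where
  map_mul a b := by
    simp only [x, r, E.d_mul, map_add, map_mul]
  central f := (commute_X f).eq
  comm := E.C_mul_G_of_commute E.F_mul_w
  resolvent a := by
    have h1 : E.r a * E.G - E.G * E.r a =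
        E.G * ((1 - X * C E.w) * E.r a - E.r a * (1 - X * C E.w)) * E.G := by
      have e1 : E.G * ((1 - X * C E.w) * E.r a - E.r a * (1 - X * C E.w)) * E.G =
          (E.G * (1 - X * C E.w)) * E.r a * E.G - E.G * E.r a * ((1 - X * C E.w) * E.G) := by
        noncomm_ring
      rw [e1, E.G_mul, E.mul_G, one_mul, mul_one]
    have h2 : (1 - X * C E.w) * E.r a - E.r a * (1 - X * C E.w) =
        X * (C E.F * E.x a + E.x a * C E.F) := by
      have e1 : E.r a * (X * C E.w) = X * (E.r a * C E.w) := by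
        rw [← mul_assoc, (commute_X (E.r a)).eq, mul_assoc]
      have e2 : C E.F * E.x a + E.x a * C E.F = E.r a * C E.w - C E.w * E.r a := by
        simp only [x, r, ← map_mul, ← map_add, ← map_sub]
        congr 1
        rw [d_apply, w]; noncomm_ring
      rw [sub_mul, mul_sub, e1, e2]
      noncomm_ring
    have h3 : E.G * (X * (C E.F * E.x a + E.x a * C E.F)) * E.G =
        X * (E.G * (C E.F * E.x a + E.x a * C E.F) * E.G) := by
      rw [← mul_assoc E.G, (commute_X E.G).eq]
      noncomm_ring
    rw [← h3, ← h2, ← h1]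
    abel

variable {E}

theorem wt_G : E.Wt 0 E.G := fun s => by
  rw [G, coeff_mk]
  induction s with
  | zero => exact E.mem_zero _
  | succ s ih =>
    rw [pow_succ]
    have := E.mul_mem ih (show E.w ∈ E.J 2 from E.defect_mem)
    rwa [show 0 + 2 * (s + 1) = 0 + 2 * s + 2 by ring]

theorem wt_x (a : A) : E.Wt 1 (E.x a) := wt_C (E.d_mem a)

theorem wt_r (a : A) : E.Wt 0 (E.r a) := wt_C (E.mem_zero _)

theorem eig_G : E.Eig 1 E.G := fun s => by rw [G, coeff_mk, map_pow, E.σ_w, one_smul]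

theorem eig_x (a : A) : E.Eig E.ε (E.x a) := eig_C (E.σ_d a)

theorem eig_r (a : A) : E.Eig 1 (E.r a) := eig_C (by rw [E.σ_ρ, one_smul])

end TracedModule

end CyclicCharacter

end

noncomputable section

namespace CyclicCharacter

open PowerSeries

/-! ### Cyclic norms of words through an Euler derivation. -/

section NormOfWords

variable {A R : Type*} [Ring R]

theorem word_eq_list_prod (G : R) (x : A → R) : ∀ (n : ℕ) (a : Fin n → A),
    word G x n a = G * ((List.ofFn a).map fun b => x b * G).prod
  | 0, a => by simp [word]
  | n + 1, a => by
    rw [word, word_eq_list_prod G x n, List.ofFn_succ, List.map_cons, List.prod_cons]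
    simp only [mul_assoc]
    rfl

theorem ofFn_rotate {n : ℕ} (a : Fin (n + 1) → A) (j : Fin (n + 1)) :
    List.ofFn (fun i => a (i + j)) = (List.ofFn a).rotate j := by
  refine List.ext_getElem (by simp) fun k h1 h2 => ?_
  rw [List.getElem_rotate]
  simp only [List.getElem_ofFn, List.length_ofFn]
  congr 1

/-- With `y = xG`, `D x = 0` and `D G = G² - G`, the derivation doubles one `G` after each letter in
turn and subtracts one copy of the product per letter; the term with the length restores these
copies. -/
theorem derivation_list_prod {D : R → R} (hD : ∀ r s, D (r * s) = D r * s + r * D s) {G : R}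
    {y : A → R} (hy : ∀ a, D (y a) = y a * G - y a) : ∀ l : List A,
    D (l.map y).prod + l.length • (l.map y).prod =
      ∑ j ∈ Finset.range l.length,
        ((l.take (j + 1)).map y).prod * (G * ((l.drop (j + 1)).map y).prod)
  | [] => by
    have := hD 1 1
    simp only [mul_one, one_mul, left_eq_add] at this
    simp [this]
  | a :: l => by
    have ih := derivation_list_prod hD hy l
    rw [List.length_cons, Finset.sum_range_succ', List.map_cons, List.prod_cons, hD, hy, succ_nsmul]
    simp only [List.take_succ_cons, List.drop_succ_cons, List.map_cons, List.prod_cons, mul_assoc,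
      ← Finset.mul_sum, ← ih, zero_add, List.take_zero, List.drop_zero, List.map_nil, List.prod_nil,
      mul_one, mul_add, sub_mul, mul_smul_comm]
    abel

theorem neg_one_pow_pow_of_add_eq {n k l : ℕ} (h : k + l = n + 1) :
    ((-1 : ℂ) ^ n) ^ l = (-1) ^ (n * k) := by
  rw [← pow_mul]
  refine neg_one_pow_congr (Nat.even_add.1 ?_)
  rw [← mul_add, add_comm l, h]
  exact Nat.even_mul_succ_self n

/-- The cyclic norm of a functional of words, computed by an Euler derivation. -/
theorem cycNorm_word [Ring A] [Algebra ℂ R] {D : R → R} (hD : ∀ r s, D (r * s) = D r * s + r * D s) {G : R}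
    (hG : D G = G * G - G) {x : A → R} (hx : ∀ a, D (x a) = 0) {τ : R →ₗ[ℂ] ℂ} {κ : ℂ}
    (hτ : ∀ r, τ (D r) = κ * τ r) {n : ℕ}
    (hc : ∀ l l' : List A, l.length + l'.length = n + 1 →
      τ ((l.map fun b => x b * G).prod * (G * (l'.map fun b => x b * G).prod)) =
        (-1) ^ (n * l.length) *
          τ (G * (l'.map fun b => x b * G).prod * (l.map fun b => x b * G).prod))
    (a : Fin (n + 1) → A) :
    cycNorm n (fun a => τ (word G x (n + 1) a)) a =
      (n + 1 + κ) * τ (x (a 0) * word G x n (Fin.tail a)) := by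
  have hy : ∀ a, D (x a * G) = x a * G * G - x a * G := fun a => by
    rw [hD, hx, hG, zero_mul, zero_add, mul_sub, mul_assoc]
  have h0 : x (a 0) * word G x n (Fin.tail a) =
      ((List.ofFn a).map fun b => x b * G).prod := by
    rw [word_eq_list_prod, List.ofFn_succ, List.map_cons, List.prod_cons, mul_assoc]
    rfl
  have h1 := congrArg τ (derivation_list_prod hD hy (List.ofFn a))
  rw [map_add, hτ, map_nsmul, map_sum, List.length_ofFn, nsmul_eq_mul] at h1
  -- By cyclicity, doubling the `G` after the letter `j` gives the word of the arguments rotated by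
  -- `j + 1`, with a `G` at both ends. For `j = n` the rotation is trivial, and so is the sign, `n(n
  -- + 1)` being even.
  have h2 : ∀ j ∈ Finset.range (n + 1),
      τ ((((List.ofFn a).take (j + 1)).map fun b => x b * G).prod *
        (G * (((List.ofFn a).drop (j + 1)).map fun b => x b * G).prod)) =
      (-1) ^ (n * ((j + 1) % (n + 1))) *
        τ (word G x (n + 1) fun i => a (i + ⟨(j + 1) % (n + 1), Nat.mod_lt _ n.succ_pos⟩)) := by
    intro j hj
    have hj' : j + 1 ≤ n + 1 := Finset.mem_range.1 hj
    have hlen : ((List.ofFn a).take (j + 1)).length = j + 1 := by simp; omega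
    rw [hc _ _ (by simp; omega), hlen, word_eq_list_prod, ofFn_rotate, mul_assoc]
    have hs : (-1 : ℂ) ^ (n * (j + 1)) = (-1) ^ (n * ((j + 1) % (n + 1))) := by
      rcases hj'.eq_or_lt with h | h
      · rw [h, Nat.mod_self, mul_zero, pow_zero, (Nat.even_mul_succ_self n).neg_one_pow]
      · rw [Nat.mod_eq_of_lt h]
    have hr : (List.ofFn a).drop (j + 1) ++ (List.ofFn a).take (j + 1) =
        (List.ofFn a).rotate ((j + 1) % (n + 1)) := by
      rw [← List.rotate_eq_drop_append_take (by simpa using hj')]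
      conv_lhs => rw [← List.rotate_mod]
      rw [List.length_ofFn]
    rw [hs, ← List.prod_append, ← List.map_append, hr]
  rw [h0, cycNorm_apply]
  rw [Finset.sum_congr rfl h2, ← Fin.sum_univ_eq_sum_range (fun j =>
    (-1) ^ (n * ((j + 1) % (n + 1))) *
        τ (word G x (n + 1) fun i => a (i + ⟨(j + 1) % (n + 1), Nat.mod_lt _ n.succ_pos⟩)))] at h1
  have h3 : ∑ j : Fin (n + 1), (-1 : ℂ) ^ (n * (j : ℕ)) * τ (word G x (n + 1) fun i => a (i + j)) =
      κ * τ ((List.ofFn a).map fun b => x b * G).prod +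
        (n + 1 : ℕ) * τ ((List.ofFn a).map fun b => x b * G).prod := by
    rw [h1, ← Equiv.sum_comp (Equiv.addRight (1 : Fin (n + 1)))]
    refine Finset.sum_congr rfl fun j _ => ?_
    have : Equiv.addRight (1 : Fin (n + 1)) j = ⟨(j + 1) % (n + 1), Nat.mod_lt _ n.succ_pos⟩ := by
      ext
      simp [Fin.val_add]
    rw [this]
  rw [h3]
  push_cast
  ring

end NormOfWords

/-- The Euler derivation `z d/dz`. -/
def euler {L : Type*} [Ring L] (f : L⟦X⟧) : L⟦X⟧ := PowerSeries.mk fun n => n • coeff n f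

theorem coeff_euler {L : Type*} [Ring L] (f : L⟦X⟧) (n : ℕ) :
    coeff n (euler f) = n • coeff n f := by rw [euler, coeff_mk]

theorem euler_mul {L : Type*} [Ring L] (f g : L⟦X⟧) :
    euler (f * g) = euler f * g + f * euler g := by
  ext n
  rw [coeff_euler, map_add, coeff_mul, coeff_mul, coeff_mul, ← Finset.sum_add_distrib,
    Finset.smul_sum]
  refine Finset.sum_congr rfl fun p hp => ?_
  rw [Finset.HasAntidiagonal.mem_antidiagonal] at hp
  rw [coeff_euler, coeff_euler, ← hp, add_smul, smul_mul_assoc, mul_smul_comm]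

theorem euler_C {L : Type*} [Ring L] (l : L) : euler (C l) = 0 := by
  ext n
  rw [coeff_euler, coeff_C]
  split_ifs with h
  · rw [h, zero_smul, map_zero]
  · rw [smul_zero, map_zero]

theorem euler_one {L : Type*} [Ring L] : euler (1 : L⟦X⟧) = 0 := by
  rw [← map_one C, euler_C]

theorem euler_add {L : Type*} [Ring L] (f g : L⟦X⟧) : euler (f + g) = euler f + euler g := by
  ext n
  simp only [coeff_euler, map_add, smul_add]

theorem euler_zero {L : Type*} [Ring L] : euler (0 : L⟦X⟧) = 0 := by
  ext n
  simp only [coeff_euler, map_zero, smul_zero]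

namespace TracedModule

variable {A L : Type*} [Ring A] [Algebra ℂ A] [Ring L] [Algebra ℂ L] (E : TracedModule A L)

/-- Apply the derivation to `G(1 - zw) = 1` and use `G(zw)G = G² - G`. -/
theorem euler_G : euler E.G = E.G * E.G - E.G := by
  have h : E.G * E.G - E.G = E.G * (X * C E.w) * E.G := by
    have h1 : X * C E.w = 1 - (1 - X * C E.w) := by abel
    rw [h1, mul_sub, mul_one, E.G_mul, sub_mul, one_mul]
  have h2 : euler (1 - X * C E.w) = -(X * C E.w) := by
    ext n
    rw [coeff_euler, map_sub, map_neg, coeff_one]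
    rcases n with _ | _ | n
    · rw [zero_smul, coeff_zero_X_mul, neg_zero]
    · rw [coeff_succ_X_mul]; simp
    · rw [coeff_succ_X_mul, coeff_C]; simp
  have h3 := congrArg euler E.G_mul
  rw [euler_mul, h2, euler_one] at h3
  have h4 := congrArg (· * E.G) h3
  simp only [add_mul, mul_assoc, E.mul_G, zero_mul, mul_one, neg_mul, mul_neg] at h4
  rw [h]
  simp only [mul_assoc]
  exact add_neg_eq_zero.1 h4

theorem Tr_euler (r : ℕ) (f : L⟦X⟧) : E.Tr r (euler f) = r * E.Tr r f := by
  rw [Tr_apply, coeff_euler, map_nsmul, nsmul_eq_mul, Tr_apply]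

variable {E}

theorem wt_one : E.Wt 0 1 := by
  rw [← map_one C]; exact wt_C (E.mem_zero _)

theorem eig_one : E.Eig 1 1 := by
  rw [← map_one C]; exact eig_C (by rw [map_one, one_smul])

theorem wt_list (l : List A) : E.Wt l.length (l.map fun b => E.x b * E.G).prod := by
  induction l with
  | nil => exact wt_one
  | cons a l ih => exact Wt.mul_le (add_comm _ _) ((wt_x a).mul wt_G) ih

theorem eig_list (l : List A) : E.Eig (E.ε ^ l.length) (l.map fun b => E.x b * E.G).prod := by
  induction l with
  | nil => simpa using eig_one
  | cons a l ih =>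
    have := ((eig_x a).mul (eig_G (E := E))).mul ih
    rwa [mul_one, ← pow_succ'] at this

theorem cycNorm_Tr_word {n r : ℕ} (hN : E.N ≤ n + 1 + 2 * r) (hε : E.ε = (-1) ^ n)
    (a : Fin (n + 1) → A) :
    cycNorm n (fun a => E.Tr r (word E.G E.x (n + 1) a)) a =
      (n + 1 + r) * E.Tr r (E.x (a 0) * word E.G E.x n (Fin.tail a)) := by
  refine cycNorm_word euler_mul E.euler_G (fun a => euler_C _) (E.Tr_euler r) ?_ a
  intro l l' hl
  have h := Tr_mul_comm (E := E) (r := r) (wt_list l) (wt_G.mul (wt_list l'))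
    (eig_G.mul (eig_list l')) (by omega)
  rw [one_mul, hε, neg_one_pow_pow_of_add_eq hl] at h
  exact h

/-! ### Two by two matrices -/

open Matrix in
/-- The matrices `[[f, g], [0, (-1)^k f]]` with `f` of weight `k` and `g` of weight `k + 1`. -/
structure MatWt (E : TracedModule A L) (k : ℕ) (M : Matrix (Fin 2) (Fin 2) L⟦X⟧) : Prop where
  low : M 1 0 = 0
  diag : M 1 1 = (-1 : ℂ) ^ k • M 0 0
  wt_diag : E.Wt k (M 0 0)
  eig_diag : E.Eig (E.ε ^ k) (M 0 0)
  wt_up : E.Wt (k + 1) (M 0 1)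
  eig_up : E.Eig (E.ε ^ (k + 1)) (M 0 1)

theorem Eig.add {c : ℂ} {f g : L⟦X⟧} (hf : E.Eig c f) (hg : E.Eig c g) : E.Eig c (f + g) :=
  fun s => by rw [map_add, map_add, hf, hg, smul_add]

theorem Eig.smul {c : ℂ} (c' : ℂ) {f : L⟦X⟧} (hf : E.Eig c f) : E.Eig c (c' • f) :=
  fun s => by rw [PowerSeries.coeff_smul, map_smul, hf, smul_comm]

theorem wt_zero {k : ℕ} : E.Wt k 0 := fun s => by rw [map_zero]; exact zero_mem _

theorem eig_zero {c : ℂ} : E.Eig c 0 := fun s => by rw [map_zero, map_zero, smul_zero]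

theorem MatWt.mul {k l : ℕ} {M M' : Matrix (Fin 2) (Fin 2) L⟦X⟧} (h : E.MatWt k M)
    (h' : E.MatWt l M') : E.MatWt (k + l) (M * M') where
  low := by rw [Matrix.mul_apply, Fin.sum_univ_two, h.low, h'.low, zero_mul, mul_zero, add_zero]
  diag := by
    rw [Matrix.mul_apply, Matrix.mul_apply, Fin.sum_univ_two, Fin.sum_univ_two, h.low, h'.low,
      h.diag, h'.diag, zero_mul, mul_zero, add_zero, zero_add, smul_mul_smul_comm, pow_add]
  wt_diag := by
    rw [Matrix.mul_apply, Fin.sum_univ_two, h'.low, mul_zero, add_zero]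
    exact h.wt_diag.mul h'.wt_diag
  eig_diag := by
    rw [Matrix.mul_apply, Fin.sum_univ_two, h'.low, mul_zero, add_zero, pow_add]
    exact h.eig_diag.mul h'.eig_diag
  wt_up := by
    rw [Matrix.mul_apply, Fin.sum_univ_two, h'.diag]
    exact (Wt.mul_le (by ring) h.wt_diag h'.wt_up).add
      (Wt.mul_le (by ring) h.wt_up (h'.wt_diag.smul _))
  eig_up := by
    rw [Matrix.mul_apply, Fin.sum_univ_two, h'.diag]
    refine Eig.add ?_ ?_
    · rw [add_assoc, pow_add]
      exact h.eig_diag.mul h'.eig_up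
    · rw [add_right_comm, pow_add]
      exact h.eig_up.mul (h'.eig_diag.smul _)

variable (E)

/-- The functional `Tr r` of the upper right entry. -/
def matTr (r : ℕ) : Matrix (Fin 2) (Fin 2) L⟦X⟧ →ₗ[ℂ] ℂ where
  toFun M := E.Tr r (M 0 1)
  map_add' _ _ := map_add _ _ _
  map_smul' c M := map_smul (E.Tr r) c (M 0 1)

theorem matTr_apply (r : ℕ) (M : Matrix (Fin 2) (Fin 2) L⟦X⟧) : E.matTr r M = E.Tr r (M 0 1) := rfl

variable {E}

/-- The upper right entry of a product has two terms. With the sign `(-1)^k` in the lower right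
entries, both acquire the same factor under exchange exactly when `ε = (-1)^(k+l)`. -/
theorem matTr_mul_comm {k l r : ℕ} {M M' : Matrix (Fin 2) (Fin 2) L⟦X⟧} (h : E.MatWt k M)
    (h' : E.MatWt l M') (hN : E.N ≤ k + l + 1 + 2 * r) (hε : E.ε = (-1) ^ (k + l)) :
    E.matTr r (M * M') = (-E.ε) ^ l * E.matTr r (M' * M) := by
  simp only [matTr_apply, Matrix.mul_apply, Fin.sum_univ_two, h.diag, h'.diag, map_add,
    mul_smul_comm, map_smul, smul_eq_mul]
  rw [Tr_mul_comm h.wt_diag h'.wt_up h'.eig_up (by omega),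
    Tr_mul_comm h.wt_up h'.wt_diag h'.eig_diag (by omega)]
  have h1 : E.ε ^ (l + 1) = (-E.ε) ^ l * (-1) ^ k := by
    rw [pow_succ, neg_pow, mul_comm ((-1 : ℂ) ^ l), mul_assoc, ← pow_add, add_comm l k, ← hε]
  rw [h1, neg_pow E.ε]
  ring

/-- The commutator with `diag(0, 1)` plus the entrywise Euler derivation. -/
def matEuler (M : Matrix (Fin 2) (Fin 2) L⟦X⟧) : Matrix (Fin 2) (Fin 2) L⟦X⟧ :=
  M.map euler + (M * !![0, 0; 0, 1] - !![0, 0; 0, 1] * M)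

omit [Algebra ℂ L] in
theorem matEuler_mul (M M' : Matrix (Fin 2) (Fin 2) L⟦X⟧) :
    matEuler (M * M') = matEuler M * M' + M * matEuler M' := by
  have h : (M * M').map euler = M.map euler * M' + M * M'.map euler := by
    ext1 i j
    simp only [Matrix.map_apply, Matrix.add_apply, Matrix.mul_apply, Fin.sum_univ_two, euler_add,
      euler_mul]
    abel
  rw [matEuler, h, matEuler, matEuler]
  noncomm_ring

variable (E)

/-- The matrix `[[G, G V G], [0, G]]`. -/
def matG (V : L) : Matrix (Fin 2) (Fin 2) L⟦X⟧ := !![E.G, E.G * C V * E.G; 0, E.G]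

/-- The matrix `[[[F, a], 0], [0, -[F, a]]]`. -/
def matx (a : A) : Matrix (Fin 2) (Fin 2) L⟦X⟧ := !![E.x a, 0; 0, -E.x a]

variable {E}

theorem matWt_G {V : L} (hV : V ∈ E.J 1) (hσ : E.σ V = E.ε • V) : E.MatWt 0 (E.matG V) where
  low := rfl
  diag := by rw [pow_zero, one_smul]; rfl
  wt_diag := wt_G
  eig_diag := by rw [pow_zero]; exact eig_G
  wt_up := Wt.mul_le (add_zero _).symm (Wt.mul_le rfl wt_G (wt_C hV)) wt_G
  eig_up := by
    have := (eig_G.mul (eig_C hσ)).mul (eig_G (E := E))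
    rw [zero_add, pow_one]
    rwa [one_mul, mul_one] at this

theorem matWt_x (a : A) : E.MatWt 1 (E.matx a) where
  low := rfl
  diag := by rw [pow_one, neg_smul, one_smul]; rfl
  wt_diag := wt_x a
  eig_diag := by rw [pow_one]; exact eig_x a
  wt_up := wt_zero
  eig_up := eig_zero

theorem matWt_one : E.MatWt 0 1 where
  low := rfl
  diag := by rw [pow_zero, one_smul]; rfl
  wt_diag := wt_one
  eig_diag := by rw [pow_zero]; exact eig_one
  wt_up := wt_zero
  eig_up := eig_zero

theorem matWt_list {V : L} (hV : V ∈ E.J 1) (hσ : E.σ V = E.ε • V) (l : List A) :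
    E.MatWt l.length (l.map fun b => E.matx b * E.matG V).prod := by
  induction l with
  | nil => exact matWt_one
  | cons a l ih =>
    rw [List.length_cons, add_comm]
    exact ((matWt_x a).mul (matWt_G hV hσ)).mul ih

/-- Words with an insertion are off-diagonal entries of plain words in triangular matrices, so
`cycNorm_word` also applies to them. The sign in `matx` produces the alternating signs. -/
theorem word_mat (V : L) : ∀ (n : ℕ) (a : Fin n → A), word (E.matG V) E.matx n a =
    !![word E.G E.x n a, (-1 : ℂ) ^ n • wordIns E.G (C V) E.x n a;
      0, (-1 : ℂ) ^ n • word E.G E.x n a]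
  | 0, a => by simp only [word, wordIns, pow_zero, one_smul]; rfl
  | n + 1, a => by
    rw [word, word_mat V n, word, wordIns, matG, matx, Matrix.mul_fin_two, Matrix.mul_fin_two]
    obtain ⟨s, hs⟩ : ∃ s : ℂ, (-1) ^ n = s := ⟨_, rfl⟩
    have hs1 : (-1 : ℂ) ^ (n + 1) = -s := by rw [pow_succ, hs, mul_neg_one]
    simp only [mul_zero, zero_mul, add_zero, zero_add, hs, hs1, neg_smul,
      mul_neg, neg_mul, mul_smul_comm, smul_neg, sub_eq_add_neg, smul_add, smul_zero,
      neg_neg]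
    rw [add_comm (s • _)]

/-- The Euler derivation of `GVG` contains `-2 GVG`, but `matG² - matG` requires `-GVG`. The
commutator with `diag(0, 1)` supplies the missing copy, which is why the eigenvalue in `matTr_euler`
is `r + 1`. -/
theorem matEuler_G (V : L) : matEuler (E.matG V) = E.matG V * E.matG V - E.matG V := by
  rw [matEuler, matG, Matrix.mul_fin_two, Matrix.mul_fin_two, Matrix.mul_fin_two]
  ext1 i j
  fin_cases i <;> fin_cases j <;>
    simp [euler_mul, euler_C, euler_G, euler_zero, mul_sub, sub_mul, mul_assoc]
  abel

theorem matEuler_x (a : A) : matEuler (E.matx a) = 0 := by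
  rw [matEuler, matx, Matrix.mul_fin_two, Matrix.mul_fin_two]
  ext1 i j
  fin_cases i <;> fin_cases j <;> simp [euler_C, euler_zero, x, ← map_neg]

theorem matTr_euler (r : ℕ) (M : Matrix (Fin 2) (Fin 2) L⟦X⟧) :
    E.matTr r (matEuler M) = (r + 1) * E.matTr r M := by
  have h : matEuler M 0 1 = euler (M 0 1) + M 0 1 := by
    simp only [matEuler, Matrix.add_apply, Matrix.sub_apply, Matrix.map_apply, Matrix.mul_apply,
      Fin.sum_univ_two]
    simp
  rw [matTr_apply, h, map_add, Tr_euler, matTr_apply]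
  ring

theorem cycNorm_Tr_wordIns {n r : ℕ} (hN : E.N ≤ n + 2 + 2 * r) (hε : E.ε = (-1) ^ (n + 1))
    {V : L} (hV : V ∈ E.J 1) (hσ : E.σ V = E.ε • V) (a : Fin (n + 1) → A) :
    cycNorm n (fun a => E.Tr r (wordIns E.G (C V) E.x (n + 1) a)) a =
      -((n + 2 + r) * E.Tr r (E.x (a 0) * wordIns E.G (C V) E.x n (Fin.tail a))) := by
  have h := cycNorm_word (n := n) matEuler_mul (matEuler_G (E := E) V) (matEuler_x (E := E))
    (matTr_euler (E := E) r) ?_ a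
  · simp only [word_mat, matTr_apply, matx, Matrix.mul_fin_two, Matrix.of_apply, Matrix.cons_val',
      Matrix.cons_val_one, Matrix.cons_val_zero, Matrix.cons_val_fin_one, map_smul, zero_mul,
      add_zero, smul_zero, mul_smul_comm, smul_eq_mul] at h
    have h2 : (fun a => (-1 : ℂ) ^ (n + 1) * E.Tr r (wordIns E.G (C V) E.x (n + 1) a)) =
      (-1 : ℂ) ^ (n + 1) • fun a => E.Tr r (wordIns E.G (C V) E.x (n + 1) a) := rfl
    rw [h2, map_smul, Pi.smul_apply, smul_eq_mul] at h
    have h3 : (-1 : ℂ) ^ (n + 1) * (-1) ^ (n + 1) = 1 := by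
      rw [← mul_pow]; norm_num
    have h4 := congrArg (fun t => (-1 : ℂ) ^ (n + 1) * t) h
    simp only [← mul_assoc, h3, one_mul] at h4
    rw [h4]
    have h5 : (-1 : ℂ) ^ n * (-1) ^ n = 1 := by
      rw [← mul_pow]; norm_num
    rw [pow_succ]
    linear_combination -((n + 2 + r) * E.Tr r (E.x (a 0) * wordIns E.G (C V) E.x n (Fin.tail a))) * h5
  · intro l l' hl
    have h := matTr_mul_comm (E := E) (r := r) (matWt_list hV hσ l)
      ((matWt_G hV hσ).mul (matWt_list hV hσ l')) (by omega)
      (by rw [hε, zero_add, hl])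
    rw [h, zero_add, hε, pow_succ, mul_neg_one, neg_neg, neg_one_pow_pow_of_add_eq hl]

end TracedModule

end CyclicCharacter

end

noncomputable section

namespace CyclicCharacter

open PowerSeries

/-! ### The character and its transgression in the cyclic bicomplex. -/

section MultilinearWords

variable {A R : Type*} [Ring A] [Algebra ℂ A] [Ring R] [Algebra ℂ R]

theorem IsMultilinearMap.cons_mul_left {n : ℕ} {f : (Fin n → A) → R} (hf : IsMultilinearMap f)
    (r : R) (l : A →ₗ[ℂ] R) :
    IsMultilinearMap fun a : Fin (n + 1) → A => r * l (a 0) * f (Fin.tail a) :=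
  hf.cons_mul (LinearMap.mulLeft ℂ r ∘ₗ l)

theorem isMultilinearMap_word (G : R) (x : A →ₗ[ℂ] R) : ∀ n, IsMultilinearMap (word G x n)
  | 0 => isMultilinearMap_const G
  | n + 1 => (isMultilinearMap_word G x n).cons_mul_left G x

theorem isMultilinearMap_wordIns (G V : R) (x : A →ₗ[ℂ] R) :
    ∀ n, IsMultilinearMap (wordIns G V x n)
  | 0 => isMultilinearMap_const _
  | n + 1 => ((isMultilinearMap_word G x n).cons_mul_left (G * V * G) x).sub
      ((isMultilinearMap_wordIns G V x n).cons_mul_left G x)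

end MultilinearWords

theorem bicomplexProj_congr {A : Type*} [Ring A] {α α' β β' : CochainFamily A}
    (hα : ∀ n, α n = α' n) (hβ : ∀ n, β (n + 1) = β' (n + 1)) :
    bicomplexProj α β = bicomplexProj α' β' := by
  funext n
  rw [bicomplexProj, bicomplexProj, hα, hα, hβ]

theorem hochschildb_eq_barD {A : Type*} [Ring A] {n : ℕ} (φ : Functionals A n)
    (a : Fin (n + 2) → A) : hochschildb n φ a = barD φ a + (-1 : ℂ) ^ (n + 1) *
      φ (Fin.cons (a (Fin.last (n + 1)) * a 0) (Fin.tail (Fin.init a))) := rfl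

theorem cyc_apply {A : Type*} [Ring A] {n : ℕ} (φ : Functionals A n) (a : Fin (n + 1) → A) :
    cyc n φ a = (-1 : ℂ) ^ n * φ (Fin.cons (a (Fin.last n)) (Fin.init a)) := by
  rw [← cyc_snoc, Fin.snoc_init_self]

namespace TracedModule

variable {A L : Type*} [Ring A] [Algebra ℂ A] [Ring L] [Algebra ℂ L] (E : TracedModule A L)

/-- Power series of weight `k` whose supercommutator with `F` has weight `k + 1`. -/
structure Reg (k : ℕ) (f : L⟦X⟧) : Prop where
  wt : E.Wt k f
  wt_sd : E.Wt (k + 1) (C E.F * f - (-1 : ℂ) ^ k • (f * C E.F))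

variable {E}

theorem Reg.mul {k l : ℕ} {f g : L⟦X⟧} (hf : E.Reg k f) (hg : E.Reg l g) :
    E.Reg (k + l) (f * g) where
  wt := hf.wt.mul hg.wt
  wt_sd := by
    have h : C E.F * (f * g) - (-1 : ℂ) ^ (k + l) • (f * g * C E.F) =
        (C E.F * f - (-1 : ℂ) ^ k • (f * C E.F)) * g +
          (-1 : ℂ) ^ k • (f * (C E.F * g - (-1 : ℂ) ^ l • (g * C E.F))) := by
      simp only [sub_mul, mul_sub, smul_sub, smul_mul_assoc, mul_smul_comm, smul_smul, pow_add,
        mul_assoc]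
      abel
    rw [h]
    exact (Wt.mul_le (by ring) hf.wt_sd hg.wt).add ((Wt.mul_le (by ring) hf.wt hg.wt_sd).smul _)

theorem Reg.mul_le {k l m : ℕ} (hm : m = k + l) {f g : L⟦X⟧} (hf : E.Reg k f) (hg : E.Reg l g) :
    E.Reg m (f * g) := hm ▸ hf.mul hg

theorem Reg.sub {k : ℕ} {f g : L⟦X⟧} (hf : E.Reg k f) (hg : E.Reg k g) : E.Reg k (f - g) where
  wt := hf.wt.sub hg.wt
  wt_sd := by
    have h : C E.F * (f - g) - (-1 : ℂ) ^ k • ((f - g) * C E.F) =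
        (C E.F * f - (-1 : ℂ) ^ k • (f * C E.F)) - (C E.F * g - (-1 : ℂ) ^ k • (g * C E.F)) := by
      rw [mul_sub, sub_mul, smul_sub]
      abel
    rw [h]
    exact hf.wt_sd.sub hg.wt_sd

theorem reg_G : E.Reg 0 E.G where
  wt := wt_G
  wt_sd := by
    rw [pow_zero, one_smul, E.C_mul_G_of_commute E.F_mul_w, sub_self]
    exact wt_zero

theorem reg_x (a : A) : E.Reg 1 (E.x a) where
  wt := wt_x a
  wt_sd := by
    rw [pow_one, neg_smul, one_smul, sub_neg_eq_add, x, ← map_mul, ← map_mul, ← map_add]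
    exact wt_C (E.sd_d_mem a)

theorem reg_r (a : A) : E.Reg 0 (E.r a) where
  wt := wt_r a
  wt_sd := by
    rw [pow_zero, one_smul, r, ← map_mul, ← map_mul, ← map_sub]
    exact wt_C (E.d_mem a)

theorem reg_C {V : L} (hV : V ∈ E.J 1) (hV' : E.F * V + V * E.F ∈ E.J 2) : E.Reg 1 (C V) where
  wt := wt_C hV
  wt_sd := by
    rw [pow_one, neg_smul, one_smul, sub_neg_eq_add, ← map_mul, ← map_mul, ← map_add]
    exact wt_C hV'

theorem reg_word : ∀ (n : ℕ) (a : Fin n → A), E.Reg n (word E.G E.x n a)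
  | 0, _ => reg_G
  | n + 1, _ => Reg.mul_le (add_comm n 1) (Reg.mul_le (zero_add 1).symm reg_G (reg_x _))
      (reg_word n _)

theorem reg_wordIns {V : L} (hV : V ∈ E.J 1) (hV' : E.F * V + V * E.F ∈ E.J 2) :
    ∀ (n : ℕ) (a : Fin n → A), E.Reg (n + 1) (wordIns E.G (C V) E.x n a)
  | 0, _ => Reg.mul_le (add_zero _).symm (Reg.mul_le rfl reg_G (reg_C hV hV')) reg_G
  | n + 1, _ => (Reg.mul_le (by ring) ((((reg_G.mul (reg_C hV hV')).mul reg_G).mul (reg_x _)))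
      (reg_word n _)).sub (Reg.mul_le (by ring) (reg_G.mul (reg_x _)) (reg_wordIns hV hV' n _))

variable (E)

/-- The functional `(r + k)!⁻¹ T_r`, where `2 r + k = N`. -/
def charTr (k : ℕ) : L⟦X⟧ →ₗ[ℂ] ℂ :=
  if k ≤ E.N ∧ Even (E.N - k) then
    (((E.N - k) / 2 + k).factorial : ℂ)⁻¹ • E.Tr ((E.N - k) / 2) else 0

theorem charTr_of_eq {k r : ℕ} (h : 2 * r + k = E.N) :
    E.charTr k = ((r + k).factorial : ℂ)⁻¹ • E.Tr r := by
  have h1 : E.N - k = 2 * r := by omega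
  rw [charTr, if_pos ⟨by omega, by rw [h1]; exact even_two_mul r⟩, h1,
    Nat.mul_div_cancel_left _ two_pos]

theorem charTr_cases (k : ℕ) : (∃ r, 2 * r + k = E.N) ∨ E.charTr k = 0 ∧ E.charTr (k + 2) = 0 := by
  by_cases h : k ≤ E.N ∧ Even (E.N - k)
  · obtain ⟨r, hr⟩ := h.2
    exact Or.inl ⟨r, by omega⟩
  · refine Or.inr ⟨if_neg h, if_neg fun h' => h ⟨by omega, ?_⟩⟩
    obtain ⟨r, hr⟩ := h'.2
    exact ⟨r + 1, by omega⟩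

theorem charTr_eq_zero_of_lt {k : ℕ} (h : E.N < k) : E.charTr k = 0 := if_neg fun h' => by omega

theorem charTr_eq_zero_of_parity {k : ℕ} (h : (k : ZMod 2) ≠ E.N) : E.charTr k = 0 := by
  refine if_neg fun h' => h ?_
  obtain ⟨r, hr⟩ := h'.2
  have h1 : E.N = k + 2 * r := by omega
  rw [h1]
  push_cast
  have : (2 : ZMod 2) = 0 := rfl
  rw [this, zero_mul, add_zero]

variable {E}

theorem charTr_mul_r_comm {k : ℕ} {f : L⟦X⟧} (hf : E.Wt k f) (b : A) :
    E.charTr k (f * E.r b) = E.charTr k (E.r b * f) := by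
  rcases E.charTr_cases k with ⟨r, hr⟩ | h
  · rw [E.charTr_of_eq hr, LinearMap.smul_apply, LinearMap.smul_apply,
      Tr_mul_comm hf (wt_r b) (eig_r b) (by omega), one_mul]
  · rw [h.1]; rfl

/-- After cancelling `X`, the coefficient of `f` in question has weight `N - 1`, one short of the
guaranteed trace class range, and that of its supercommutator has weight `N`. This is a case that
`T_supercommutator` was made for. -/
theorem charTr_X_supercommutator (hε : E.ε = (-1) ^ (E.N + 1)) {k : ℕ} {f : L⟦X⟧}
    (hf : E.Reg (k + 1) f) :
    E.charTr k (X * (C E.F * f - (-1 : ℂ) ^ (k + 1) • (f * C E.F))) = 0 := by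
  rcases E.charTr_cases k with ⟨r, hr⟩ | h
  · have hε' : E.ε = (-1) ^ (k + 1) := by
      rw [hε, ← hr, add_assoc, pow_add, pow_mul]; norm_num
    rw [E.charTr_of_eq hr, LinearMap.smul_apply]
    rcases r with _ | r
    · rw [Tr_zero_X_mul, smul_zero]
    · have h := hf.wt_sd
      rw [← hε'] at h ⊢
      rw [Tr_succ_X_mul, Tr_supercommutator hf.wt (by omega) h (by omega), smul_zero]
  · rw [h.1]; rfl

theorem charTr_X_mul_r (hε : E.ε = (-1) ^ (E.N + 1)) {k : ℕ} {f : L⟦X⟧}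
    (hf : E.Reg (k + 1) f) (b : A) :
    E.charTr k (X * (E.r b * (C E.F * f - (-1 : ℂ) ^ (k + 1) • (f * C E.F)))) =
      -E.charTr k (X * (E.x b * f)) := by
  have h := charTr_X_supercommutator hε (Reg.mul_le (zero_add _).symm (reg_r b) hf)
  rw [← add_eq_zero_iff_eq_neg, ← map_add, ← mul_add, ← h]
  congr 2
  rw [x, d_apply, map_sub, map_mul, map_mul, r, mul_sub, sub_mul, mul_smul_comm]
  simp only [mul_assoc]
  abel

/-- The factor `r + n + 2` in the cyclic norm is the quotient of consecutive factorials. This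
requirement dictates the normalization `1/(r + k)!` in `charTr`. -/
theorem cycNorm_charTr_word (hε : E.ε = (-1) ^ (E.N + 1)) {n : ℕ} (a : Fin (n + 2) → A) :
    cycNorm (n + 1) (fun a => E.charTr (n + 2) (word E.G E.x (n + 2) a)) a =
      E.charTr n (X * (E.x (a 0) * word E.G E.x (n + 1) (Fin.tail a))) := by
  rcases E.charTr_cases n with ⟨r, hr⟩ | h
  · rcases r with _ | r
    · rw [E.charTr_of_eq hr, E.charTr_eq_zero_of_lt (k := n + 2) (by omega), LinearMap.smul_apply,
        Tr_zero_X_mul, smul_zero]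
      exact congrFun (map_zero (cycNorm (n + 1))) a
    · have hε' : E.ε = (-1) ^ (n + 1) := by
        rw [hε, ← hr, add_assoc, pow_add, pow_mul]; norm_num
      rw [E.charTr_of_eq hr, E.charTr_of_eq (k := n + 2) (r := r) (by omega), LinearMap.smul_apply,
        Tr_succ_X_mul]
      have h1 := cycNorm_Tr_word (E := E) (n := n + 1) (r := r) (by omega) hε' a
      have h2 : (fun a => ((((r + (n + 2)).factorial : ℂ)⁻¹ • E.Tr r) (word E.G E.x (n + 2) a))) =
        ((r + (n + 2)).factorial : ℂ)⁻¹ • fun a => E.Tr r (word E.G E.x (n + 1 + 1) a) := rfl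
      have h3 : (r + (n + 2)).factorial = (r + n + 2) * (r + 1 + n).factorial := by
        rw [show r + (n + 2) = r + 1 + n + 1 by ring, Nat.factorial_succ]
        ring
      have h4 : ((r + 1 + n).factorial : ℂ) ≠ 0 := Nat.cast_ne_zero.2 (Nat.factorial_ne_zero _)
      have h5 : (r + n + 2 : ℂ) ≠ 0 := by exact_mod_cast Nat.succ_ne_zero (r + n + 1)
      rw [h2, map_smul, Pi.smul_apply, h1, h3]
      simp only [smul_eq_mul]
      push_cast
      rw [mul_inv]
      field_simp
      ring
  · rw [h.1, h.2]
    exact congrFun (map_zero (cycNorm (n + 1))) a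

theorem cycNorm_charTr_wordIns (hε : E.ε = (-1) ^ (E.N + 1)) {V : L} (hV : V ∈ E.J 1)
    (hσ : E.σ V = E.ε • V) {n : ℕ} (a : Fin (n + 1) → A) :
    cycNorm n (fun a => E.charTr (n + 2) (wordIns E.G (C V) E.x (n + 1) a)) a =
      -E.charTr n (X * (E.x (a 0) * wordIns E.G (C V) E.x n (Fin.tail a))) := by
  rcases E.charTr_cases n with ⟨r, hr⟩ | h
  · rcases r with _ | r
    · rw [E.charTr_of_eq hr, E.charTr_eq_zero_of_lt (k := n + 2) (by omega), LinearMap.smul_apply,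
        Tr_zero_X_mul, smul_zero, neg_zero]
      exact congrFun (map_zero (cycNorm n)) a
    · have hε' : E.ε = (-1) ^ (n + 1) := by
        rw [hε, ← hr, add_assoc, pow_add, pow_mul]; norm_num
      rw [E.charTr_of_eq hr, E.charTr_of_eq (k := n + 2) (r := r) (by omega), LinearMap.smul_apply,
        Tr_succ_X_mul]
      have h1 := cycNorm_Tr_wordIns (E := E) (n := n) (r := r) (by omega) hε' hV hσ a
      have h2 : (fun a => ((((r + (n + 2)).factorial : ℂ)⁻¹ • E.Tr r)
          (wordIns E.G (C V) E.x (n + 1) a))) = ((r + (n + 2)).factorial : ℂ)⁻¹ •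
            fun a => E.Tr r (wordIns E.G (C V) E.x (n + 1) a) := rfl
      have h3 : (r + (n + 2)).factorial = (r + n + 2) * (r + 1 + n).factorial := by
        rw [show r + (n + 2) = r + 1 + n + 1 by ring, Nat.factorial_succ]
        ring
      have h4 : ((r + 1 + n).factorial : ℂ) ≠ 0 := Nat.cast_ne_zero.2 (Nat.factorial_ne_zero _)
      have h5 : (r + n + 2 : ℂ) ≠ 0 := by exact_mod_cast Nat.succ_ne_zero (r + n + 1)
      rw [h2, map_smul, Pi.smul_apply, h1, h3]
      simp only [smul_eq_mul]
      push_cast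
      rw [mul_inv]
      field_simp
      ring
  · rw [h.1, h.2]
    exact (congrFun (map_zero (cycNorm n)) a).trans neg_zero.symm

/-! ### The character in the cyclic bicomplex -/

variable (E)

/-- The character, Hochschild columns. -/
def φ : CochainFamily A := fun n a => E.charTr n (E.r (a 0) * word E.G E.x n (Fin.tail a))

/-- The character, bar columns. -/
def ψ : CochainFamily A := fun n a => E.charTr (n + 1) (word E.G E.x (n + 1) a)

/-- The transgression, Hochschild columns. -/
def α (V : L) : CochainFamily A := fun n a =>
  -E.charTr (n + 1) (E.r (a 0) * wordIns E.G (C V) E.x n (Fin.tail a))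

/-- The transgression, bar columns. -/
def β (V : L) : CochainFamily A := fun n a => -E.charTr (n + 2) (wordIns E.G (C V) E.x (n + 1) a)

/-- The derivative of the character, Hochschild columns. -/
def dφ (D : L⟦X⟧ → L⟦X⟧) : CochainFamily A := fun n a =>
  E.charTr n (E.r (a 0) * D (word E.G E.x n (Fin.tail a)))

/-- The derivative of the character, bar columns. -/
def dψ (D : L⟦X⟧ → L⟦X⟧) : CochainFamily A := fun n a =>
  E.charTr (n + 1) (D (word E.G E.x (n + 1) a))

variable {E}

theorem barD_r_mul_word {n : ℕ} (a : Fin (n + 2) → A) :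
    barD (fun v : Fin (n + 1) → A => E.r (v 0) * word E.G E.x n (Fin.tail v)) a =
      E.r (a 0 * a 1) * word E.G E.x n (Fin.tail (Fin.tail a)) -
        E.r (a 0) * wordBar E.r (C E.F) E.G X E.x n (Fin.tail a) := by
  rcases n with _ | n
  · rw [barD_one, E.wordRelations.wordBar_zero, mul_zero, sub_zero]
    rfl
  · rw [barD_succ, ← E.wordRelations.barD_word, ← barD_mul_left]
    rfl

theorem barD_r_mul_wordIns {V : L} {D : L⟦X⟧ → L⟦X⟧}
    (hD : WordDerivation E.r (C E.F) E.G X (C V) E.x D) {n : ℕ} (a : Fin (n + 2) → A) :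
    barD (fun v : Fin (n + 1) → A => E.r (v 0) * wordIns E.G (C V) E.x n (Fin.tail v)) a =
      E.r (a 0 * a 1) * wordIns E.G (C V) E.x n (Fin.tail (Fin.tail a)) -
        E.r (a 0) * wordInsBar E.r (C E.F) E.G X (C V) E.x D n (Fin.tail a) := by
  rcases n with _ | n
  · rw [barD_one, E.wordRelations.wordInsBar_zero hD, mul_zero, sub_zero]
    rfl
  · rw [barD_succ, ← E.wordRelations.barD_wordIns hD, ← barD_mul_left]
    rfl

theorem r_mul (a b : A) : E.r (a * b) = E.r a * E.r b := by rw [r, map_mul, map_mul]; rfl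

/-- In positive degrees one end term of the Bianchi identity cancels the first face and the other
one cancels the wrapping face by cyclicity. There remains `z a₀` times a supercommutator with `F`;
integration by parts makes it `-z[F, a₀]` times the word, the negative of `N ψ`, up to the common
sign. -/
theorem bicomplexHoch_φ_ψ (hε : E.ε = (-1) ^ (E.N + 1)) : bicomplexHoch E.φ E.ψ = 0 := by
  funext n a
  rcases n with _ | n
  · rw [bicomplexHoch]
    -- For `N` odd, `ψ 0` is a multiple of the trace of `[F, a₀]G = [F, a₀G]`, where `ε = 1`. For
    -- `N` even it is zero by definition.
    by_cases h : E.N % 2 = 1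
    · obtain ⟨r, hr⟩ : ∃ r, 2 * r + 1 = E.N := ⟨E.N / 2, by omega⟩
      have hε' : E.ε = 1 := by
        rw [hε, ← hr, add_assoc, pow_add, pow_mul]; norm_num
      have h1 := cycNorm_Tr_word (E := E) (n := 0) (r := r) (by omega) (by rw [hε', pow_zero]) a
      have h2 : E.ψ 0 = ((r + 1).factorial : ℂ)⁻¹ • fun a => E.Tr r (word E.G E.x 1 a) := by
        funext a
        rw [ψ, E.charTr_of_eq hr]
        rfl
      have h3 := Tr_supercommutator (E := E) (r := r) (v := 0) (v' := 1)
        ((wt_r (a 0)).mul wt_G) (by omega)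
        (by rw [hε', one_smul]; have := ((reg_r (E := E) (a 0)).mul reg_G).wt_sd
            rwa [pow_zero, one_smul] at this) (by omega)
      have h4 : E.x (a 0) * word E.G E.x 0 (Fin.tail a) =
          C E.F * (E.r (a 0) * E.G) - E.ε • (E.r (a 0) * E.G * C E.F) := by
        rw [hε', one_smul, mul_assoc, ← E.C_mul_G_of_commute E.F_mul_w, x, d_apply, map_sub,
          map_mul, map_mul, word, TracedModule.r, sub_mul]
        simp only [mul_assoc]
      rw [h2, map_smul, Pi.smul_apply, h1, h4, h3, mul_zero, smul_zero]
      rfl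
    · have h2 : E.ψ 0 = 0 := by
        funext a
        rw [ψ, charTr, if_neg]
        · rfl
        · rintro ⟨h1, r, hr⟩
          omega
      rw [h2, map_zero]
      rfl
  · have hf := reg_word (E := E) (n + 1) (Fin.tail a)
    have e1 : (Fin.tail a) 0 = a 1 := rfl
    have e3 : (Fin.tail a) (Fin.last n) = a (Fin.last (n + 1)) := rfl
    have h1 : barD (E.φ n) a = E.charTr n (barD (fun v : Fin (n + 1) → A =>
        E.r (v 0) * word E.G E.x n (Fin.tail v)) a) := barD_comp _ _ a
    have h2 : cycNorm (n + 1) (E.ψ (n + 1)) a =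
        E.charTr n (X * (E.x (a 0) * word E.G E.x (n + 1) (Fin.tail a))) :=
      cycNorm_charTr_word hε a
    have h3 := charTr_mul_r_comm (k := n)
      ((wt_r (a 0)).mul (reg_word (E := E) n (Fin.init (Fin.tail a))).wt |>.anti (by omega))
      (a (Fin.last (n + 1)))
    have h4 := charTr_X_mul_r hε hf (a 0)
    rw [bicomplexHoch, Pi.add_apply, hochschildb_eq_barD, h1, h2, barD_r_mul_word, r_mul, wordBar,
      e1, e3, φ, Fin.cons_zero, Fin.tail_cons, Fin.tail_init_eq_init_tail, r_mul, Pi.zero_apply,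
      Pi.zero_apply]
    simp only [mul_sub, map_sub, mul_assoc, mul_smul_comm, map_smul, smul_eq_mul] at h3 h4 ⊢
    have e4 : ∀ g, E.r (a 0) * (X * g) = X * (E.r (a 0) * g) := fun g => by
      rw [← mul_assoc, (commute_X (E.r (a 0))).eq, mul_assoc]
    simp only [e4, h3] at h4 ⊢
    rw [pow_succ] at h4 ⊢
    linear_combination h4

theorem bicomplexBar_φ_ψ (hε : E.ε = (-1) ^ (E.N + 1)) : bicomplexBar E.φ E.ψ = 0 := by
  funext n a
  rcases n with _ | n
  · rfl
  · have hf := reg_word (E := E) (n + 2) a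
    have h1 : barD (E.ψ n) a = E.charTr (n + 1) (barD (word E.G E.x (n + 1)) a) := barD_comp _ _ a
    have h3 := charTr_mul_r_comm (reg_word (E := E) (n + 1) (Fin.init a)).wt (a (Fin.last (n + 1)))
    have h4 := charTr_X_supercommutator hε hf
    rw [bicomplexBar, Pi.sub_apply, Pi.sub_apply, h1, E.wordRelations.barD_word, wordBar, cyc_apply,
      φ, φ, Fin.cons_zero, Fin.tail_cons, map_sub, map_sub, map_smul, h3, h4, smul_eq_mul,
      Pi.zero_apply, Pi.zero_apply]
    ring

section Transgression

variable {V : L} {D : L⟦X⟧ → L⟦X⟧}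

/-- The cancellations are those of the cocycle property, with `barD_wordIns` in place of
`barD_word`; what survives is the derivative of the word. -/
theorem bicomplexHoch_α_β (hε : E.ε = (-1) ^ (E.N + 1)) (hV : V ∈ E.J 1)
    (hV' : E.F * V + V * E.F ∈ E.J 2) (hσ : E.σ V = E.ε • V)
    (hD : WordDerivation E.r (C E.F) E.G X (C V) E.x D) :
    bicomplexHoch (E.α V) (E.β V) = E.dφ D := by
  funext n a
  have hN : ∀ (n : ℕ) (a : Fin (n + 1) → A), cycNorm n (E.β V n) a =
      E.charTr n (X * (E.x (a 0) * wordIns E.G (C V) E.x n (Fin.tail a))) := fun n a => by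
    have h := cycNorm_charTr_wordIns hε hV hσ a
    have h2 : E.β V n = -fun a => E.charTr (n + 2) (wordIns E.G (C V) E.x (n + 1) a) := rfl
    rw [h2, map_neg, Pi.neg_apply, h, neg_neg]
  rcases n with _ | n
  · have h4 := charTr_X_mul_r hε (reg_wordIns hV hV' 0 (Fin.tail a)) (a 0)
    have hs : (-1 : ℂ) ^ (0 + 1) = -1 := by norm_num
    rw [hs, neg_smul, one_smul, sub_neg_eq_add] at h4
    rw [bicomplexHoch, hN, dφ, word, hD.map_G, ← neg_eq_iff_eq_neg.2 h4, wordIns, mul_neg, map_neg]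
    congr 2
    have h2 : ∀ r, C E.F * (E.G * r) = E.G * (C E.F * r) := fun r => by
      rw [← mul_assoc, E.wordRelations.comm, mul_assoc]
    rw [← mul_assoc (E.r (a 0)), (commute_X (E.r (a 0))).eq, mul_assoc]
    simp only [mul_add, add_mul, mul_assoc, h2, ← E.wordRelations.comm]
  · have hf := reg_wordIns (E := E) hV hV' (n + 1) (Fin.tail a)
    have e1 : (Fin.tail a) 0 = a 1 := rfl
    have e3 : (Fin.tail a) (Fin.last n) = a (Fin.last (n + 1)) := rfl
    have h1 : barD (E.α V n) a = -E.charTr (n + 1) (barD (fun v : Fin (n + 1) → A =>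
        E.r (v 0) * wordIns E.G (C V) E.x n (Fin.tail v)) a) := by
      rw [← LinearMap.neg_apply, ← barD_comp]
      rfl
    have h3 := charTr_mul_r_comm (k := n + 1)
      ((wt_r (a 0)).mul (reg_wordIns (E := E) hV hV' n (Fin.init (Fin.tail a))).wt |>.anti
        (by omega)) (a (Fin.last (n + 1)))
    have h4 := charTr_X_mul_r hε hf (a 0)
    rw [bicomplexHoch, Pi.add_apply, hochschildb_eq_barD, h1, hN, barD_r_mul_wordIns hD, r_mul,
      wordInsBar, e1, e3, α, Fin.cons_zero, Fin.tail_cons, Fin.tail_init_eq_init_tail, r_mul, dφ]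
    simp only [mul_sub, mul_add, map_sub, map_add, mul_assoc, mul_smul_comm, map_smul,
      smul_eq_mul] at h3 h4 ⊢
    have e4 : ∀ g, E.r (a 0) * (X * g) = X * (E.r (a 0) * g) := fun g => by
      rw [← mul_assoc, (commute_X (E.r (a 0))).eq, mul_assoc]
    simp only [e4, h3] at h4 ⊢
    rw [pow_succ, pow_succ] at h4
    rw [pow_succ]
    linear_combination h4

/-- Only positive degrees are claimed: in degree zero `bicomplexBar` vanishes by definition, whereas
`dψ` need not. The projection does not read this component. -/
theorem bicomplexBar_α_β (hε : E.ε = (-1) ^ (E.N + 1)) (hV : V ∈ E.J 1)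
    (hV' : E.F * V + V * E.F ∈ E.J 2) (hD : WordDerivation E.r (C E.F) E.G X (C V) E.x D) (n : ℕ) :
    bicomplexBar (E.α V) (E.β V) (n + 1) = E.dψ D (n + 1) := by
  funext a
  have hf := reg_wordIns (E := E) hV hV' (n + 2) a
  have h1 : barD (E.β V n) a = -E.charTr (n + 2) (barD (wordIns E.G (C V) E.x (n + 1)) a) := by
    rw [← LinearMap.neg_apply, ← barD_comp]
    rfl
  have h3 := charTr_mul_r_comm (reg_wordIns (E := E) hV hV' (n + 1) (Fin.init a)).wt
    (a (Fin.last (n + 1)))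
  have h4 := charTr_X_supercommutator hε hf
  rw [bicomplexBar, Pi.sub_apply, Pi.sub_apply, h1, E.wordRelations.barD_wordIns hD, wordInsBar,
    cyc_apply, α, α, Fin.cons_zero, Fin.tail_cons, map_add, map_add, map_sub, map_smul, h3,
    smul_eq_mul, dψ]
  rw [pow_succ, mul_neg_one, neg_smul, sub_neg_eq_add] at h4
  rw [h4]
  ring

end Transgression

end TracedModule

end CyclicCharacter

end

/-! ### The class of the character and its homotopy invariance. -/

noncomputable section

namespace CyclicCharacter

open PowerSeries
open scoped Polynomial

theorem connesB₀_sub {A : Type*} [Ring A] {n : ℕ} (φ χ : Functionals A (n + 1)) :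
    connesB₀ n (φ - χ) = connesB₀ n φ - connesB₀ n χ := by
  simp only [connesB₀_eq, map_sub]
  abel

theorem bicomplexProj_sub {A : Type*} [Ring A] (α α' β β' : CochainFamily A) :
    bicomplexProj (α - α') (β - β') = bicomplexProj α β - bicomplexProj α' β' := by
  funext n
  simp only [bicomplexProj, Pi.sub_apply, connesB₀_sub, map_sub]
  abel

theorem bicomplexProj_zero {A : Type*} [Ring A] :
    bicomplexProj (0 : CochainFamily A) 0 = 0 := by
  simpa using bicomplexProj_sub (0 : CochainFamily A) 0 0 0

theorem map_word {A R S : Type*} [Ring R] [Ring S] (h : R →+* S) (G : R) (x : A → R) :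
    ∀ (n : ℕ) (a : Fin n → A), h (word G x n a) = word (h G) (fun b => h (x b)) n a
  | 0, _ => rfl
  | n + 1, a => by rw [word, word, map_mul, map_mul, map_word h G x n]

namespace TracedModule

variable {A L : Type*} [Ring A] [Algebra ℂ A] [Ring L] [Algebra ℂ L] (E : TracedModule A L)

/-! ### The character as an element of the periodic complex -/

/-- The constant series, as a linear map. -/
def Cₗ : L →ₗ[ℂ] L⟦X⟧ where
  toFun := C
  map_add' := map_add _
  map_smul' c l := by
    ext n
    rw [RingHom.id_apply, PowerSeries.coeff_smul, coeff_C, coeff_C]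
    split_ifs
    · rfl
    · rw [smul_zero]

theorem isMultilinearMap_word_x (n : ℕ) : IsMultilinearMap (word E.G E.x n) :=
  isMultilinearMap_word E.G (Cₗ ∘ₗ E.d) n

theorem isMultilinearMap_wordIns_x (V : L) (n : ℕ) :
    IsMultilinearMap (wordIns E.G (C V) E.x n) :=
  isMultilinearMap_wordIns E.G (C V) (Cₗ ∘ₗ E.d) n

/-- The character in the `(b, B)`-bicomplex. -/
def char : CochainFamily A := bicomplexProj E.φ E.ψ

theorem char_mem_periodicCochains : E.char ∈ periodicCochains A E.N := by
  refine bicomplexProj_mem (K := E.N) (fun n => ?_) (fun n => ?_) (fun n hn => ?_) (fun n hn => ?_)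
    (fun n hn => ?_) (fun n hn => ?_)
  · exact ((E.isMultilinearMap_word_x n).cons_mul (Cₗ ∘ₗ (E.ρ : A →ₗ[ℂ] L))).comp (E.charTr n)
  · exact (E.isMultilinearMap_word_x (n + 1)).comp (E.charTr (n + 1))
  · funext a
    rw [φ, E.charTr_eq_zero_of_parity hn]
    rfl
  · funext a
    rw [ψ, E.charTr_eq_zero_of_parity]
    · rfl
    · rw [← hn]
      have key : ∀ x : ZMod 2, x + 1 ≠ x := by decide
      push_cast
      exact key _
  · funext a
    rw [φ, E.charTr_eq_zero_of_lt hn]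
    rfl
  · funext a
    rw [ψ, E.charTr_eq_zero_of_lt (by omega)]
    rfl

theorem transgression_mem_periodicCochains (V : L) :
    bicomplexProj (E.α V) (E.β V) ∈ periodicCochains A ((E.N : ZMod 2) + 1) := by
  refine bicomplexProj_mem (K := E.N) (fun n => ?_) (fun n => ?_) (fun n hn => ?_) (fun n hn => ?_)
    (fun n hn => ?_) (fun n hn => ?_)
  · exact ((E.isMultilinearMap_wordIns_x V n).cons_mul (Cₗ ∘ₗ (E.ρ : A →ₗ[ℂ] L))).comp
      (-E.charTr (n + 1))
  · exact (E.isMultilinearMap_wordIns_x V (n + 1)).comp (-E.charTr (n + 2))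
  · funext a
    rw [α, E.charTr_eq_zero_of_parity, LinearMap.zero_apply, neg_zero]
    · rfl
    · have key : ∀ x y : ZMod 2, x ≠ y + 1 → x + 1 ≠ y := by decide
      push_cast
      exact key _ _ hn
  · funext a
    rw [β, E.charTr_eq_zero_of_parity, LinearMap.zero_apply, neg_zero]
    · rfl
    · have key : ∀ x y : ZMod 2, x = y + 1 → x + 2 ≠ y := by decide
      push_cast
      exact key _ _ hn
  · funext a
    rw [α, E.charTr_eq_zero_of_lt (by omega), LinearMap.zero_apply, neg_zero]
    rfl
  · funext a
    rw [β, E.charTr_eq_zero_of_lt (by omega), LinearMap.zero_apply, neg_zero]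
    rfl

theorem char_mem_periodicCocycles (hε : E.ε = (-1) ^ (E.N + 1)) :
    E.char ∈ periodicCocycles A E.N := by
  refine ⟨E.char_mem_periodicCochains, ?_⟩
  change totalD A E.char = 0
  rw [char, totalD_bicomplexProj, bicomplexHoch_φ_ψ hε, bicomplexBar_φ_ψ hε,
    bicomplexProj_zero]

/-! ### Derivations -/

/-- A linear map applied to the coefficients of a power series. -/
def mapCoeff (D : L →ₗ[ℂ] L) (f : L⟦X⟧) : L⟦X⟧ := PowerSeries.mk fun n => D (coeff n f)

theorem coeff_mapCoeff (D : L →ₗ[ℂ] L) (f : L⟦X⟧) (n : ℕ) :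
    coeff n (mapCoeff D f) = D (coeff n f) := coeff_mk _ _

theorem mapCoeff_C (D : L →ₗ[ℂ] L) (l : L) : mapCoeff D (C l) = C (D l) := by
  ext n
  rw [coeff_mapCoeff, coeff_C, coeff_C]
  split_ifs
  · rfl
  · rw [map_zero]

theorem mapCoeff_mul {D : L →ₗ[ℂ] L} (hD : ∀ r s, D (r * s) = D r * s + r * D s) (f g : L⟦X⟧) :
    mapCoeff D (f * g) = mapCoeff D f * g + f * mapCoeff D g := by
  ext n
  rw [coeff_mapCoeff, map_add, coeff_mul, coeff_mul, coeff_mul, map_sum, ← Finset.sum_add_distrib]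
  refine Finset.sum_congr rfl fun p _ => ?_
  rw [hD, coeff_mapCoeff, coeff_mapCoeff]

theorem wordDerivation {D : L →ₗ[ℂ] L} (hD : ∀ r s, D (r * s) = D r * s + r * D s)
    (hρ : ∀ a, D (E.ρ a) = 0) {V : L} (hF : D E.F = V) :
    WordDerivation E.r (C E.F) E.G X (C V) E.x (mapCoeff D) where
  leibniz := mapCoeff_mul hD
  map_G := by
    have h1 : D 1 = 0 := by
      have := hD 1 1
      simpa only [mul_one, one_mul, left_eq_add] using this
    have hw : D E.w = -(E.F * V + V * E.F) := by
      rw [w, map_sub, h1, hD, hF, zero_sub, add_comm]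
    have hX : ∀ f, mapCoeff D (X * f) = X * mapCoeff D f := fun f => by
      ext n
      rcases n with _ | n
      · rw [coeff_mapCoeff, coeff_zero_X_mul, coeff_zero_X_mul, map_zero]
      · rw [coeff_mapCoeff, coeff_succ_X_mul, coeff_succ_X_mul, coeff_mapCoeff]
    have hXw : mapCoeff D (1 - X * C E.w) = X * C (E.F * V + V * E.F) := by
      have h2 : mapCoeff D (1 - X * C E.w) = mapCoeff D 1 - mapCoeff D (X * C E.w) := by
        ext n
        rw [coeff_mapCoeff, map_sub, map_sub, map_sub, coeff_mapCoeff, coeff_mapCoeff]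
      rw [h2, hX, mapCoeff_C, hw, ← map_one C, mapCoeff_C, h1, map_zero, zero_sub, map_neg, mul_neg,
        neg_neg]
    have h3 := congrArg (mapCoeff D) E.G_mul
    rw [mapCoeff_mul hD, hXw, show mapCoeff D (1 : L⟦X⟧) = 0 by
      rw [← map_one C, mapCoeff_C, h1, map_zero]] at h3
    have h4 := congrArg (· * E.G) h3
    simp only [add_mul, zero_mul] at h4
    rw [mul_assoc, E.mul_G, mul_one] at h4
    rw [eq_neg_of_add_eq_zero_left h4, ← mul_assoc E.G, (commute_X E.G).eq]
    simp only [map_add, map_mul, mul_assoc]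
  map_x a := by
    rw [x, mapCoeff_C, d_apply, map_sub, hD, hD, hF, hρ, mul_zero, zero_mul, add_zero, zero_add,
      map_sub, map_mul, map_mul]
    rfl

/-! ### The path of operators -/

variable (V : L)

/-- The module with the operator `F + V`. -/
def shift (hV : V ∈ E.J 1) (hσ : E.σ V = E.ε • V) (hV' : E.F * V + V * E.F ∈ E.J 2) :
    TracedModule A L where
  J := E.J
  σ := E.σ
  T := E.T
  N := E.N
  ρ := E.ρ
  F := E.F + V
  ε := E.ε
  mem_zero := E.mem_zero
  anti := E.anti
  mul_mem := E.mul_mem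
  cyclic := E.cyclic
  σ_ρ := E.σ_ρ
  σ_F := by rw [map_add, E.σ_F, hσ, smul_add]
  ε_sq := E.ε_sq
  comm_mem a := by
    have h : (E.F + V) * E.ρ a - E.ρ a * (E.F + V) = E.d a + (V * E.ρ a - E.ρ a * V) := by
      rw [d_apply]; noncomm_ring
    rw [h]
    exact add_mem (E.d_mem a) (sub_mem (E.mul_mem_right _ hV) (E.mul_mem_left _ hV))
  defect_mem := by
    have h : 1 - (E.F + V) * (E.F + V) = E.w - (E.F * V + V * E.F) - V * V := by
      rw [w]; noncomm_ring
    rw [h]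
    exact sub_mem (sub_mem E.defect_mem hV') (E.mul_mem hV hV)

/-- The integral over `[0, 1]` of the values of `T` along a polynomial path. -/
def polyT (T : L →ₗ[ℂ] ℂ) : L[X] →ₗ[ℂ] ℂ :=
  Polynomial.lsum fun j => ((j : ℂ) + 1)⁻¹ • T

theorem polyT_apply (T : L →ₗ[ℂ] ℂ) (p : L[X]) :
    polyT T p = p.sum fun j l => ((j : ℂ) + 1)⁻¹ * T l := Polynomial.lsum_apply _ _

theorem polyT_congr {T : L →ₗ[ℂ] ℂ} {p q : L[X]} (h : ∀ n, T (p.coeff n) = T (q.coeff n)) :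
    polyT T p = polyT T q := by
  rw [← sub_eq_zero, ← map_sub, polyT_apply, Polynomial.sum]
  refine Finset.sum_eq_zero fun n _ => ?_
  rw [Polynomial.coeff_sub, map_sub, h, sub_self, mul_zero]

/-- The evaluation at a natural number, a ring homomorphism. -/
def polyEval (c : ℕ) : L[X] →+* L :=
  Polynomial.eval₂RingHom' (RingHom.id L) (c : L) fun a => (Nat.cast_commute c a).symm

omit [Algebra ℂ L] in
theorem polyEval_C (c : ℕ) (l : L) : polyEval c (Polynomial.C l) = l := by
  simp [polyEval]

omit [Algebra ℂ L] in
theorem polyEval_X (c : ℕ) : polyEval c (Polynomial.X : L[X]) = c := by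
  simp [polyEval]

omit [Algebra ℂ L] in
theorem polyEval_monomial (c n : ℕ) (l : L) :
    polyEval c (Polynomial.monomial n l) = l * (c : L) ^ n := by
  rw [← Polynomial.C_mul_X_pow_eq_monomial, map_mul, map_pow, polyEval_C, polyEval_X]

/-- The fundamental theorem of calculus for polynomial paths. It needs no topology on `L`. -/
theorem polyT_derivative (T : L →ₗ[ℂ] ℂ) (p : L[X]) :
    polyT T (Polynomial.derivative p) = T (polyEval 1 p) - T (polyEval 0 p) := by
  induction p using Polynomial.induction_on' with
  | add p q hp hq => simp only [map_add, hp, hq]; ring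
  | monomial n l =>
    rw [Polynomial.derivative_monomial, polyT_apply, polyEval_monomial, polyEval_monomial,
      Polynomial.sum_monomial_index _ _ (by rw [map_zero, mul_zero])]
    rcases n with _ | n
    · simp
    · have h : l * ((n + 1 : ℕ) : L) = ((n : ℂ) + 1) • l := by
        rw [← nsmul_eq_mul', ← Nat.cast_smul_eq_nsmul ℂ]
        push_cast
        rfl
      rw [h, map_smul, Nat.add_sub_cancel, smul_eq_mul, ← mul_assoc,
        inv_mul_cancel₀ (Nat.cast_add_one_ne_zero n)]
      simp

/-- Polynomials with coefficients in a submodule. -/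
def polySubmodule (J : Submodule ℂ L) : Submodule ℂ L[X] where
  carrier := {p | ∀ n, p.coeff n ∈ J}
  zero_mem' n := by rw [Polynomial.coeff_zero]; exact J.zero_mem
  add_mem' hp hq n := by rw [Polynomial.coeff_add]; exact J.add_mem (hp n) (hq n)
  smul_mem' c p hp n := by rw [Polynomial.coeff_smul]; exact J.smul_mem c (hp n)

theorem C_mem_polySubmodule {J : Submodule ℂ L} {l : L} (hl : l ∈ J) :
    Polynomial.C l ∈ polySubmodule J := fun n => by
  rw [Polynomial.coeff_C]
  split_ifs
  · exact hl
  · exact J.zero_mem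

theorem X_mul_C_mem_polySubmodule {J : Submodule ℂ L} {l : L} (hl : l ∈ J) :
    Polynomial.X * Polynomial.C l ∈ polySubmodule J := fun n => by
  rcases n with _ | n
  · rw [Polynomial.coeff_X_mul_zero]; exact J.zero_mem
  · rw [Polynomial.coeff_X_mul]; exact C_mem_polySubmodule hl n

theorem X_mul_X_mul_C_mem_polySubmodule {J : Submodule ℂ L} {l : L} (hl : l ∈ J) :
    Polynomial.X * (Polynomial.X * Polynomial.C l) ∈ polySubmodule J := fun n => by
  rcases n with _ | n
  · rw [Polynomial.coeff_X_mul_zero]; exact J.zero_mem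
  · rw [Polynomial.coeff_X_mul]; exact X_mul_C_mem_polySubmodule hl n

omit [Algebra ℂ L] in
theorem X_mul_C_eq (l l' : L) : Polynomial.C l * (Polynomial.X * Polynomial.C l') =
    Polynomial.X * Polynomial.C (l * l') := by
  rw [← mul_assoc, ← Polynomial.X_mul, mul_assoc, Polynomial.C_mul]

omit [Algebra ℂ L] in
theorem X_mul_X_mul_C_eq (l l' : L) :
    Polynomial.X * Polynomial.C l * (Polynomial.X * Polynomial.C l') =
    Polynomial.X * (Polynomial.X * Polynomial.C (l * l')) := by
  rw [mul_assoc, X_mul_C_eq]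

/-- The module over the polynomial algebra with the operator `F + t V`. -/
def path (hV : V ∈ E.J 1) (hσ : E.σ V = E.ε • V) (hV' : E.F * V + V * E.F ∈ E.J 2) :
    TracedModule A L[X] where
  J k := polySubmodule (E.J k)
  σ := Polynomial.mapAlgHom E.σ
  T := polyT E.T
  N := E.N
  ρ := (Polynomial.CAlgHom (R := ℂ) (A := L) : L →ₙₐ[ℂ] L[X]).comp E.ρ
  F := Polynomial.C E.F + Polynomial.X * Polynomial.C V
  ε := E.ε
  mem_zero p n := E.mem_zero _
  anti k l hkl p hp n := E.anti hkl (hp n)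
  mul_mem {a b p q} hp hq n := by
    rw [Polynomial.coeff_mul]
    exact sum_mem fun i _ => E.mul_mem (hp _) (hq _)
  cyclic {a b p q} hp hq hab := by
    refine polyT_congr fun n => ?_
    rw [Polynomial.coeff_mul, Polynomial.coeff_mul, map_sum, map_sum,
      ← Finset.Nat.sum_antidiagonal_swap]
    refine Finset.sum_congr rfl fun i _ => ?_
    rw [Prod.fst_swap, Prod.snd_swap, E.cyclic (hp _) (hq _) hab, Polynomial.coeff_mapAlgHom_apply]
  σ_ρ a := by
    change Polynomial.mapAlgHom E.σ (Polynomial.C (E.ρ a)) = Polynomial.C (E.ρ a)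
    rw [Polynomial.coe_mapAlgHom, Polynomial.map_C]
    congr 1
    exact E.σ_ρ a
  σ_F := by
    rw [Polynomial.coe_mapAlgHom, Polynomial.map_add, Polynomial.map_mul, Polynomial.map_X,
      Polynomial.map_C, Polynomial.map_C]
    have h1 : (E.σ : L →+* L) E.F = E.ε • E.F := E.σ_F
    have h2 : (E.σ : L →+* L) V = E.ε • V := hσ
    rw [h1, h2, smul_add, ← Polynomial.smul_C, ← Polynomial.smul_C, mul_smul_comm]
  ε_sq := E.ε_sq
  comm_mem a := by
    change (Polynomial.C E.F + Polynomial.X * Polynomial.C V) * Polynomial.C (E.ρ a) -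
      Polynomial.C (E.ρ a) * (Polynomial.C E.F + Polynomial.X * Polynomial.C V) ∈ _
    have h : (Polynomial.C E.F + Polynomial.X * Polynomial.C V) * Polynomial.C (E.ρ a) -
        Polynomial.C (E.ρ a) * (Polynomial.C E.F + Polynomial.X * Polynomial.C V) =
        Polynomial.C (E.d a) + Polynomial.X * Polynomial.C (V * E.ρ a - E.ρ a * V) := by
      rw [d_apply, add_mul, mul_add, X_mul_C_eq, mul_assoc, ← Polynomial.C_mul, ← Polynomial.C_mul,
        ← Polynomial.C_mul, Polynomial.C_sub, Polynomial.C_sub, mul_sub]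
      abel
    rw [h]
    exact add_mem (C_mem_polySubmodule (E.d_mem a)) (X_mul_C_mem_polySubmodule
      (sub_mem (E.mul_mem_right _ hV) (E.mul_mem_left _ hV)))
  defect_mem := by
    have h : 1 - (Polynomial.C E.F + Polynomial.X * Polynomial.C V) *
        (Polynomial.C E.F + Polynomial.X * Polynomial.C V) =
        Polynomial.C E.w - Polynomial.X * Polynomial.C (E.F * V + V * E.F) -
          Polynomial.X * (Polynomial.X * Polynomial.C (V * V)) := by
      rw [w, add_mul, mul_add, mul_add, X_mul_C_eq, X_mul_X_mul_C_eq, mul_assoc, ← Polynomial.C_mul,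
        ← Polynomial.C_mul, Polynomial.C_sub, Polynomial.C_add, mul_add, Polynomial.C_1]
      abel
    rw [h]
    exact sub_mem (sub_mem (C_mem_polySubmodule E.defect_mem) (X_mul_C_mem_polySubmodule hV'))
      (X_mul_X_mul_C_mem_polySubmodule (E.mul_mem hV hV))

section Homotopy

variable {E V}
variable {hV : V ∈ E.J 1} {hσ : E.σ V = E.ε • V} {hV' : E.F * V + V * E.F ∈ E.J 2}

theorem map_letters {E₁ : TracedModule A L} {c : ℕ} (hρ : E₁.ρ = E.ρ)
    (hF : polyEval c (E.path V hV hσ hV').F = E₁.F) :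
    (∀ a, PowerSeries.map (polyEval c) ((E.path V hV hσ hV').r a) = E₁.r a) ∧
    ∀ n a, PowerSeries.map (polyEval c)
      (word (E.path V hV hσ hV').G (E.path V hV hσ hV').x n a) = word E₁.G E₁.x n a := by
  have h1 : ∀ a, polyEval c ((E.path V hV hσ hV').ρ a) = E₁.ρ a := fun a => by
    rw [hρ]
    exact polyEval_C c (E.ρ a)
  have h2 : ∀ a, polyEval c ((E.path V hV hσ hV').d a) = E₁.d a := fun a => by
    rw [d_apply, map_sub, map_mul, map_mul, hF, h1, d_apply]
  have h3 : polyEval c (E.path V hV hσ hV').w = E₁.w := by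
    rw [w, map_sub, map_one, map_mul, hF, w]
  refine ⟨fun a => by rw [r, PowerSeries.map_C, h1, r], fun n a => ?_⟩
  rw [map_word]
  congr 1
  · ext n
    rw [PowerSeries.coeff_map, G, coeff_mk, map_pow, h3, G, coeff_mk]
  · funext a
    rw [x, PowerSeries.map_C, h2, x]

theorem charTr_derivative {E₀ E₁ : TracedModule A L} (h₀ : E₀.N = E.N) (h₁ : E₁.N = E.N)
    (h₀' : E₀.T = E.T) (h₁' : E₁.T = E.T) (k : ℕ) (f : L[X]⟦X⟧) :
    (E.path V hV hσ hV').charTr k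
      (mapCoeff (Polynomial.derivative.restrictScalars ℂ) f) =
      E₁.charTr k (PowerSeries.map (polyEval 1) f) -
        E₀.charTr k (PowerSeries.map (polyEval 0) f) := by
  have h : (E.path V hV hσ hV').N = E.N := rfl
  rw [charTr, charTr, charTr, h₀, h₁, h]
  split_ifs
  · simp only [LinearMap.smul_apply, Tr_apply, coeff_mapCoeff, PowerSeries.coeff_map, h₀', h₁']
    rw [← smul_sub, ← polyT_derivative]
    rfl
  · simp

/-- Homotopy invariance of the character. -/
theorem char_shift_sub_char (hε : E.ε = (-1) ^ (E.N + 1)) :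
    (E.shift V hV hσ hV').char - E.char ∈ periodicCoboundaries A E.N := by
  set P := E.path V hV hσ hV' with hP
  set E₁ := E.shift V hV hσ hV'
  have hC : ∀ l : L, (Polynomial.derivative.restrictScalars ℂ : L[X] →ₗ[ℂ] L[X])
    (Polynomial.C l) = 0 := fun l => Polynomial.derivative_C
  -- The derivation `d/dt` annihilates the representation and maps `F + tV` to `V`, so the
  -- transgression of `P` has the integrated derivative of the character as its boundary.
  have hD := P.wordDerivation (D := Polynomial.derivative.restrictScalars ℂ)
    (V := Polynomial.C V) (fun r s => Polynomial.derivative_mul) (fun a => hC (E.ρ a))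
    (by change Polynomial.derivative (Polynomial.C E.F + Polynomial.X * Polynomial.C V) = _
        simp)
  have hPV : (Polynomial.C V : L[X]) ∈ P.J 1 := C_mem_polySubmodule hV
  have hPσ : P.σ (Polynomial.C V) = P.ε • Polynomial.C V := by
    change Polynomial.mapAlgHom E.σ (Polynomial.C V) = E.ε • Polynomial.C V
    rw [Polynomial.coe_mapAlgHom, Polynomial.map_C, Polynomial.smul_C]
    congr 1
  have hPV' : P.F * Polynomial.C V + Polynomial.C V * P.F ∈ P.J 2 := by
    have h : P.F * Polynomial.C V + Polynomial.C V * P.F =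
        Polynomial.C (E.F * V + V * E.F) + (Polynomial.X * Polynomial.C (V * V) +
          Polynomial.X * Polynomial.C (V * V)) := by
      change (Polynomial.C E.F + Polynomial.X * Polynomial.C V) * Polynomial.C V +
        Polynomial.C V * (Polynomial.C E.F + Polynomial.X * Polynomial.C V) = _
      rw [add_mul, mul_add, X_mul_C_eq, mul_assoc, ← Polynomial.C_mul, ← Polynomial.C_mul,
        ← Polynomial.C_mul, Polynomial.C_add]
      abel
    rw [h]
    exact add_mem (C_mem_polySubmodule hV') (add_mem
      (X_mul_C_mem_polySubmodule (E.mul_mem hV hV))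
      (X_mul_C_mem_polySubmodule (E.mul_mem hV hV)))
  have h0 := map_letters (E := E) (V := V) (hV := hV) (hσ := hσ) (hV' := hV') (E₁ := E) (c := 0) rfl
    (by change polyEval 0 (Polynomial.C E.F + Polynomial.X * Polynomial.C V) = _
        rw [map_add, map_mul, polyEval_C, polyEval_X, Nat.cast_zero, zero_mul, add_zero])
  have h1 := map_letters (E := E) (V := V) (hV := hV) (hσ := hσ) (hV' := hV') (E₁ := E₁) (c := 1)
    rfl
    (by change polyEval 1 (Polynomial.C E.F + Polynomial.X * Polynomial.C V) = E.F + V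
        rw [map_add, map_mul, polyEval_C, polyEval_X, polyEval_C, Nat.cast_one, one_mul])
  refine ⟨bicomplexProj (P.α (Polynomial.C V)) (P.β (Polynomial.C V)),
    P.transgression_mem_periodicCochains _, ?_⟩
  rw [totalD_bicomplexProj, bicomplexHoch_α_β (E := P) hε hPV hPV' hPσ hD, char, char,
    ← bicomplexProj_sub]
  -- In each column the integral of the derivative is the difference of the values at `t = 1` and `t
  -- = 0`.
  refine bicomplexProj_congr (fun n => ?_) (fun n => ?_)
  · funext a
    have h2 := charTr_derivative (E := E) (V := V) (hV := hV) (hσ := hσ) (hV' := hV') (E₀ := E)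
      (E₁ := E₁) rfl rfl rfl rfl n (P.r (a 0) * word P.G P.x n (Fin.tail a))
    rw [map_mul (PowerSeries.map _), map_mul (PowerSeries.map _), h0.1, h1.1, h0.2, h1.2, hD.leibniz,
      r, mapCoeff_C, show P.ρ (a 0) = Polynomial.C (E.ρ (a 0)) from rfl, hC, map_zero, zero_mul,
      zero_add] at h2
    exact h2
  · rw [bicomplexBar_α_β (E := P) hε hPV hPV' hD]
    funext a
    have h2 := charTr_derivative (E := E) (V := V) (hV := hV) (hσ := hσ) (hV' := hV') (E₀ := E)
      (E₁ := E₁) rfl rfl rfl rfl (n + 2) (word P.G P.x (n + 2) a)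
    rw [h0.2, h1.2] at h2
    exact h2

end Homotopy

end TracedModule

end CyclicCharacter

end

/-! ### Modules with `F² = 1` and Connes' periodicity. -/

noncomputable section

namespace CyclicCharacter

open PowerSeries

section General

variable {A : Type*}

/-- The component of degree `N` of a family of cochains. -/
def cut (N : ℕ) (c : CochainFamily A) : CochainFamily A := fun n => if n = N then c n else 0

theorem cut_self (N : ℕ) (c : CochainFamily A) : cut N c N = c N := if_pos rfl

theorem cut_of_ne {N n : ℕ} (h : n ≠ N) (c : CochainFamily A) : cut N c n = 0 := if_neg h

theorem cut_smul (N : ℕ) (k : ℂ) (c : CochainFamily A) : cut N (k • c) = k • cut N c := by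
  funext n
  rw [Pi.smul_apply, cut, cut]
  split_ifs
  · rfl
  · rw [smul_zero]

theorem cycNorm_of_cyc {n : ℕ} {φ : Functionals A n} (h : cyc n φ = φ) :
    cycNorm n φ = ((n : ℂ) + 1) • φ := by
  have h1 : ∀ j : ℕ, (cyc n ^ j) φ = φ := fun j => by
    induction j with
    | zero => rfl
    | succ j ih => rw [pow_succ, Module.End.mul_apply, h, ih]
  rw [cycNorm_eq_sum_cyc, LinearMap.sum_apply, Finset.sum_congr rfl fun j _ => h1 j,
    Finset.sum_const, Finset.card_range, ← Nat.cast_smul_eq_nsmul ℂ]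
  push_cast
  rfl

section

variable [Ring A]

theorem hochschildb_smul {n : ℕ} (c : ℂ) (φ : Functionals A n) :
    hochschildb n (c • φ) = c • hochschildb n φ := by
  simp only [hochschildb_eq_sum, map_smul, Finset.smul_sum]

theorem hochschildb_zero (n : ℕ) : hochschildb n (0 : Functionals A n) = 0 := by
  simpa using hochschildb_smul 0 (0 : Functionals A n)

theorem barD_zero (n : ℕ) : barD (0 : Functionals A n) = 0 := by
  funext a
  simp [barD]

theorem bicomplexProj_of_cyc {α : CochainFamily A} (h : ∀ n, cyc (n + 1) (α (n + 1)) = α (n + 1)) :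
    bicomplexProj α 0 = α := by
  funext n
  rw [bicomplexProj, connesB₀_of_cyc (h _)]
  simp

theorem bicomplexProj_of_connesB₀ {α β : CochainFamily A}
    (h : ∀ n, β (n + 1) = connesB₀ (n + 1) (α (n + 2))) : bicomplexProj α β = α := by
  funext n
  rw [bicomplexProj, h]
  simp

end

theorem word_snoc {R : Type*} [Ring R] (G : R) (x : A → R) : ∀ (n : ℕ) (a : Fin (n + 1) → A),
    word G x (n + 1) a = word G x n (Fin.init a) * x (a (Fin.last n)) * G
  | 0, a => by rw [word, word, word]; rfl
  | n + 1, a => by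
    rw [word, word_snoc G x n, word, Fin.tail_init_eq_init_tail]
    simp only [mul_assoc]
    rfl

end General

namespace TracedModule

variable {A L : Type*} [Ring A] [Algebra ℂ A] [Ring L] [Algebra ℂ L] {E : TracedModule A L}

/-- If `F` commutes with the projection `1 ∈ A`, then the character has the expected components. -/
theorem char_of_comm (h : E.F * E.ρ 1 = E.ρ 1 * E.F) : E.char = E.φ := by
  refine bicomplexProj_of_connesB₀ fun n => ?_
  -- The representation need not be unital. From `[F, 1] = 0` the values `φ(…, 1)` vanish, and
  -- `ρ(1)[F, b] = [F, b]` gives `φ(1, …) = ψ`; hence `B₀ φ = ψ` and the correction in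
  -- `bicomplexProj` disappears.
  have hd : E.d 1 = 0 := by rw [d_apply, h, sub_self]
  have hx : E.x 1 = 0 := by rw [x, hd, map_zero]
  have hG : C (E.ρ 1) * E.G = E.G * C (E.ρ 1) := by
    refine E.C_mul_G_of_commute ?_
    rw [Commute, SemiconjBy, w, mul_sub, sub_mul, mul_one, one_mul, ← mul_assoc, ← h, mul_assoc, ← h,
      mul_assoc]
  have h1 : ∀ b, E.ρ 1 * E.d b = E.d b := fun b => by
    rw [d_apply, mul_sub, ← mul_assoc, ← h, mul_assoc, ← mul_assoc (E.ρ 1) (E.ρ b), ← map_mul,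
      one_mul]
  funext a
  rw [connesB₀, φ, φ, Fin.cons_zero, Fin.tail_cons]
  have h2 : Fin.tail (Fin.snoc (α := fun _ => A) a 1) =
      (Fin.snoc (α := fun _ => A) (Fin.tail a) 1 : Fin (n + 2) → A) := by
    funext i
    refine Fin.lastCases ?_ (fun i => ?_) i
    · rw [Fin.tail, Fin.succ_last, Fin.snoc_last, Fin.snoc_last]
    · rw [Fin.tail, Fin.succ_castSucc, Fin.snoc_castSucc, Fin.snoc_castSucc, Fin.tail]
  rw [h2, word_snoc _ _ _ (Fin.snoc (α := fun _ => A) (Fin.tail a) 1), Fin.snoc_last, hx, mul_zero,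
    zero_mul, mul_zero, map_zero, mul_zero, sub_zero, word, ← mul_assoc, ← mul_assoc, r, hG, mul_assoc E.G, x, ← map_mul, h1]
  rfl

/-! ### Modules with `F² = 1` -/

variable (E)

/-- The functional `T(a₀ [F, a₁] ⋯ [F, aₙ])`. -/
def top : CochainFamily A := fun n a => E.T (E.ρ (a 0) * word 1 E.d n (Fin.tail a))

/-- The functional `T(F [F, a₀] ⋯ [F, aₙ])`. -/
def conn : CochainFamily A := fun n a => E.T (E.F * word 1 E.d (n + 1) a)

/-- The functional `T(a₀ F [F, a₁] ⋯ [F, aₙ])`. -/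
def mid : CochainFamily A := fun n a => E.T (E.ρ (a 0) * (E.F * word 1 E.d n (Fin.tail a)))

variable {E}

theorem word_mem : ∀ (n : ℕ) (a : Fin n → A), word 1 E.d n a ∈ E.J n
  | 0, _ => E.mem_zero _
  | n + 1, a => by
    rw [word, one_mul]
    have h := E.mul_mem (E.d_mem (a 0)) (word_mem n (Fin.tail a))
    rwa [show E.J (1 + n) = E.J (n + 1) by rw [add_comm]] at h

theorem wordRelations_one : WordRelations E.ρ E.F 1 0 E.d where
  map_mul := E.d_mul
  central := by simp
  comm := by simp
  resolvent := by simp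

section Square

variable (hF : E.F * E.F = 1)

include hF

theorem F_mul_d (a : A) : E.F * E.d a = -(E.d a * E.F) := by
  rw [d_apply, mul_sub, sub_mul, ← mul_assoc, hF, mul_assoc (E.ρ a) E.F, hF]
  noncomm_ring

theorem F_mul_word : ∀ (n : ℕ) (a : Fin n → A),
    E.F * word 1 E.d n a = (-1 : ℂ) ^ n • (word 1 E.d n a * E.F)
  | 0, _ => by rw [word, pow_zero, one_smul, mul_one, one_mul]
  | n + 1, a => by
    rw [word, one_mul, ← mul_assoc, F_mul_d hF, neg_mul, mul_assoc, F_mul_word n, pow_succ,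
      mul_neg_one, neg_smul, mul_smul_comm, mul_assoc]

/-- The product is the supercommutator of `F` with `a₀[F, a₁] ⋯ [F, aₙ]`, since `F` anticommutes
with every `[F, a]`. -/
theorem T_word {n : ℕ} (hN : E.N ≤ n + 1) (hε : E.ε = (-1) ^ n) (a : Fin (n + 1) → A) :
    E.T (word 1 E.d (n + 1) a) = 0 := by
  have h : word 1 E.d (n + 1) a = E.F * (E.ρ (a 0) * word 1 E.d n (Fin.tail a)) -
      E.ε • (E.ρ (a 0) * word 1 E.d n (Fin.tail a) * E.F) := by
    rw [hε, mul_assoc (E.ρ (a 0)), ← mul_smul_comm, ← F_mul_word hF, word, one_mul, d_apply]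
    noncomm_ring
  have h1 := E.anti hN (word_mem (n + 1) a)
  rw [h] at h1 ⊢
  exact E.T_supercommutator (E.mul_mem_left _ (word_mem n _)) (by omega) h1

theorem w_eq_zero : E.w = 0 := by rw [w, hF, sub_self]

theorem word_G (n : ℕ) (a : Fin n → A) : word E.G E.x n a = C (word 1 E.d n a) := by
  have hG : E.G = C 1 := by
    ext n
    rw [G, coeff_mk, w_eq_zero hF, coeff_C]
    split_ifs with h
    · rw [h, pow_zero]
    · rw [zero_pow h]
  rw [map_word, hG]
  rfl

omit hF in
theorem charTr_C {k : ℕ} (l : L) :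
    E.charTr k (C l) = if k = E.N then (E.N.factorial : ℂ)⁻¹ * E.T l else 0 := by
  split_ifs with h
  · subst h
    rw [E.charTr_of_eq (r := 0) (by omega), LinearMap.smul_apply, Tr_apply, coeff_zero_C,
      smul_eq_mul, zero_add]
  · rcases E.charTr_cases k with ⟨r, hr⟩ | h'
    · rw [E.charTr_of_eq hr, LinearMap.smul_apply, Tr_apply, coeff_C, if_neg (by omega), map_zero,
        smul_zero]
    · rw [h'.1]; rfl

theorem φ_of_sq : E.φ = cut E.N ((E.N.factorial : ℂ)⁻¹ • E.top) := by
  funext n a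
  rw [φ, word_G hF, r, ← map_mul, charTr_C, cut]
  split_ifs
  · rfl
  · rfl

theorem ψ_of_sq (hε : E.ε = (-1) ^ (E.N + 1)) : E.ψ = 0 := by
  funext n a
  rw [ψ, word_G hF, charTr_C]
  split_ifs with h
  · rw [T_word hF h.ge (by rw [hε, ← h, pow_succ, pow_succ]; ring), mul_zero]
    rfl
  · rfl

/-- Now `G = 1`, so only the coefficient of `z⁰` survives and only in degree `N`. Since `ψ = 0`, the
cocycle equation `(1 - λ)φ = b'ψ` makes `φ` cyclic in positive degrees, and the projection does not
change it. -/
theorem char_of_sq (hε : E.ε = (-1) ^ (E.N + 1)) :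
    E.char = cut E.N ((E.N.factorial : ℂ)⁻¹ • E.top) := by
  have h := bicomplexBar_φ_ψ hε
  rw [char, ψ_of_sq hF hε, bicomplexProj_of_cyc, φ_of_sq hF]
  intro n
  have h1 := congrFun h (n + 1)
  rw [ψ_of_sq hF hε] at h1
  rw [bicomplexBar, Pi.zero_apply, barD_zero, sub_zero, Pi.zero_apply, sub_eq_zero] at h1
  exact h1.symm

/-- Expand `[F, a₀]`: rotating one `F` in `T(F a₀ F D)` turns it into `-T(a₀ D)`. This needs `N ≤
n`, whereas the cyclicity of `conn` holds already for `N ≤ n + 1`. -/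
theorem conn_eq_two_mul_top {n : ℕ} (hN : E.N ≤ n) (hε : E.ε = (-1) ^ (n + 1)) :
    E.conn n = (2 : ℂ) • E.top n := by
  funext a
  set D := word 1 E.d n (Fin.tail a)
  have h : E.F * word 1 E.d (n + 1) a =
      E.ρ (a 0) * D - E.F * (E.ρ (a 0) * (E.F * D)) := by
    rw [word, one_mul, d_apply, sub_mul, mul_sub, mul_assoc E.F, ← mul_assoc E.F E.F, hF, one_mul]
    simp only [mul_assoc]
    rfl
  have hm : E.ρ (a 0) * (E.F * D) ∈ E.J n :=
    E.mul_mem_left _ (E.mul_mem_left _ (word_mem n _))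
  have h1 := E.cyclic hm (E.mem_zero E.F) hN
  have h2 : E.ρ (a 0) * (E.F * D) * E.F = (-1 : ℂ) ^ n • (E.ρ (a 0) * D) := by
    rw [F_mul_word hF, mul_smul_comm, smul_mul_assoc, ← mul_assoc, mul_assoc, hF, mul_one]
  rw [h2, E.σ_F, smul_mul_assoc, map_smul, map_smul, smul_eq_mul, smul_eq_mul, hε, pow_succ] at h1
  have h3 : (-1 : ℂ) ^ n * (-1) ^ n = 1 := by rw [← mul_pow]; norm_num
  rw [conn, h, map_sub, Pi.smul_apply, top, smul_eq_mul]
  linear_combination (-(-1 : ℂ) ^ n) * h1 + (E.T (E.ρ (a 0) * D) + E.T (E.F * (E.ρ (a 0) * (E.F * D)))) * h3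

variable {n : ℕ} (hN : E.N ≤ n + 1) (hε : E.ε = (-1) ^ (n + 1))

include hN hε

theorem cyc_conn : cyc n (E.conn n) = E.conn n := by
  funext a
  set D := word 1 E.d n (Fin.init a)
  have hm : E.F * D ∈ E.J n := E.mul_mem_left _ (word_mem n _)
  have h1 := E.cyclic hm (E.d_mem (a (Fin.last n))) hN
  rw [E.σ_d, smul_mul_assoc, map_smul, smul_eq_mul, hε, mul_assoc, ← mul_assoc (E.d _),
    ← neg_eq_iff_eq_neg.2 (F_mul_d hF _), pow_succ] at h1
  have e1 : word 1 E.d (n + 1) (Fin.cons (a (Fin.last n)) (Fin.init a)) =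
      E.d (a (Fin.last n)) * D := by
    rw [word, Fin.cons_zero, Fin.tail_cons, one_mul]
  have e2 : word 1 E.d (n + 1) a = D * E.d (a (Fin.last n)) := by rw [word_snoc, mul_one]
  rw [cyc_apply, conn, conn, e1, e2, h1, neg_mul, map_neg, mul_assoc E.F]
  ring

/-- The two end terms of the bar differential of `conn` are the two terms on the left. In the first
one `F a₀` may be replaced by `a₀ F`, the difference being zero by `T_word`. -/
theorem mid_sub_cyc : E.mid (n + 1) - cyc (n + 1) (E.mid (n + 1)) = barD (E.conn n) := by
  funext a
  have h1 : barD (E.conn n) a = E.T (E.F * barD (word 1 E.d (n + 1)) a) := by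
    rw [← barD_mul_left, ← barD_comp]
    rfl
  have h2 := T_word hF (n := n + 1) (by omega) hε a
  have hm : E.F * word 1 E.d (n + 1) (Fin.init a) ∈ E.J (n + 1) :=
    E.mul_mem_left _ (word_mem (n + 1) _)
  have h3 := E.cyclic hm (E.mem_zero (E.ρ (a (Fin.last (n + 1))))) hN
  rw [E.σ_ρ, mul_assoc] at h3
  rw [word, one_mul, d_apply, sub_mul, map_sub] at h2
  rw [Pi.sub_apply, cyc_apply, h1, wordRelations_one.barD_word, wordBar, zero_mul, sub_zero,
    mid, mid, Fin.cons_zero, Fin.tail_cons, mul_sub, map_sub, mul_smul_comm, map_smul, h3,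
    smul_eq_mul]
  simp only [mul_assoc] at h2 ⊢
  linear_combination -h2

/-- `b N = N b'` and the previous lemma give `b N conn = N(1 - λ) mid = 0`, and `N` acts on the
cyclic functional `conn` as `n + 1`. -/
theorem hochschildb_conn : hochschildb n (E.conn n) = 0 := by
  have h2 := hochschildb_cycNorm (E.conn n)
  rw [← mid_sub_cyc hF hN hε, map_sub, ← Module.End.mul_apply (cycNorm (n + 1)), cycNorm_mul_cyc,
    sub_self, cycNorm_of_cyc (cyc_conn hF hN hε), hochschildb_smul] at h2
  exact (smul_eq_zero.1 h2).resolve_left (Nat.cast_add_one_ne_zero n)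

-- The bar faces telescope to `T(a₀ D aₙ₊₂ F)` and the wrapping face gives `T(a₀ D F aₙ₊₂)` with the
-- opposite sign. Together they form the last commutator of `-top`.
omit hε in
theorem hochschildb_mid : hochschildb (n + 1) (E.mid (n + 1)) = -E.top (n + 2) := by
  funext a
  have hR := wordRelations_one (E := E)
  have e3 : (Fin.tail a) (Fin.last (n + 1)) = a (Fin.last (n + 2)) := rfl
  have h0 : E.mid (n + 1) = fun v => (-1 : ℂ) ^ (n + 1) •
      E.T (E.ρ (v 0) * word 1 E.d (n + 1) (Fin.tail v) * E.F) := by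
    funext v
    rw [mid, F_mul_word hF, mul_smul_comm, map_smul, mul_assoc]
  have h1 : barD (fun v : Fin (n + 2) → A => E.ρ (v 0) * word 1 E.d (n + 1) (Fin.tail v)) a =
      E.ρ (a 0 * a 1) * word 1 E.d (n + 1) (Fin.tail (Fin.tail a)) -
        E.ρ (a 0) * wordBar E.ρ E.F 1 0 E.d (n + 1) (Fin.tail a) := by
    rw [barD_succ, ← hR.barD_word, ← barD_mul_left]
    rfl
  set s : ℂ := (-1) ^ (n + 1) with hs
  have hs2 : s * s = 1 := by rw [hs, ← mul_pow]; norm_num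
  set D := word 1 E.d (n + 1) (Fin.init (Fin.tail a)) with hDdef
  have h2 : barD (E.mid (n + 1)) a = E.T (E.ρ (a 0) * (D * (E.ρ (a (Fin.last (n + 2))) * E.F))) := by
    have h4 : barD (E.mid (n + 1)) a = (s • E.T ∘ₗ LinearMap.mulRight ℂ E.F) (barD
        (fun v : Fin (n + 2) → A => E.ρ (v 0) * word 1 E.d (n + 1) (Fin.tail v)) a) := by
      rw [← barD_comp, h0]
      rfl
    have h5 : barD (fun v : Fin (n + 2) → A => E.ρ (v 0) * word 1 E.d (n + 1) (Fin.tail v)) a =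
        s • (E.ρ (a 0) * (D * E.ρ (a (Fin.last (n + 2))))) := by
      rw [h1, wordBar, zero_mul, sub_zero, map_mul, e3, ← hs, ← hDdef, mul_sub, mul_smul_comm,
        ← mul_assoc (E.ρ (a 0))]
      exact sub_sub_cancel _ _
    rw [h4, h5, map_smul, LinearMap.smul_apply, smul_smul, hs2, one_smul, LinearMap.comp_apply,
      LinearMap.mulRight_apply]
    simp only [mul_assoc]
  have hm : E.ρ (a 0) * (D * E.F) ∈ E.J (n + 1) :=
    E.mul_mem_left _ (E.mul_mem_right _ (word_mem (n + 1) _))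
  have h3 := E.cyclic hm (E.mem_zero (E.ρ (a (Fin.last (n + 2))))) hN
  rw [E.σ_ρ] at h3
  have h6 : word 1 E.d (n + 2) (Fin.tail a) = D * E.d (a (Fin.last (n + 2))) := by
    rw [word_snoc, mul_one]
    rfl
  rw [hochschildb_eq_barD, h2, h0]
  beta_reduce
  rw [Fin.cons_zero, Fin.tail_cons, map_mul E.ρ, Pi.neg_apply, top, h6,
    d_apply, Fin.tail_init_eq_init_tail, ← hDdef, pow_succ, ← hs, smul_eq_mul]
  simp only [mul_assoc, mul_sub, map_sub] at h3 ⊢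
  rw [← h3]
  linear_combination -(E.T (E.ρ (a 0) * (D * (E.F * E.ρ (a (Fin.last (n + 2))))))) * hs2

theorem cyc_top : cyc (n + 2) (E.top (n + 2)) = E.top (n + 2) := by
  have hε' : E.ε = (-1) ^ (n + 2 + 1) := by rw [hε]; ring
  have h := cyc_conn hF (n := n + 2) (by omega) hε'
  rw [conn_eq_two_mul_top hF (by omega) hε', map_smul] at h
  exact smul_right_injective _ two_ne_zero h

theorem bicomplexHoch_mid_conn : bicomplexHoch (cut (n + 1) E.mid) (cut n E.conn) =
    ((n : ℂ) + 1) • cut n E.conn - cut (n + 2) E.top := by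
  have h : ∀ k, cycNorm k (cut n E.conn k) = ((n : ℂ) + 1) • cut n E.conn k := fun k => by
    by_cases hk : k = n
    · subst hk
      rw [cut_self, cycNorm_of_cyc (cyc_conn hF hN hε)]
    · rw [cut_of_ne hk, map_zero, smul_zero]
  funext k
  rw [Pi.sub_apply, Pi.smul_apply]
  rcases k with _ | k
  · rw [bicomplexHoch, h, cut_of_ne (N := n + 2) (by omega), sub_zero]
  · rw [bicomplexHoch, h]
    by_cases hk : k = n + 1
    · subst hk
      rw [cut_self, cut_self, hochschildb_mid hF hN]
      abel
    · rw [cut_of_ne hk, cut_of_ne (N := n + 2) (by omega), hochschildb_zero]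
      abel

theorem bicomplexBar_mid_conn : bicomplexBar (cut (n + 1) E.mid) (cut n E.conn) = 0 := by
  funext k
  rcases k with _ | k
  · rfl
  · rw [bicomplexBar]
    by_cases hk : k = n
    · subst hk
      rw [cut_self, cut_self, mid_sub_cyc hF hN hε, sub_self]
      rfl
    · rw [cut_of_ne hk, cut_of_ne (N := n + 1) (by omega), map_zero, barD_zero]
      simp

omit hF hN hε in
theorem isMultilinearMap_cut {c : CochainFamily A} (k : ℕ) (h : ∀ n, IsMultilinearMap (c n)) (n : ℕ) :
    IsMultilinearMap (cut k c n) := by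
  rw [cut]
  split_ifs
  · exact h n
  · exact isMultilinearMap_zero

omit hF hN hε in
theorem isMultilinearMap_conn (n : ℕ) : IsMultilinearMap (E.conn n) :=
  (isMultilinearMap_word 1 E.d (n + 1)).comp (E.T ∘ₗ LinearMap.mulLeft ℂ E.F)

omit hF hN hε in
theorem isMultilinearMap_mid (n : ℕ) : IsMultilinearMap (E.mid n) :=
  (((isMultilinearMap_word 1 E.d n).comp (LinearMap.mulLeft ℂ E.F)).cons_mul
    (E.ρ : A →ₗ[ℂ] L)).comp E.T

/-- The periodicity relation between the characters of a module with `F² = 1` in the degrees `n`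
and `n + 2`. -/
theorem periodicity :
    ((n : ℂ) + 1) • cut n E.conn - cut (n + 2) E.top ∈ periodicCoboundaries A n := by
  -- For the pair `(mid, conn)` the bar part of the differential cancels by `mid_sub_cyc`; the
  -- Hochschild part is `N conn + b mid = (n + 1) conn - top`.
  refine ⟨bicomplexProj (cut (n + 1) E.mid) (cut n E.conn), ?_, ?_⟩
  · refine bicomplexProj_mem (K := n + 1) (isMultilinearMap_cut _ isMultilinearMap_mid)
      (isMultilinearMap_cut _ isMultilinearMap_conn) (fun k hk => ?_) (fun k hk => ?_)
      (fun k hk => cut_of_ne (by omega) _) (fun k hk => cut_of_ne (by omega) _)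
    · refine cut_of_ne ?_ _
      rintro rfl
      exact hk (by push_cast; rfl)
    · refine cut_of_ne ?_ _
      rintro rfl
      have key : ∀ x : ZMod 2, x ≠ x + 1 := by decide
      exact key _ hk
  · rw [totalD_bicomplexProj, bicomplexHoch_mid_conn hF hN hε, bicomplexBar_mid_conn hF hN hε,
      bicomplexProj_of_cyc]
    intro k
    rw [Pi.sub_apply, Pi.smul_apply, map_sub, map_smul]
    congr 1
    · by_cases hk : k + 1 = n
      · subst hk
        rw [cut_self, cyc_conn hF hN hε]
      · rw [cut_of_ne hk, map_zero]
    · by_cases hk : k + 1 = n + 2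
      · obtain rfl : k = n + 1 := by omega
        rw [cut_self, cyc_top hF hN hε]
      · rw [cut_of_ne hk, map_zero]

theorem cut_conn_mem_periodicCocycles : cut n E.conn ∈ periodicCocycles A n := by
  refine ⟨⟨isMultilinearMap_cut _ isMultilinearMap_conn, fun k hk => cut_of_ne ?_ _, n,
    fun k hk => cut_of_ne (by omega) _⟩, ?_⟩
  · rintro rfl
    exact hk rfl
  have h : ∀ k, cyc k (cut n E.conn k) = cut n E.conn k := fun k => by
    by_cases hk : k = n
    · subst hk
      rw [cut_self, cyc_conn hF hN hε]
    · rw [cut_of_ne hk, map_zero]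
  have h1 : bicomplexHoch (cut n E.conn) 0 = 0 := by
    funext k
    rcases k with _ | k
    · rw [bicomplexHoch, Pi.zero_apply, map_zero]
    · rw [bicomplexHoch, Pi.zero_apply, map_zero, add_zero]
      by_cases hk : k = n
      · subst hk
        rw [cut_self, hochschildb_conn hF hN hε]
      · rw [cut_of_ne hk, hochschildb_zero]
  have h2 : bicomplexBar (cut n E.conn) 0 = 0 := by
    funext k
    rcases k with _ | k
    · rfl
    · rw [bicomplexBar, h, Pi.zero_apply, barD_zero]
      simp
  change totalD A (cut n E.conn) = 0
  rw [← bicomplexProj_of_cyc (fun k => h (k + 1)), totalD_bicomplexProj, h1, h2, bicomplexProj_zero]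

end Square

end TracedModule

end CyclicCharacter

end

/-! ### Normalizing constants, comparison of the characters, coefficients of words. -/

noncomputable section

namespace CyclicCharacter

open PowerSeries

namespace TracedModule

variable {A L : Type*} [Ring A] [Algebra ℂ A] [Ring L] [Algebra ℂ L] (E : TracedModule A L)

/-- The same module with a larger degree of summability. -/
def withN (N : ℕ) (h : E.N ≤ N) : TracedModule A L :=
  { E with
    N := N
    cyclic := fun hx hy hab => E.cyclic hx hy (h.trans hab) }

/-- The normalizing constants `c Γ(n / 2 + 1) / n!`. -/
def kappa (c : ℂ) (n : ℕ) : ℂ := c * (Real.Gamma ((n : ℝ) / 2 + 1) : ℂ) / (n.factorial : ℂ)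

/-- `periodicity` and `conn = 2 top` make `2(n + 1) conn n` cohomologous to `conn (n + 2)`. The
recursion therefore makes the class of `kappa c n • conn n` independent of `n` within its parity. -/
theorem kappa_eq (c : ℂ) (n : ℕ) : kappa c n = 2 * ((n : ℂ) + 1) * kappa c (n + 2) := by
  have h1 : Real.Gamma (((n + 2 : ℕ) : ℝ) / 2 + 1) =
      ((n : ℝ) / 2 + 1) * Real.Gamma ((n : ℝ) / 2 + 1) := by
    rw [← Real.Gamma_add_one (by positivity)]
    congr 1
    push_cast
    ring
  have h2 : ((n + 2).factorial : ℂ) = ((n : ℂ) + 2) * (((n : ℂ) + 1) * (n.factorial : ℂ)) := by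
    rw [Nat.factorial_succ, Nat.factorial_succ]
    push_cast
    ring
  have h3 : (n.factorial : ℂ) ≠ 0 := Nat.cast_ne_zero.2 n.factorial_ne_zero
  have h4 : (n : ℂ) + 1 ≠ 0 := Nat.cast_add_one_ne_zero n
  have h5 : (n : ℂ) + 2 ≠ 0 := by exact_mod_cast (Nat.succ_ne_zero (n + 1))
  rw [kappa, kappa, h1, h2]
  push_cast
  field_simp

variable {E} {V : L} {hV : V ∈ E.J 1} {hσ : E.σ V = E.ε • V} {hV' : E.F * V + V * E.F ∈ E.J 2}

theorem cast_add_two (n : ℕ) : ((n + 2 : ℕ) : ZMod 2) = n := by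
  push_cast
  have : (2 : ZMod 2) = 0 := rfl
  rw [this, add_zero]

theorem cast_add_two_mul (n j : ℕ) : ((n + 2 * j : ℕ) : ZMod 2) = n := by
  induction j with
  | zero => rfl
  | succ j ih => rw [mul_add, ← add_assoc, mul_one, cast_add_two, ih]

theorem kappa_conn_sub {E₁ : TracedModule A L} (hF : E₁.F * E₁.F = 1) (c : ℂ) {n : ℕ}
    (hN : E₁.N ≤ n + 1) (hε : E₁.ε = (-1) ^ (n + 1)) (j : ℕ) :
    kappa c n • cut n E₁.conn - kappa c (n + 2 * j) • cut (n + 2 * j) E₁.conn ∈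
      periodicCoboundaries A n := by
  induction j with
  | zero => rw [mul_zero, add_zero, sub_self]; exact zero_mem _
  | succ j ih =>
    have hε' : E₁.ε = (-1) ^ (n + 2 * j + 1) := by
      rw [hε, add_right_comm, pow_add _ (n + 1), pow_mul]; norm_num
    have h1 := periodicity hF (n := n + 2 * j) (by omega) hε'
    rw [cast_add_two_mul] at h1
    have hcut : ∀ M, E₁.conn M = (2 : ℂ) • E₁.top M → cut M E₁.conn = (2 : ℂ) • cut M E₁.top := by
      intro M hM
      funext k
      rw [Pi.smul_apply, cut, cut]
      split_ifs with hk
      · rw [hk, hM]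
      · rw [smul_zero]
    have h2 := hcut (n + 2 * j + 2)
      (conn_eq_two_mul_top hF (by omega) (by rw [hε']; ring))
    have h3 : kappa c n • cut n E₁.conn - kappa c (n + 2 * (j + 1)) • cut (n + 2 * (j + 1)) E₁.conn =
        (kappa c n • cut n E₁.conn - kappa c (n + 2 * j) • cut (n + 2 * j) E₁.conn) +
          (2 * kappa c (n + 2 * j + 2)) • (((n + 2 * j : ℕ) + 1 : ℂ) • cut (n + 2 * j) E₁.conn -
            cut (n + 2 * j + 2) E₁.top) := by
      rw [kappa_eq c (n + 2 * j), show n + 2 * (j + 1) = n + 2 * j + 2 by ring, h2]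
      module
    rw [h3]
    exact add_mem ih (Submodule.smul_mem _ _ h1)

/-- The character of a module, and the character of a perturbation of square one, are cohomologous
up to normalization, in all degrees in which they are defined. -/
theorem char_sub_conn (hF : (E.F + V) * (E.F + V) = 1) (hρ : E.F * E.ρ 1 = E.ρ 1 * E.F) (c : ℂ)
    {N n : ℕ} (hN : E.N ≤ N) (hn : E.N ≤ n + 1) (hεN : E.ε = (-1) ^ (N + 1))
    (hNn : (N : ZMod 2) = n) :
    ((kappa c N * N.factorial) • (E.withN N hN).φ -
      (kappa c n / 2) • cut n (E.shift V hV hσ hV').conn ∈ periodicCoboundaries A N) ∧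
    (kappa c N * N.factorial) • (E.withN N hN).φ ∈ periodicCocycles A N ∧
    (kappa c n / 2) • cut n (E.shift V hV hσ hV').conn ∈ periodicCocycles A N := by
  set E₁ := E.shift V hV hσ hV' with hE₁
  set E' := E.withN N hN
  have hF₁ : E₁.F * E₁.F = 1 := hF
  have hpar : N % 2 = n % 2 := by
    rwa [ZMod.natCast_eq_natCast_iff'] at hNn
  have hεn : E.ε = (-1) ^ (n + 1) := by
    rw [hεN]
    exact neg_one_pow_congr (by rw [Nat.even_add_one, Nat.even_add_one, Nat.even_iff, Nat.even_iff, hpar])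
  have hchar : E'.char = E'.φ := char_of_comm (E := E') hρ
  -- The homotopy is applied in degree `N`, where the endpoint is `top / N!`, that is half of `conn
  -- / N!`. The passage from `N` to `n` is made afterwards, for the module of square one alone.
  have h1 : (E'.shift V hV hσ hV').char - E'.char ∈ periodicCoboundaries A N :=
    char_shift_sub_char (E := E') hεN
  have h2 : (E'.shift V hV hσ hV').char = cut N ((N.factorial : ℂ)⁻¹ • E₁.top) :=
    char_of_sq (E := E'.shift V hV hσ hV') hF hεN
  have hcut : cut N E₁.conn = (2 : ℂ) • cut N E₁.top := by
    rw [← cut_smul]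
    funext k
    rw [cut, cut]
    split_ifs with hk
    · rw [hk, Pi.smul_apply, conn_eq_two_mul_top hF₁ (show E₁.N ≤ N from hN) hεN]
    · rfl
  have h3 : (kappa c N * N.factorial) • E'.φ - (kappa c N / 2) • cut N E₁.conn ∈
      periodicCoboundaries A N := by
    have h4 : (kappa c N * N.factorial) • E'.φ - (kappa c N / 2) • cut N E₁.conn =
        (-(kappa c N * N.factorial)) • ((E'.shift V hV hσ hV').char - E'.char) := by
      have h5 : (N.factorial : ℂ) ≠ 0 := Nat.cast_ne_zero.2 N.factorial_ne_zero
      rw [hchar, h2, cut_smul, hcut, neg_smul, smul_sub, smul_smul, smul_smul, mul_assoc,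
        mul_inv_cancel₀ h5, mul_one, div_mul_cancel₀ _ two_ne_zero]
      abel
    rw [h4]
    exact Submodule.smul_mem _ _ h1
  have h6 : (kappa c N / 2) • cut N E₁.conn - (kappa c n / 2) • cut n E₁.conn ∈
      periodicCoboundaries A N := by
    have key : ∀ k l : ℕ, (kappa c k / 2) • cut k E₁.conn - (kappa c l / 2) • cut l E₁.conn =
        (1 / 2 : ℂ) • (kappa c k • cut k E₁.conn - kappa c l • cut l E₁.conn) := fun k l => by
      module
    rw [key]
    refine Submodule.smul_mem _ _ ?_
    -- Both directions are needed: in the degree `n` one only has `E.N ≤ n + 1`, and `n` may be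
    -- smaller or larger than `N`.
    rcases le_total n N with h | h
    · obtain ⟨j, rfl⟩ : ∃ j, N = n + 2 * j := ⟨(N - n) / 2, by omega⟩
      have := kappa_conn_sub hF₁ c (show E₁.N ≤ n + 1 from hn) hεn j
      rw [hNn, ← neg_sub]
      exact neg_mem this
    · obtain ⟨j, rfl⟩ : ∃ j, n = N + 2 * j := ⟨(n - N) / 2, by omega⟩
      exact kappa_conn_sub hF₁ c (show E₁.N ≤ N + 1 from hN.trans (Nat.le_succ N)) hεN j
  refine ⟨by simpa using add_mem h3 h6, Submodule.smul_mem _ _ ?_, Submodule.smul_mem _ _ ?_⟩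
  · rw [← hchar]
    exact E'.char_mem_periodicCocycles hεN
  · rw [hNn]
    exact cut_conn_mem_periodicCocycles hF₁ hn hεn

/-! ### Coefficients of words -/

theorem sum_antidiagonalTuple_succ {M : Type*} [AddCommMonoid M] (k n : ℕ)
    (f : (Fin (k + 1) → ℕ) → M) :
    ∑ i ∈ Finset.Nat.antidiagonalTuple (k + 1) n, f i =
      ∑ q ∈ Finset.HasAntidiagonal.antidiagonal n, ∑ i ∈ Finset.Nat.antidiagonalTuple k q.2, f (Fin.cons q.1 i) := by
  rw [Finset.sum_sigma']
  refine Finset.sum_bij' (fun i _ => ⟨(i 0, ∑ j, i (Fin.succ j)), Fin.tail i⟩)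
    (fun q _ => Fin.cons q.1.1 q.2) ?_ ?_ ?_ ?_ ?_
  · intro i hi
    rw [Finset.Nat.mem_antidiagonalTuple, Fin.sum_univ_succ] at hi
    rw [Finset.mem_sigma, Finset.HasAntidiagonal.mem_antidiagonal, Finset.Nat.mem_antidiagonalTuple]
    exact ⟨hi, rfl⟩
  · rintro ⟨⟨s, t⟩, i⟩ hi
    rw [Finset.mem_sigma, Finset.HasAntidiagonal.mem_antidiagonal, Finset.Nat.mem_antidiagonalTuple] at hi
    rw [Finset.Nat.mem_antidiagonalTuple, Fin.sum_univ_succ]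
    simp only [Fin.cons_zero, Fin.cons_succ]
    rw [hi.2]
    exact hi.1
  · intro i _
    exact Fin.cons_self_tail i
  · rintro ⟨⟨s, t⟩, i⟩ hi
    rw [Finset.mem_sigma, Finset.Nat.mem_antidiagonalTuple] at hi
    obtain ⟨_, h2⟩ := hi
    simp only at h2
    subst h2
    simp
  · intro i _
    rw [Fin.cons_self_tail]

/-- The product `w^{i₀} d₁ w^{i₁} ⋯ d_k w^{i_k}`. -/
def monom {R : Type*} [Ring R] (w : R) {k : ℕ} (d : Fin k → R) (i : Fin (k + 1) → ℕ) : R :=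
  w ^ i 0 * (List.ofFn fun j : Fin k => d j * w ^ i j.succ).prod

theorem monom_cons {R : Type*} [Ring R] (w : R) {k : ℕ} (d : Fin (k + 1) → R) (s : ℕ)
    (i : Fin (k + 1) → ℕ) : monom w d (Fin.cons s i : Fin (k + 2) → ℕ) =
      w ^ s * d 0 * monom w (Fin.tail d) i := by
  rw [monom, monom, List.ofFn_succ, List.prod_cons]
  simp only [Fin.cons_zero, Fin.cons_succ, mul_assoc]
  rfl

/-- As `G = ∑ wⁱ zⁱ`, the coefficient of `z^s` distributes the exponent `s` over the `k + 1`
resolvents; this gives the sums in the definition of the character. -/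
theorem coeff_word (s : ℕ) : ∀ (k : ℕ) (a : Fin k → A), coeff s (word E.G E.x k a) =
    ∑ i ∈ Finset.Nat.antidiagonalTuple (k + 1) s, monom E.w (fun j => E.d (a j)) i
  | 0, a => by
    rw [word, Finset.Nat.antidiagonalTuple_one, Finset.sum_singleton, G, coeff_mk]
    simp [monom]
  | k + 1, a => by
    rw [word, sum_antidiagonalTuple_succ, coeff_mul]
    refine Finset.sum_congr rfl fun q _ => ?_
    rw [coeff_word q.2 k, x, coeff_mul_C, G, coeff_mk, Finset.mul_sum]
    refine Finset.sum_congr rfl fun i _ => ?_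
    rw [monom_cons]
    rfl

theorem word_one (k : ℕ) (a : Fin k → A) :
    word 1 E.d k a = (List.ofFn fun j => E.d (a j)).prod := by
  rw [word_eq_list_prod, one_mul, List.map_ofFn]
  simp only [mul_one]
  rfl

end TracedModule

end CyclicCharacter

end

noncomputable section

namespace CyclicCharacter

/-! ### The Schatten filtration and the trace on it. -/

section Weights

variable {K : Type*} [NormedAddCommGroup K] [InnerProductSpace ℂ K]

/-- The Schatten class as a subspace. -/
def schattenIdeal (p : ℝ) (hp : 0 < p) : Submodule ℂ (K →L[ℂ] K) where
  carrier := {T | IsSchatten p T}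
  zero_mem' := isSchatten_zero hp
  add_mem' hS hT := hS.add hp hT
  smul_mem' c T hT := by
    have h := IsSchatten.mul_left hp (c • (1 : K →L[ℂ] K)) hT
    rwa [smul_mul_assoc, one_mul] at h

/-- The operators of weight `k`: the Schatten class `𝓛^(p / k)`, and all operators if `k = 0`. -/
def weightIdeal (p : ℝ) (hp : 0 < p) (k : ℕ) : Submodule ℂ (K →L[ℂ] K) :=
  if hk : 0 < k then schattenIdeal (p / k) (div_pos hp (Nat.cast_pos.2 hk)) else ⊤

variable {p : ℝ} {hp : 0 < p}

theorem mem_weightIdeal {k : ℕ} (hk : 0 < k) {T : K →L[ℂ] K} :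
    T ∈ weightIdeal p hp k ↔ IsSchatten (p / k) T := by
  rw [weightIdeal, dif_pos hk]
  rfl

theorem mem_weightIdeal_zero (T : K →L[ℂ] K) : T ∈ weightIdeal p hp 0 := by
  rw [weightIdeal, dif_neg (lt_irrefl 0)]
  trivial

theorem weightIdeal_antitone : Antitone (weightIdeal (K := K) p hp) := by
  intro k l hkl T hT
  rcases Nat.eq_zero_or_pos k with rfl | hk
  · exact mem_weightIdeal_zero T
  · have hl := hk.trans_le hkl
    have hl' : (0 : ℝ) < l := Nat.cast_pos.2 hl
    rw [mem_weightIdeal hk]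
    exact ((mem_weightIdeal hl).1 hT).mono (by positivity)
      (div_le_div_of_nonneg_left hp.le (Nat.cast_pos.2 hk) (Nat.cast_le.2 hkl))

theorem mul_mem_weightIdeal {k l : ℕ} {S T : K →L[ℂ] K} (hS : S ∈ weightIdeal p hp k)
    (hT : T ∈ weightIdeal p hp l) : S * T ∈ weightIdeal p hp (k + l) := by
  rcases Nat.eq_zero_or_pos k with rfl | hk
  · rcases Nat.eq_zero_or_pos l with rfl | hl
    · exact mem_weightIdeal_zero _
    · rw [zero_add, mem_weightIdeal hl]
      exact ((mem_weightIdeal hl).1 hT).mul_left (div_pos hp (Nat.cast_pos.2 hl)) S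
  · rcases Nat.eq_zero_or_pos l with rfl | hl
    · rw [add_zero, mem_weightIdeal hk]
      exact ((mem_weightIdeal hk).1 hS).mul_right (div_pos hp (Nat.cast_pos.2 hk)) T
    · rw [mem_weightIdeal (by omega), Nat.cast_add]
      exact IsSchatten.mul hp (Nat.cast_pos.2 hk) (Nat.cast_pos.2 hl) ((mem_weightIdeal hk).1 hS)
        ((mem_weightIdeal hl).1 hT)

theorem mul_mem_weightIdeal_left {k : ℕ} (S : K →L[ℂ] K) {T : K →L[ℂ] K}
    (hT : T ∈ weightIdeal p hp k) : S * T ∈ weightIdeal p hp k := by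
  simpa using mul_mem_weightIdeal (mem_weightIdeal_zero (p := p) (hp := hp) S) hT

include hp in
theorem natCast_pos_of_le {k : ℕ} (hk : p ≤ k) : 0 < k := Nat.cast_pos.1 (hp.trans_le hk)

theorem isSchatten_one_of_mem {k : ℕ} (hk : p ≤ k) {T : K →L[ℂ] K} (hT : T ∈ weightIdeal p hp k) :
    IsSchatten 1 T := by
  have hk0 : 0 < k := natCast_pos_of_le (hp := hp) hk
  have hk' : (0 : ℝ) < k := Nat.cast_pos.2 hk0
  exact ((mem_weightIdeal hk0).1 hT).mono (by positivity) ((div_le_one hk').2 hk)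

variable [CompleteSpace K]

/-- If both weights are positive, `S` and `T` lie in the Schatten classes of the conjugate exponents
`(k+l)/k` and `(k+l)/l`, which suffices for `opTrace_mul_comm`. -/
theorem opTrace_comm_of_mem {k l : ℕ} (hkl : p ≤ (k + l : ℕ)) {S T : K →L[ℂ] K}
    (hS : S ∈ weightIdeal p hp k) (hT : T ∈ weightIdeal p hp l) :
    opTrace (S * T) = opTrace (T * S) := by
  rcases Nat.eq_zero_or_pos k with rfl | hk
  · rw [zero_add] at hkl
    exact opTrace_mul_comm_of_isSchatten (isSchatten_one_of_mem hkl hT) S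
  · rcases Nat.eq_zero_or_pos l with rfl | hl
    · rw [add_zero] at hkl
      exact (opTrace_mul_comm_of_isSchatten (isSchatten_one_of_mem hkl hS) T).symm
    · have hk' : (0 : ℝ) < k := Nat.cast_pos.2 hk
      have hl' : (0 : ℝ) < l := Nat.cast_pos.2 hl
      have h1 := (mem_weightIdeal hk).1 hS
      have h2 := (mem_weightIdeal hl).1 hT
      push_cast at hkl
      refine opTrace_mul_comm (summable_mul_of_rpow hk' hl' rfl (singularNumber_nonneg S)
        (singularNumber_nonneg T) ?_ ?_) (h1.tendsto_zero (by positivity))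
      · exact h1.mono (by positivity) (by gcongr)
      · exact h2.mono (by positivity) (by gcongr)

/-- A `TracedModule` needs a functional on the whole algebra. Any linear extension of the trace will
do, since its trace identities and the final formulas use it on trace class operators only. -/
theorem exists_traceExt : ∃ T : (K →L[ℂ] K) →ₗ[ℂ] ℂ, ∀ S, IsSchatten 1 S → T S = opTrace S := by
  let t : schattenIdeal (K := K) 1 one_pos →ₗ[ℂ] ℂ :=
    { toFun := fun S => opTrace S.1
      map_add' := fun S T => opTrace_add S.2 T.2
      map_smul' := fun c S => opTrace_smul c S.1 }
  obtain ⟨T, hT⟩ := LinearMap.exists_extend t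
  exact ⟨T, fun S hS => congrArg (fun f => f (⟨S, hS⟩ : schattenIdeal (K := K) 1 one_pos)) hT⟩

variable (K) in
/-- A linear functional on all bounded operators that extends the trace. -/
def traceExt : (K →L[ℂ] K) →ₗ[ℂ] ℂ := exists_traceExt.choose

theorem traceExt_apply {S : K →L[ℂ] K} (hS : IsSchatten 1 S) : traceExt K S = opTrace S :=
  exists_traceExt.choose_spec S hS

/-- The conjugation by an involution. -/
def conjBy (g : K →L[ℂ] K) (hg : g * g = 1) : (K →L[ℂ] K) →ₐ[ℂ] (K →L[ℂ] K) :=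
  AlgHom.ofLinearMap (LinearMap.mulLeft ℂ g ∘ₗ LinearMap.mulRight ℂ g)
    (by rw [LinearMap.comp_apply, LinearMap.mulLeft_apply, LinearMap.mulRight_apply, one_mul, hg])
    (fun S T => by
      simp only [LinearMap.comp_apply, LinearMap.mulLeft_apply, LinearMap.mulRight_apply]
      have h : g * (S * g) * (g * (T * g)) = g * S * (g * g) * (T * g) := by noncomm_ring
      rw [h, hg]
      noncomm_ring)

omit [CompleteSpace K] in
theorem conjBy_apply (g : K →L[ℂ] K) (hg : g * g = 1) (S : K →L[ℂ] K) :
    conjBy g hg S = g * (S * g) := rfl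

end Weights

section SchattenModule

variable {A : Type*} [Ring A] [Algebra ℂ A]
variable {K : Type*} [NormedAddCommGroup K] [InnerProductSpace ℂ K] [CompleteSpace K]

/-- The traced module of a summable Fredholm module with the grading operator `g`, which is the
identity for modules without grading. -/
def schattenModule {p : ℝ} (hp : 0 < p) {g : K →L[ℂ] K} (hg : g * g = 1) {ε : ℂ} (hε : ε * ε = 1)
    (ρ : A →ₙₐ[ℂ] (K →L[ℂ] K)) (hρ : ∀ a, g * ρ a = ρ a * g) {F : K →L[ℂ] K}
    (hF : g * F = ε • (F * g)) (hd : ∀ a, IsSchatten p (F * ρ a - ρ a * F))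
    (hw : IsSchatten (p / 2) (1 - F * F)) {N : ℕ} (hN : p ≤ N) :
    TracedModule A (K →L[ℂ] K) where
  J := weightIdeal p hp
  σ := conjBy g hg
  T := traceExt K ∘ₗ LinearMap.mulLeft ℂ g
  N := N
  ρ := ρ
  F := F
  ε := ε
  mem_zero := mem_weightIdeal_zero
  anti := weightIdeal_antitone
  mul_mem := mul_mem_weightIdeal
  cyclic {a b S T} hS hT hab := by
    have hab' : p ≤ (a + b : ℕ) := hN.trans (Nat.cast_le.2 hab)
    have hgS := mul_mem_weightIdeal_left g hS
    have h1 : IsSchatten 1 (g * S * T) := isSchatten_one_of_mem hab' (mul_mem_weightIdeal hgS hT)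
    have h2 : IsSchatten 1 (T * (g * S)) :=
      isSchatten_one_of_mem (k := b + a) (by rwa [add_comm]) (mul_mem_weightIdeal hT hgS)
    -- The twist by `σ` is the conjugation by `g`: `Tr(gST) = Tr(TgS)`, and `TgS = g(gTg)S`.
    have h3 : g * (g * (T * g) * S) = T * (g * S) := by
      have h : g * (g * (T * g) * S) = g * g * (T * (g * S)) := by noncomm_ring
      rw [h, hg, one_mul]
    rw [conjBy_apply, LinearMap.comp_apply, LinearMap.comp_apply, LinearMap.mulLeft_apply,
      LinearMap.mulLeft_apply, h3, ← mul_assoc, traceExt_apply h1, traceExt_apply h2]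
    exact opTrace_comm_of_mem hab' hgS hT
  σ_ρ a := by rw [conjBy_apply, ← hρ, ← mul_assoc, hg, one_mul]
  σ_F := by
    have h : F * g = ε • (g * F) := by rw [hF, smul_smul, hε, one_smul]
    rw [conjBy_apply, h, mul_smul_comm, ← mul_assoc, hg, one_mul]
  ε_sq := hε
  comm_mem a := by
    rw [mem_weightIdeal one_pos, Nat.cast_one, div_one]
    exact hd a
  defect_mem := by
    rw [mem_weightIdeal two_pos]
    exact hw

end SchattenModule

/-! ### The doubled representation and the terms of the character. -/

section Identification

variable {A : Type*} [Ring A] [Algebra ℂ A]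
variable {H : Type*} [NormedAddCommGroup H] [InnerProductSpace ℂ H] [CompleteSpace H]

/-- The representation on `H ⊕ H` as a homomorphism of algebras. -/
def FredholmModule.doubleRepHom (E : FredholmModule A H) : A →ₙₐ[ℂ] (Double H →L[ℂ] Double H) where
  toFun := E.doubleRep
  map_smul' c a := by
    rw [FredholmModule.doubleRep, map_smul, MonoidHom.id_apply, FredholmModule.doubleRep,
      diagOp_smul, smul_zero]
  map_zero' := by rw [FredholmModule.doubleRep, map_zero, diagOp_zero]
  map_add' a b := by
    simp only [FredholmModule.doubleRep, map_add, diagOp_add, add_zero]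
  map_mul' a b := by
    simp only [FredholmModule.doubleRep, map_mul, diagOp_mul, mul_zero]

omit [CompleteSpace H] in
theorem diagOp_pow (S T : H →L[ℂ] H) (n : ℕ) : diagOp S T ^ n = diagOp (S ^ n) (T ^ n) := by
  induction n with
  | zero => simp only [pow_zero, diagOp_one]
  | succ n ih => rw [pow_succ, pow_succ, pow_succ, ih, diagOp_mul]

omit [CompleteSpace H] in
theorem diagOp_list_prod {k : ℕ} (S T : Fin k → H →L[ℂ] H) :
    (List.ofFn fun j => diagOp (S j) (T j)).prod = diagOp (List.ofFn S).prod (List.ofFn T).prod := by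
  induction k with
  | zero => simp only [List.ofFn_zero, List.prod_nil, diagOp_one]
  | succ k ih => rw [List.ofFn_succ, List.ofFn_succ, List.ofFn_succ, List.prod_cons, List.prod_cons,
      List.prod_cons, ih, diagOp_mul]

omit [CompleteSpace H] in
theorem diagOp_monom (w : H →L[ℂ] H) {k : ℕ} (d : Fin k → H →L[ℂ] H) (i : Fin (k + 1) → ℕ) :
    TracedModule.monom (diagOp w w) (fun j => diagOp (d j) 0) i =
      diagOp (TracedModule.monom w d i) (TracedModule.monom w (fun _ => 0) i) := by
  simp only [TracedModule.monom, diagOp_pow, diagOp_mul, diagOp_list_prod]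

omit [CompleteSpace H] in
theorem monom_mem_weightIdeal {p : ℝ} {hp : 0 < p} {w : H →L[ℂ] H} (hw : w ∈ weightIdeal p hp 2)
    {k : ℕ} {d : Fin k → H →L[ℂ] H} (hd : ∀ j, d j ∈ weightIdeal p hp 1) (i : Fin (k + 1) → ℕ) :
    TracedModule.monom w d i ∈ weightIdeal p hp (k + 2 * ∑ j, i j) := by
  have hpow : ∀ n, w ^ n ∈ weightIdeal p hp (2 * n) := fun n => by
    induction n with
    | zero => exact mem_weightIdeal_zero _
    | succ n ih => rw [pow_succ]; exact mul_mem_weightIdeal ih hw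
  induction k with
  | zero =>
    simp only [TracedModule.monom, List.ofFn_zero, List.prod_nil, mul_one, zero_add]
    exact hpow _
  | succ k ih =>
    rw [← Fin.cons_self_tail i, TracedModule.monom_cons, Fin.sum_univ_succ]
    simp only [Fin.cons_zero, Fin.cons_succ]
    have h := mul_mem_weightIdeal (mul_mem_weightIdeal (hpow (i 0)) (hd 0))
      (ih (fun j => hd j.succ) (Fin.tail i))
    rw [show k + 1 + 2 * (i 0 + ∑ j, Fin.tail i j) = 2 * i 0 + 1 + (k + 2 * ∑ j, Fin.tail i j) by
      ring]
    exact h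

variable (E : FredholmModule A H)

theorem FredholmModule.term_eq {k : ℕ} (a : Fin (k + 1) → A) (i : Fin (k + 1) → ℕ) :
    E.term a i = E.rep (a 0) *
      TracedModule.monom (1 - E.F ^ 2) (fun j : Fin k => ⁅E.F, E.rep (a j.succ)⁆) i := by
  rw [FredholmModule.term, TracedModule.monom, mul_assoc]

variable {E} {p : ℝ}

theorem FredholmModule.isSchatten_term (hp : 0 < p) (hE : E.IsSummable p) (γ : H →L[ℂ] H)
    {k r : ℕ} (hkr : p ≤ (2 * r + k : ℕ)) (a : Fin (k + 1) → A) {i : Fin (k + 1) → ℕ}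
    (hi : i ∈ Finset.Nat.antidiagonalTuple (k + 1) r) : IsSchatten 1 (γ * E.term a i) := by
  rw [Finset.Nat.mem_antidiagonalTuple] at hi
  have hw : 1 - E.F ^ 2 ∈ weightIdeal p hp 2 := by
    rw [mem_weightIdeal two_pos, ← neg_sub, ← neg_one_mul]
    have h : (0 : ℝ) < p / (2 : ℕ) := by positivity
    exact IsSchatten.mul_left h _ hE.2
  have hd : ∀ j : Fin k, ⁅E.F, E.rep (a j.succ)⁆ ∈ weightIdeal p hp 1 := fun j => by
    rw [mem_weightIdeal one_pos, Nat.cast_one, div_one]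
    exact hE.1 _
  have h := monom_mem_weightIdeal hw hd i
  rw [hi, add_comm] at h
  rw [E.term_eq, ← mul_assoc]
  exact isSchatten_one_of_mem hkr (mul_mem_weightIdeal_left _ h)

end Identification

end CyclicCharacter

end

/-! ### The characters of a Fredholm module and of its double. -/

noncomputable section

namespace CyclicCharacter

open PowerSeries

variable {A : Type*} [Ring A] [Algebra ℂ A]
variable {H : Type*} [NormedAddCommGroup H] [InnerProductSpace ℂ H] [CompleteSpace H]

theorem HP.mk_eq_mk {i : ZMod 2} {c c' : CochainFamily A} (hc : c ∈ periodicCocycles A i)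
    (hc' : c' ∈ periodicCocycles A i) (h : c - c' ∈ periodicCoboundaries A i) :
    HP.mk c hc = HP.mk c' hc' :=
  (Submodule.Quotient.eq _).2 h

/-- A grading of a Fredholm module and of its double, of parity `ε`: `F` and `F̃` are even for
`ε = 1` and odd for `ε = -1`. Modules without grading have trivial gradings. -/
structure Graded (E : FredholmModule A H) (p : ℝ) (γ γ' : H →L[ℂ] H) (ε : ℂ)
    (Ft : Double H →L[ℂ] Double H) : Prop where
  summable : E.IsSummable p
  γ_sq : γ * γ = 1
  γ'_sq : γ' * γ' = 1
  ε_sq : ε * ε = 1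
  rep_comm : ∀ a, γ * E.rep a = E.rep a * γ
  F_comm : γ * E.F = ε • (E.F * γ)
  F_comm' : γ' * E.F = ε • (E.F * γ')
  double : E.IsDouble p Ft
  Ft_comm : diagOp γ γ' * Ft = ε • (Ft * diagOp γ γ')

namespace Graded

variable {E : FredholmModule A H} {p : ℝ} {γ γ' : H →L[ℂ] H} {ε : ℂ}
variable {Ft : Double H →L[ℂ] Double H} (h : Graded E p γ γ' ε Ft) (hp : 0 < p)

theorem lie_eq (a : A) : diagOp E.F (-E.F) * E.doubleRep a - E.doubleRep a * diagOp E.F (-E.F) =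
    diagOp ⁅E.F, E.rep a⁆ 0 := by
  rw [FredholmModule.doubleRep, diagOp_mul, diagOp_mul, diagOp_sub, mul_zero, zero_mul, sub_zero]
  rfl

theorem defect_eq : 1 - diagOp E.F (-E.F) * diagOp E.F (-E.F) =
    diagOp (1 - E.F ^ 2) (1 - E.F ^ 2) := by
  rw [diagOp_mul, neg_mul_neg, ← diagOp_one, diagOp_sub, sq]

include h hp

theorem defect_mem : IsSchatten (p / 2) (1 - E.F ^ 2) := by
  have h1 := IsSchatten.mul_left (half_pos hp) (-1) h.summable.2
  rwa [neg_one_mul, neg_sub] at h1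

/-- The traced module of the operator `F ⊕ (-F)`. -/
def module : TracedModule A (Double H →L[ℂ] Double H) :=
  schattenModule hp (g := diagOp γ γ') (by rw [diagOp_mul, h.γ_sq, h.γ'_sq, diagOp_one]) h.ε_sq
    E.doubleRepHom
    (fun a => by
      change diagOp γ γ' * diagOp (E.rep a) 0 = diagOp (E.rep a) 0 * diagOp γ γ'
      rw [diagOp_mul, diagOp_mul, h.rep_comm, mul_zero, zero_mul])
    (F := diagOp E.F (-E.F))
    (by rw [diagOp_mul, diagOp_mul, diagOp_smul, h.F_comm, mul_neg, h.F_comm', neg_mul, smul_neg])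
    (fun a => by
      have h1 := IsSchatten.diagOp_left hp (h.summable.1 a)
      rwa [← lie_eq] at h1)
    (by rw [defect_eq]; exact IsSchatten.diagOp (by positivity) (h.defect_mem hp) (h.defect_mem hp))
    (N := ⌈p⌉₊) (Nat.le_ceil p)

theorem perturbation_mem : Ft - diagOp E.F (-E.F) ∈ (h.module hp).J 1 := by
  change _ ∈ weightIdeal p hp 1
  rw [mem_weightIdeal one_pos, Nat.cast_one, div_one]
  exact h.double.2

theorem perturbation_σ : (h.module hp).σ (Ft - diagOp E.F (-E.F)) =
    (h.module hp).ε • (Ft - diagOp E.F (-E.F)) := by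
  have hg : diagOp γ γ' * diagOp γ γ' = 1 := by rw [diagOp_mul, h.γ_sq, h.γ'_sq, diagOp_one]
  have h1 : (h.module hp).σ Ft = (h.module hp).ε • Ft := by
    change diagOp γ γ' * (Ft * diagOp γ γ') = ε • Ft
    rw [← mul_assoc, h.Ft_comm, smul_mul_assoc, mul_assoc, hg, mul_one]
  have h2 : (h.module hp).σ (diagOp E.F (-E.F)) = (h.module hp).ε • diagOp E.F (-E.F) :=
    (h.module hp).σ_F
  rw [map_sub, smul_sub, h1, h2]

/-- Weight `2` does not follow from `V ∈ 𝓛^p`. It comes from `(F' + V)² = 1`, which gives `F'V + VF'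
= (1 - F'²) - V²`. -/
theorem perturbation_sd_mem : (h.module hp).F * (Ft - diagOp E.F (-E.F)) +
    (Ft - diagOp E.F (-E.F)) * (h.module hp).F ∈ (h.module hp).J 2 := by
  change diagOp E.F (-E.F) * (Ft - diagOp E.F (-E.F)) +
    (Ft - diagOp E.F (-E.F)) * diagOp E.F (-E.F) ∈ (h.module hp).J 2
  set V := Ft - diagOp E.F (-E.F) with hV
  have h1 : diagOp E.F (-E.F) * V + V * diagOp E.F (-E.F) =
      (1 - diagOp E.F (-E.F) * diagOp E.F (-E.F)) - V * V := by
    have h2 : (1 : Double H →L[ℂ] Double H) =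
        (V + diagOp E.F (-E.F)) * (V + diagOp E.F (-E.F)) := by
      rw [hV, sub_add_cancel, ← sq, h.double.1]
    rw [h2]
    noncomm_ring
  rw [h1]
  exact sub_mem (h.module hp).defect_mem
    ((h.module hp).mul_mem (h.perturbation_mem hp) (h.perturbation_mem hp))

theorem F_add : (h.module hp).F + (Ft - diagOp E.F (-E.F)) = Ft := by
  change diagOp E.F (-E.F) + (Ft - diagOp E.F (-E.F)) = Ft
  abel

/-- The character of `F` in terms of operators on `H`. -/
theorem φ_eq {N : ℕ} (hN : p ≤ N) (hN' : (h.module hp).N ≤ N) {k r : ℕ} (hkr : 2 * r + k = N)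
    (a : Fin (k + 1) → A) : ((h.module hp).withN N hN').φ k a =
      ((r + k).factorial : ℂ)⁻¹ *
        ∑ i ∈ Finset.Nat.antidiagonalTuple (k + 1) r, opTrace (γ * E.term a i) := by
  set M := (h.module hp).withN N hN'
  rw [TracedModule.φ, M.charTr_of_eq (r := r) hkr, LinearMap.smul_apply, smul_eq_mul,
    TracedModule.Tr_apply, TracedModule.r, coeff_C_mul, TracedModule.coeff_word, Finset.mul_sum,
    map_sum]
  congr 1
  refine Finset.sum_congr rfl fun i hi => ?_
  have h1 : ∀ j : Fin k, M.d (Fin.tail a j) = diagOp ⁅E.F, E.rep (a j.succ)⁆ 0 := fun j =>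
    lie_eq (E := E) (a j.succ)
  have h2 : M.w = diagOp (1 - E.F ^ 2) (1 - E.F ^ 2) := defect_eq
  simp only [h1, h2, diagOp_monom]
  have h3 : M.T (M.ρ (a 0) * diagOp
      (TracedModule.monom (1 - E.F ^ 2) (fun j : Fin k => ⁅E.F, E.rep (a j.succ)⁆) i)
      (TracedModule.monom (1 - E.F ^ 2) (fun _ : Fin k => 0) i)) =
      traceExt (Double H) (diagOp γ γ' * (diagOp (E.rep (a 0)) 0 * diagOp
      (TracedModule.monom (1 - E.F ^ 2) (fun j : Fin k => ⁅E.F, E.rep (a j.succ)⁆) i)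
      (TracedModule.monom (1 - E.F ^ 2) (fun _ : Fin k => 0) i))) := rfl
  have h4 := FredholmModule.isSchatten_term hp h.summable γ (hkr ▸ hN) a hi
  -- In the second copy of `H` powers of `1 - F²` may survive in the word; the leading factor `a₀ ⊕
  -- 0` removes them.
  rw [h3, diagOp_mul, diagOp_mul, ← E.term_eq, zero_mul, mul_zero,
    traceExt_apply (h4.diagOp_left one_pos), opTrace_diagOp h4]

/-- The traced module of the operator `F̃`. -/
def squareModule : TracedModule A (Double H →L[ℂ] Double H) :=
  (h.module hp).shift (Ft - diagOp E.F (-E.F)) (h.perturbation_mem hp) (h.perturbation_σ hp)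
    (h.perturbation_sd_mem hp)

theorem squareModule_F : (h.squareModule hp).F = Ft := h.F_add hp

theorem squareModule_sq : (h.squareModule hp).F * (h.squareModule hp).F = 1 := by
  rw [squareModule_F, ← sq, h.double.1]

theorem doubleTerm_eq {n : ℕ} (a : Fin (n + 1) → A) : E.doubleTerm Ft a =
    (h.squareModule hp).ρ (a 0) * word 1 (h.squareModule hp).d n (Fin.tail a) := by
  rw [TracedModule.word_one, FredholmModule.doubleTerm]
  congr 3
  funext j
  rw [TracedModule.d_apply, squareModule_F]
  rfl

omit h hp in
theorem symmetrize_eq {R : Type*} [Ring R] [Algebra ℂ R] {ε : ℂ} (hε : ε * ε = 1)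
    {f g a D : R} (hg : f * g = ε • (g * f)) (hD : D * f = -(ε • (f * D))) :
    f * (f * (g * (a * D)) + g * (a * D) * f) = g * (f * ((f * a - a * f) * D)) := by
  have h1 : f * (g * (a * D)) = ε • (g * (f * (a * D))) := by
    rw [← mul_assoc, hg, smul_mul_assoc, mul_assoc]
  have h2 : g * (a * D) * f = -(ε • (g * (a * (f * D)))) := by
    rw [mul_assoc, mul_assoc, hD]
    simp only [mul_neg, mul_smul_comm]
  have h3 : f * (g * (a * D)) + g * (a * D) * f = ε • (g * ((f * a - a * f) * D)) := by
    rw [h1, h2, ← sub_eq_add_neg, ← smul_sub, ← mul_sub, sub_mul, mul_assoc, mul_assoc]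
  rw [h3, mul_smul_comm, ← mul_assoc f, hg, smul_mul_assoc, smul_smul, hε, one_smul, mul_assoc]

/-- Moving `F̃` across the grading and the `n` commutators converts `F̃T + TF̃` into a further
commutator `[F̃, a₀]`. The operator has weight `n + 1`, so `p ≤ n + 1` suffices for the regularised
trace. -/
theorem connes_eq {n : ℕ} (hε : ε = (-1) ^ (n + 1)) (a : Fin (n + 1) → A) :
    Ft * (Ft * (diagOp γ γ' * E.doubleTerm Ft a) + diagOp γ γ' * E.doubleTerm Ft a * Ft) =
      diagOp γ γ' * ((h.squareModule hp).F * word 1 (h.squareModule hp).d (n + 1) a) := by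
  have h1 := TracedModule.F_mul_word (h.squareModule_sq hp) n (Fin.tail a)
  have h2 : word 1 (h.squareModule hp).d (n + 1) a = (Ft * (h.squareModule hp).ρ (a 0) -
      (h.squareModule hp).ρ (a 0) * Ft) * word 1 (h.squareModule hp).d n (Fin.tail a) := by
    rw [word, one_mul, TracedModule.d_apply, squareModule_F]
  rw [h.doubleTerm_eq hp, h2]
  rw [squareModule_F] at h1 ⊢
  set D := word 1 (h.squareModule hp).d n (Fin.tail a)
  set a₀ := (h.squareModule hp).ρ (a 0)
  set g := diagOp γ γ'
  have h3 : Ft * g = ε • (g * Ft) := by rw [h.Ft_comm, smul_smul, h.ε_sq, one_smul]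
  have h4 : D * Ft = -(ε • (Ft * D)) := by
    have h5 : ε * (-1) ^ n = -1 := by
      rw [hε, ← pow_add, show n + 1 + n = 2 * n + 1 by ring]
      exact Odd.neg_one_pow ⟨n, rfl⟩
    rw [h1, smul_smul, h5]
    exact neg_eq_iff_eq_neg.1 (neg_one_smul ℂ (D * Ft)).symm
  exact symmetrize_eq h.ε_sq h3 h4

theorem isSchatten_connes {n : ℕ} (hn : p ≤ (n + 1 : ℕ)) (hε : ε = (-1) ^ (n + 1))
    (a : Fin (n + 1) → A) : IsSchatten 1
      (Ft * (Ft * (diagOp γ γ' * E.doubleTerm Ft a) + diagOp γ γ' * E.doubleTerm Ft a * Ft)) := by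
  rw [h.connes_eq hp hε]
  exact isSchatten_one_of_mem (hp := hp) hn (mul_mem_weightIdeal_left _ (mul_mem_weightIdeal_left _
    (TracedModule.word_mem (E := h.squareModule hp) (n + 1) a)))

theorem conn_eq {n : ℕ} (hn : p ≤ (n + 1 : ℕ)) (hε : ε = (-1) ^ (n + 1)) (a : Fin (n + 1) → A) :
    (h.squareModule hp).conn n a = 2 * connesTrace Ft (diagOp γ γ' * E.doubleTerm Ft a) := by
  have h1 : (h.squareModule hp).conn n a = traceExt (Double H)
    (diagOp γ γ' * ((h.squareModule hp).F * word 1 (h.squareModule hp).d (n + 1) a)) := rfl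
  rw [h1, ← h.connes_eq hp hε, traceExt_apply (h.isSchatten_connes hp hn hε a), connesTrace]
  ring

/-- The character of `F` and Connes' character of `F̃` are cohomologous. -/
theorem character_eq (c : ℂ) {N n : ℕ} (hN : p ≤ N) (hn : p ≤ (n + 1 : ℕ)) {i : ZMod 2}
    (hNi : (N : ZMod 2) = i) (hni : (n : ZMod 2) = i) (hεN : ε = (-1) ^ (N + 1))
    (hεn : ε = (-1) ^ (n + 1)) {ch co : CochainFamily A}
    (hch : ∀ k r, 2 * r + k = N → ∀ a : Fin (k + 1) → A, ch k a =
      TracedModule.kappa c N * N.factorial / ((r + k).factorial : ℂ) *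
        ∑ i ∈ Finset.Nat.antidiagonalTuple (k + 1) r, opTrace (γ * E.term a i))
    (hch0 : ∀ k, (¬ ∃ r, 2 * r + k = N) → ch k = 0)
    (hco : ∀ a : Fin (n + 1) → A, co n a =
      TracedModule.kappa c n * connesTrace Ft (diagOp γ γ' * E.doubleTerm Ft a))
    (hco0 : ∀ k, k ≠ n → co k = 0) :
    ∃ (h : ch ∈ periodicCocycles A i) (h' : co ∈ periodicCocycles A i),
      HP.mk ch h = HP.mk co h' := by
  have hN' : (h.module hp).N ≤ N := Nat.ceil_le.2 hN
  have hn' : (h.module hp).N ≤ n + 1 := Nat.ceil_le.2 hn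
  obtain ⟨h1, h2, h3⟩ := TracedModule.char_sub_conn (E := h.module hp)
    (hV := h.perturbation_mem hp) (hσ := h.perturbation_σ hp) (hV' := h.perturbation_sd_mem hp)
    (h.squareModule_sq hp)
    -- The unit acts by `1 ⊕ 0`, which commutes with `F ⊕ (-F)`.
    (by change diagOp E.F (-E.F) * diagOp (E.rep 1) 0 = diagOp (E.rep 1) 0 * diagOp E.F (-E.F)
        rw [diagOp_mul, diagOp_mul, map_one, mul_zero, zero_mul, mul_one, one_mul])
    c hN' hn' hεN (hNi.trans hni.symm)
  have e1 : (TracedModule.kappa c N * N.factorial) • ((h.module hp).withN N hN').φ = ch := by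
    funext k a
    rw [Pi.smul_apply, Pi.smul_apply, smul_eq_mul]
    by_cases hk : ∃ r, 2 * r + k = N
    · obtain ⟨r, hr⟩ := hk
      rw [h.φ_eq hp hN hN' hr, hch k r hr, div_eq_mul_inv]
      ring
    · rw [hch0 k hk, TracedModule.φ, TracedModule.charTr, if_neg, LinearMap.zero_apply, mul_zero]
      · rfl
      · rintro ⟨h4, r, hr⟩
        have h5 : ((h.module hp).withN N hN').N = N := rfl
        exact hk ⟨r, by omega⟩
  have e2 : (TracedModule.kappa c n / 2) • cut n (h.squareModule hp).conn = co := by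
    funext k a
    by_cases hk : k = n
    · subst hk
      rw [Pi.smul_apply, cut_self, Pi.smul_apply, h.conn_eq hp hn hεn, hco, smul_eq_mul]
      ring
    · rw [Pi.smul_apply, cut_of_ne hk, hco0 k hk, smul_zero]
  rw [hNi, e1] at h1 h2
  rw [hNi] at h3
  have e2' : (TracedModule.kappa c n / 2) • cut n ((h.module hp).shift (Ft - diagOp E.F (-E.F))
    (h.perturbation_mem hp) (h.perturbation_σ hp) (h.perturbation_sd_mem hp)).conn = co := e2
  rw [e2'] at h1 h3
  exact ⟨h2, h3, HP.mk_eq_mk h2 h3 h1⟩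

end Graded

theorem kappa_mul_factorial (c : ℂ) (n : ℕ) : TracedModule.kappa c n * n.factorial =
    c * (Real.Gamma ((n : ℝ) / 2 + 1) : ℂ) :=
  div_mul_cancel₀ _ (Nat.cast_ne_zero.2 n.factorial_ne_zero)

end CyclicCharacter

end

noncomputable section

namespace CyclicCharacter

variable {A : Type*} [Ring A] [Algebra ℂ A]
variable {H : Type*} [NormedAddCommGroup H] [InnerProductSpace ℂ H] [CompleteSpace H]

theorem EvenFredholmModule.graded (E : EvenFredholmModule A H) {p : ℝ} (hE : E.IsSummable p)
    {Ft : Double H →L[ℂ] Double H} (hFt : E.IsEvenDouble p Ft) :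
    Graded E.toFredholmModule p E.γ (-E.γ) (-1) Ft where
  summable := hE
  γ_sq := E.γ_mul_γ
  γ'_sq := (neg_mul_neg _ _).trans E.γ_mul_γ
  ε_sq := by norm_num
  rep_comm := E.rep_even
  F_comm := E.F_odd.trans (neg_one_smul ℂ _).symm
  F_comm' := by
    have h : -E.γ * E.F = -(E.F * -E.γ) := by rw [neg_mul, E.F_odd, mul_neg]
    exact h.trans (neg_one_smul ℂ _).symm
  double := hFt.1
  Ft_comm := hFt.2.trans (neg_one_smul ℂ _).symm

theorem FredholmModule.graded (E : FredholmModule A H) {p : ℝ} (hE : E.IsSummable p)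
    {Ft : Double H →L[ℂ] Double H} (hFt : E.IsDouble p Ft) : Graded E p 1 1 1 Ft where
  summable := hE
  γ_sq := one_mul 1
  γ'_sq := one_mul 1
  ε_sq := one_mul 1
  rep_comm _ := by rw [one_mul, mul_one]
  F_comm := by rw [one_mul, mul_one, one_smul]
  F_comm' := by rw [one_mul, mul_one, one_smul]
  double := hFt
  Ft_comm := by rw [diagOp_one, one_mul, mul_one, one_smul]

end CyclicCharacter

end

theorem mainTheorem5 {A : Type*} [Ring A] [Algebra ℂ A] {H : Type*} [NormedAddCommGroup H]
    [InnerProductSpace ℂ H] [CompleteSpace H] (p : ℝ) (hp : 0 < p) :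
    (∀ E : EvenFredholmModule A H, E.IsSummable p →
      (∃ Ft : Double H →L[ℂ] Double H, IsSelfAdjoint Ft ∧ E.IsEvenDouble p Ft) ∧
      ∀ Ft : Double H →L[ℂ] Double H, E.IsEvenDouble p Ft →
        ∀ m m' : ℕ, p ≤ 2 * m → p ≤ 2 * m' + 1 →
          E.CharacterTraceClass m ∧ E.ConnesTraceClass Ft m' ∧
          ∃ (h : E.character m ∈ periodicCocycles A 0)
            (h' : E.connesCharacter Ft m' ∈ periodicCocycles A 0),
            HP.mk (E.character m) h = HP.mk (E.connesCharacter Ft m') h') ∧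
    (∀ E : FredholmModule A H, E.IsSummable p →
      (∃ Ft : Double H →L[ℂ] Double H, IsSelfAdjoint Ft ∧ E.IsDouble p Ft) ∧
      ∀ Ft : Double H →L[ℂ] Double H, E.IsDouble p Ft →
        ∀ m m' : ℕ, p ≤ 2 * m + 1 → p ≤ 2 * m' + 2 →
          E.OddCharacterTraceClass m ∧ E.ConnesOddTraceClass Ft m' ∧
          ∃ (h : E.oddCharacter m ∈ periodicCocycles A 1)
            (h' : E.connesOddCharacter Ft m' ∈ periodicCocycles A 1),
            HP.mk (E.oddCharacter m) h = HP.mk (E.connesOddCharacter Ft m') h') := by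
  refine ⟨fun E hE => ⟨⟨symmetryOp E.F, symmetryOp_isSelfAdjoint E.F,
    ⟨symmetryOp_sq E.selfAdjoint_F, symmetryOp_sub hp E.selfAdjoint_F hE.2⟩,
    symmetryOp_odd E.selfAdjoint_γ E.γ_mul_γ E.selfAdjoint_F E.F_odd⟩,
    fun Ft hFt m m' hm hm' => ?_⟩, fun E hE => ⟨⟨symmetryOp E.F, symmetryOp_isSelfAdjoint E.F,
    symmetryOp_sq E.selfAdjoint_F, symmetryOp_sub hp E.selfAdjoint_F hE.2⟩,
    fun Ft hFt m m' hm hm' => ?_⟩⟩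
  · have hG : Graded E.toFredholmModule p E.γ (-E.γ) (-1) Ft :=
      EvenFredholmModule.graded E hE hFt
    have h1 : p ≤ (2 * m : ℕ) := by exact_mod_cast hm
    have h2 : p ≤ (2 * m' + 1 : ℕ) := by exact_mod_cast hm'
    have hε (n : ℕ) : (-1 : ℂ) = (-1) ^ (2 * n + 1) := (Odd.neg_one_pow ⟨n, rfl⟩).symm
    have hpar (n : ℕ) : ((2 * n : ℕ) : ZMod 2) = 0 :=
      (ZMod.natCast_eq_zero_iff_even).2 (even_two_mul n)
    -- In the degree `2n` the constant `Γ(n + 1)` is `n!`; in the odd case it is `Γ(n + 3/2)` and `c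
    -- = √(2i)`.
    have hκ (n : ℕ) : TracedModule.kappa 1 (2 * n) * (2 * n).factorial = n.factorial := by
      rw [kappa_mul_factorial, Nat.cast_mul, Nat.cast_two, mul_div_cancel_left₀ _ two_ne_zero,
        Real.Gamma_nat_eq_factorial, one_mul, Complex.ofReal_natCast]
    refine ⟨fun k hk hkm a i hi => ?_, fun a => hG.isSchatten_connes hp h2 (hε m') a,
      hG.character_eq hp 1 h1 h2 (hpar m) (hpar m') (hε m) (hε m') ?_ ?_ ?_ ?_⟩
    · obtain ⟨j, rfl⟩ := hk
      refine FredholmModule.isSchatten_term hp hE E.γ (h1.trans_eq ?_) a hi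
      congr 1
      omega
    · intro k r hr a
      have h3 : Even k ∧ k ≤ 2 * m := ⟨⟨m - r, by omega⟩, by omega⟩
      rw [EvenFredholmModule.character, if_pos h3, hκ, show m - k / 2 = r by omega,
        show m + k / 2 = r + k by omega]
    · rintro k hk
      funext a
      refine if_neg ?_
      rintro ⟨⟨j, rfl⟩, hkm⟩
      exact hk ⟨m - j, by omega⟩
    · intro a
      rw [EvenFredholmModule.connesCharacter, if_pos rfl, ← hκ m',
        mul_div_cancel_right₀ _ (Nat.cast_ne_zero.2 (Nat.factorial_ne_zero _))]
      rfl
    · rintro k hk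
      funext a
      exact if_neg hk
  · have hG : Graded E p 1 1 1 Ft := E.graded hE hFt
    have h1 : p ≤ (2 * m + 1 : ℕ) := by exact_mod_cast hm
    have h2 : p ≤ (2 * m' + 1 + 1 : ℕ) := hm'.trans_eq (by push_cast; ring)
    have hε (n : ℕ) : (1 : ℂ) = (-1) ^ (2 * n + 1 + 1) :=
      (Even.neg_one_pow ⟨n + 1, by ring⟩).symm
    have hpar (n : ℕ) : ((2 * n + 1 : ℕ) : ZMod 2) = 1 :=
      (ZMod.natCast_eq_one_iff_odd).2 ⟨n, rfl⟩
    have hκ (n : ℕ) : TracedModule.kappa ((2 * Complex.I) ^ (1 / 2 : ℂ)) (2 * n + 1) *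
        (2 * n + 1).factorial =
          (Real.Gamma (n + 3 / 2) : ℂ) * (2 * Complex.I) ^ (1 / 2 : ℂ) := by
      rw [kappa_mul_factorial, mul_comm,
        show ((2 * n + 1 : ℕ) : ℝ) / 2 + 1 = n + 3 / 2 by push_cast; ring]
    have hterm {k : ℕ} (a : Fin (k + 1) → A) (i : Fin (k + 1) → ℕ) :
        (1 : H →L[ℂ] H) * E.term a i = E.term a i := one_mul _
    have hdouble {k : ℕ} (a : Fin (k + 1) → A) :
        diagOp (1 : H →L[ℂ] H) 1 * E.doubleTerm Ft a = E.doubleTerm Ft a := by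
      rw [diagOp_one, one_mul]
    refine ⟨fun k hk hkm a i hi => ?_, fun a => ?_,
      hG.character_eq hp ((2 * Complex.I) ^ (1 / 2 : ℂ)) h1 h2 (hpar m) (hpar m') (hε m) (hε m')
        ?_ ?_ ?_ ?_⟩
    · obtain ⟨j, rfl⟩ := hk
      rw [← hterm]
      refine FredholmModule.isSchatten_term hp hE 1 (h1.trans_eq ?_) a hi
      congr 1
      omega
    · have h3 := hG.isSchatten_connes hp h2 (hε m') a
      rwa [hdouble] at h3
    · intro k r hr a
      have h3 : Odd k ∧ k ≤ 2 * m + 1 := ⟨⟨m - r, by omega⟩, by omega⟩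
      simp only [hterm]
      rw [FredholmModule.oddCharacter, if_pos h3, hκ, show m - (k - 1) / 2 = r by omega,
        show m + (k + 1) / 2 = r + k by omega]
    · rintro k hk
      funext a
      refine if_neg ?_
      rintro ⟨⟨j, rfl⟩, hkm⟩
      exact hk ⟨m - j, by omega⟩
    · intro a
      rw [FredholmModule.connesOddCharacter, if_pos rfl, ← hκ m',
        mul_div_cancel_right₀ _ (Nat.cast_ne_zero.2 (Nat.factorial_ne_zero _)), hdouble]
    · rintro k hk
      funext a
      exact if_neg hk
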